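/- For $\rho\ge 0$ let $L^\infty_\rho$ be the Banach space of (classes of) measurable functions $f:(1,\infty)\to\mathbb{C}$ with $\|f\|_{L^\infty_\rho}=\operatorname{ess\,sup}_{r>1} r^\rho|f(r)|<\infty$. Let $\operatorname{FX}(\mathbb{R},L^\infty_\rho)$ be the space of all functions $u:\mathbb{R}\to L^\infty_\rho$, $z\mapsto u(\cdot,z)$, of the form $$u(\cdot,z)=\frac{1}{(2\pi)^{1/2}}\int_{\mathbb{R}}e^{-\mathrm{i}z\zeta}g(\zeta)\,d\zeta+\sum_{m\in\mathbb{Z}}e^{\mathrm{i}mz}a_m,\qquad g\in L^1(\mathbb{R},L^\infty_\rho),\quad (a_m)\in\ell^1(\mathbb{Z},L^\infty_\rho),$$ with the norm $\|u\|_{\operatorname{FX}(L^\infty_\rho)}=\int_{\mathbb{R}}\|g(\zeta)\|_{L^\infty_\rho}\,d\zeta+\sum_{m}\|a_m\|_{L^\infty_\rho}$ (the pair $(g,(a_m))$ is determined by $u$). Derivatives are taken in the sense of distributions on $(1,\infty)\times\mathbb{R}$. **Corollary.** Let $2<\rho<3$. (1) For every $\omega\in\operatorname{FX}(\mathbb{R},L^\infty_\rho)$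 there is exactly one $\psi\in\operatorname{FX}(\mathbb{R},L^\infty_{\rho-2})$ such that $$-\Big(\partial_r^2+\frac1r\partial_r+\partial_z^2-\frac1{r^2}\Big)\psi=\omega\ \text{ in }(1,\infty)\times\mathbb{R},\qquad \psi=0\ \text{ on }\{1\}\times\mathbb{R},$$ where the boundary condition means that $\psi$ has a representative that is continuous on $[1,\infty)\times\mathbb{R}$ and vanishes on $\{1\}\times\mathbb{R}$. For this $\psi$ the axisymmetric Biot–Savart field $\mathcal{V}=\mathcal{V}[\omega]=\mathcal{V}^r\mathbf{e}_r+\mathcal{V}^z\mathbf{e}_z$, $$\mathcal{V}^r=-\partial_z\psi,\qquad \mathcal{V}^z=\frac1r\partial_r(r\psi),$$ is well defined: there is exactly one pair $(\mathcal{V}^r,\mathcal{V}^z)$ of elements of $\operatorname{FX}(\mathbb{R},L^\infty_{\rho-1})$ satisfying these equations. (2) There is a constant $C$ depending only on $\rho$ such that, for every $\omega\in\operatorname{FX}(\mathbb{R},L^\infty_\rho)$, the derivatives $\partial_r\mathcal{V}^r,\partial_z\mathcal{V}^r,\partial_r\mathcal{V}^z,\partial_z\mathcal{V}^z$ of $\mathcal{V}=\mathcal{V}[\omega]$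 belong to $\operatorname{FX}(\mathbb{R},L^\infty_\rho)$ and $$\|(\partial_r,\partial_z)^j\mathcal{V}\|_{\operatorname{FX}(L^\infty_{\rho-1+j})}\le C\,\|\omega\|_{\operatorname{FX}(L^\infty_\rho)},\qquad j=0,1,$$ where the norm on the left is the sum of the norms of the components. -/

import Mathlib

open MeasureTheory Set
open scoped ENNReal Distributions

noncomputable section

namespace AxiBiotSavart

/-- Lebesgue measure on the half line `(1, ∞)`, where the radial variable `r` lives. -/
abbrev radial : Measure ℝ := volume.restrict (Ioi (1 : ℝ))

/-- Classes (modulo null sets) of measurable functions `(1, ∞) → ℂ`. -/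
abbrev Profile : Type := ℝ →ₘ[radial] ℂ

/-- The weighted norm `ess sup_{r > 1} r ^ ρ |f r|`, with values in `[0, ∞]`. -/
def weightedSup (ρ : ℝ) (f : ℝ → ℂ) : ℝ≥0∞ :=
  essSup (fun r => ENNReal.ofReal (r ^ ρ) * ‖f r‖ₑ) radial

lemma weightedSup_eq (ρ : ℝ) (f : ℝ → ℂ) :
    weightedSup ρ f = eLpNorm (fun r => ((r ^ ρ : ℝ) : ℂ) * f r) ∞ radial := by
  rw [eLpNorm_exponent_top, eLpNormEssSup, weightedSup]
  refine essSup_congr_ae ?_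
  filter_upwards [ae_restrict_mem measurableSet_Ioi] with r hr
  have hr1 : (1 : ℝ) < r := hr
  have h0 : 0 ≤ r ^ ρ := Real.rpow_nonneg (by linarith) _
  simp only [enorm_mul]
  congr 1
  rw [← ofReal_norm, Complex.norm_real, Real.norm_of_nonneg h0]

lemma aesm_weight (ρ : ℝ) (f : Profile) :
    AEStronglyMeasurable (fun r => ((r ^ ρ : ℝ) : ℂ) * f r) radial := by
  refine AEStronglyMeasurable.mul ?_ f.aestronglyMeasurable
  have h : Measurable fun r : ℝ => ((r ^ ρ : ℝ) : ℂ) := by fun_prop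
  exact h.aestronglyMeasurable

lemma weightedSup_congr (ρ : ℝ) {f g : ℝ → ℂ} (h : f =ᵐ[radial] g) :
    weightedSup ρ f = weightedSup ρ g := by
  refine essSup_congr_ae ?_
  filter_upwards [h] with r hr
  rw [hr]

lemma weightedSup_add_le (ρ : ℝ) (f g : Profile) :
    weightedSup ρ (f + g : Profile) ≤ weightedSup ρ f + weightedSup ρ g := by
  rw [weightedSup_congr ρ (AEEqFun.coeFn_add f g), weightedSup_eq, weightedSup_eq, weightedSup_eq]
  have e : (fun r => ((r ^ ρ : ℝ) : ℂ) * (f + g : ℝ → ℂ) r) =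
      (fun r => ((r ^ ρ : ℝ) : ℂ) * f r) + fun r => ((r ^ ρ : ℝ) : ℂ) * g r := by
    funext r
    simp [mul_add]
  rw [e]
  exact eLpNorm_add_le (aesm_weight ρ f) (aesm_weight ρ g) le_top

lemma weightedSup_smul (ρ : ℝ) (c : ℂ) (f : Profile) :
    weightedSup ρ (c • f : Profile) = ‖c‖ₑ * weightedSup ρ f := by
  rw [weightedSup_congr ρ (AEEqFun.coeFn_smul c f), weightedSup_eq, weightedSup_eq,
    ← eLpNorm_const_smul]
  congr 1
  funext r
  simp only [Pi.smul_apply, smul_eq_mul]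
  ring

lemma weightedSup_zero (ρ : ℝ) : weightedSup ρ (0 : Profile) = 0 := by
  have h := weightedSup_smul ρ 0 0
  have e : (0 : ℂ) • (0 : Profile) = 0 := zero_smul ℂ (0 : Profile)
  rw [e] at h
  simpa using h

lemma eq_zero_of_weightedSup (ρ : ℝ) (f : Profile) (h : weightedSup ρ f = 0) : f = 0 := by
  rw [weightedSup_eq, eLpNorm_eq_zero_iff (aesm_weight ρ f) (by simp)] at h
  refine AEEqFun.ext ?_
  filter_upwards [h, ae_restrict_mem measurableSet_Ioi, AEEqFun.coeFn_zero (μ := radial) (β := ℂ)]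
    with r hr hr1 h0
  have hr1 : (1 : ℝ) < r := hr1
  have hpos : r ^ ρ ≠ 0 := (Real.rpow_pos_of_pos (by linarith) _).ne'
  rw [h0]
  simpa [hpos] using hr

/-- The weighted space `L^∞_ρ` of (complex-valued) functions on `(1, ∞)` with
`ess sup_{r > 1} r ^ ρ |f r| < ∞`.  For `ρ ≥ 0` such functions are automatically in
`L^∞(1, ∞)`. -/
def WLinf (ρ : ℝ) : Submodule ℂ Profile where
  carrier := {f | weightedSup ρ f < ∞}
  zero_mem' := by
    change weightedSup ρ (0 : Profile) < ∞
    rw [weightedSup_zero]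
    exact ENNReal.zero_lt_top
  add_mem' {f g} hf hg :=
    lt_of_le_of_lt (weightedSup_add_le ρ f g) (ENNReal.add_lt_top.2 ⟨hf, hg⟩)
  smul_mem' c f hf := by
    change weightedSup ρ (c • f : Profile) < ∞
    rw [weightedSup_smul]
    exact ENNReal.mul_lt_top enorm_lt_top hf

/-- `L^∞_ρ` with the norm `ess sup_{r > 1} r ^ ρ |f r|`. -/
instance instNormedAddCommGroup (ρ : ℝ) : NormedAddCommGroup (WLinf ρ) :=
  AddGroupNorm.toNormedAddCommGroup
    { toFun := fun f => (weightedSup ρ (f : Profile)).toReal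
      map_zero' := by simp [weightedSup_zero]
      add_le' := fun f g => by
        rw [← ENNReal.toReal_add f.2.ne g.2.ne]
        exact ENNReal.toReal_mono (ENNReal.add_lt_top.2 ⟨f.2, g.2⟩).ne
          (weightedSup_add_le ρ f g)
      neg' := fun f => by
        have h := weightedSup_smul ρ (-1) (f : Profile)
        have e : (-1 : ℂ) • (f : Profile) = -f := neg_one_smul ℂ (f : Profile)
        rw [e, enorm_neg, enorm_one, one_mul] at h
        rw [Submodule.coe_neg, h]
      eq_zero_of_map_eq_zero' := fun f hf => by
        rcases (ENNReal.toReal_eq_zero_iff _).1 hf with h | h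
        · exact Subtype.ext (eq_zero_of_weightedSup ρ _ h)
        · exact absurd h f.2.ne }

lemma norm_def (ρ : ℝ) (f : WLinf ρ) : ‖f‖ = (weightedSup ρ (f : Profile)).toReal := rfl

instance instNormedSpace (ρ : ℝ) : NormedSpace ℂ (WLinf ρ) where
  norm_smul_le c f := by
    rw [norm_def, norm_def, Submodule.coe_smul, weightedSup_smul, ENNReal.toReal_mul]
    simp

lemma memLp_weight (ρ : ℝ) (f : WLinf ρ) :
    MemLp (fun r => ((r ^ ρ : ℝ) : ℂ) * (f : Profile) r) ∞ radial :=
  ⟨aesm_weight ρ f, by rw [← weightedSup_eq]; exact f.2⟩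

/-- Multiplication by `r ^ ρ`, an isometry of `L^∞_ρ` onto `L^∞(1, ∞)`. -/
def toLinf (ρ : ℝ) (f : WLinf ρ) : Lp ℂ ∞ radial :=
  MemLp.toLp (fun r => ((r ^ ρ : ℝ) : ℂ) * (f : Profile) r) (memLp_weight ρ f)

lemma isometry_toLinf (ρ : ℝ) : Isometry (toLinf ρ) := by
  refine Isometry.of_dist_eq fun f g => ?_
  rw [dist_eq_norm, dist_eq_norm, norm_def, weightedSup_eq, toLinf, toLinf, ← MemLp.toLp_sub,
    Lp.norm_toLp]
  congr 1
  refine eLpNorm_congr_ae ?_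
  filter_upwards [AEEqFun.coeFn_sub (f : Profile) g] with r hr
  simp only [Pi.sub_apply, Submodule.coe_sub, hr]
  ring

lemma surjective_toLinf (ρ : ℝ) : Function.Surjective (toLinf ρ) := by
  intro F
  have hm : AEStronglyMeasurable (fun r : ℝ => ((r ^ (-ρ) : ℝ) : ℂ) * F r) radial :=
    aesm_weight (-ρ) F
  have key : (fun r => ((r ^ ρ : ℝ) : ℂ) * (AEEqFun.mk _ hm : Profile) r) =ᵐ[radial] F := by
    filter_upwards [AEEqFun.coeFn_mk _ hm, ae_restrict_mem measurableSet_Ioi] with r hr hr1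
    have hr1 : (1 : ℝ) < r := hr1
    rw [hr, ← mul_assoc, ← Complex.ofReal_mul, ← Real.rpow_add (by linarith)]
    simp
  refine ⟨⟨AEEqFun.mk _ hm, ?_⟩, ?_⟩
  · change weightedSup ρ _ < ∞
    rw [weightedSup_eq, eLpNorm_congr_ae key]
    exact F.2
  · refine Lp.ext ?_
    exact (MemLp.coeFn_toLp _).trans key

instance instCompleteSpace (ρ : ℝ) : CompleteSpace (WLinf ρ) :=
  (completeSpace_congr (e := Equiv.ofBijective (toLinf ρ)
    ⟨(isometry_toLinf ρ).injective, surjective_toLinf ρ⟩)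
    (isometry_toLinf ρ).isUniformEmbedding).2 inferInstance

/-- Axisymmetric scalar fields on `(1, ∞) × ℝ`: to each height `z` they assign the (class of the)
function `r ↦ u (r, z)` on `(1, ∞)`. -/
abbrev AxiField : Type := ℝ → Profile

/-- The Fourier transform, evaluated at `z`, of the `L^∞_ρ`-valued measure
`g dΛ + ∑_{m ∈ ℤ} a_m δ_m`. -/
def fourierX (ρ : ℝ) (g : ℝ → WLinf ρ) (a : ℤ → WLinf ρ) (z : ℝ) : WLinf ρ :=
  (((Real.sqrt (2 * Real.pi))⁻¹ : ℝ) : ℂ) •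
      (∫ ζ : ℝ, Complex.exp (-(Complex.I * z * ζ)) • g ζ)
    + ∑' m : ℤ, Complex.exp (Complex.I * m * z) • a m

/-- `u` is the Fourier transform of `g dΛ + ∑ a_m δ_m`, where `g ∈ L¹(ℝ, L^∞_ρ)` and
`a ∈ ℓ¹(ℤ, L^∞_ρ)`. -/
structure Represents (ρ : ℝ) (g : ℝ → WLinf ρ) (a : ℤ → WLinf ρ) (u : AxiField) : Prop where
  integrable : Integrable g
  summable : Summable fun m => ‖a m‖
  eq : ∀ z : ℝ, u z = (fourierX ρ g a z : Profile)

/-- Membership in the space `FX(ℝ, L^∞_ρ)`. -/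
def MemFX (ρ : ℝ) (u : AxiField) : Prop :=
  ∃ (g : ℝ → WLinf ρ) (a : ℤ → WLinf ρ), Represents ρ g a u

/-- The norm of `FX(ℝ, L^∞_ρ)`: the value of `‖g‖_{L¹} + ∑ ‖a_m‖` at the measure which `u` is the
Fourier transform of.  (The Fourier transform being injective, that measure is unique, so the set
is a singleton for `u` in the space.) -/
def fxNorm (ρ : ℝ) (u : AxiField) : ℝ :=
  sInf {N : ℝ | ∃ (g : ℝ → WLinf ρ) (a : ℤ → WLinf ρ), Represents ρ g a u ∧
    N = (∫ ζ : ℝ, ‖g ζ‖) + ∑' m : ℤ, ‖a m‖}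

/-- The open half plane `(1, ∞) × ℝ` of pairs `(r, z)`. -/
def halfPlane : TopologicalSpace.Opens (ℝ × ℝ) :=
  ⟨Ioi (1 : ℝ) ×ˢ univ, isOpen_Ioi.prod isOpen_univ⟩

/-- `∂_r φ`. -/
def dr (φ : ℝ × ℝ → ℂ) (p : ℝ × ℝ) : ℂ := deriv (fun r : ℝ => φ (r, p.2)) p.1

/-- `∂_z φ`. -/
def dz (φ : ℝ × ℝ → ℂ) (p : ℝ × ℝ) : ℂ := deriv (fun z : ℝ => φ (p.1, z)) p.2

/-- `φ / r`. -/
def divR (φ : ℝ × ℝ → ℂ) (p : ℝ × ℝ) : ℂ := φ p / (p.1 : ℂ)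

/-- The pairing `∫_ℝ ∫_1^∞ u φ dr dz`, through which a field is a distribution on
`(1, ∞) × ℝ`. -/
def pairing (u : AxiField) (φ : ℝ × ℝ → ℂ) : ℂ :=
  ∫ z : ℝ, ∫ r : ℝ, u z r * φ (r, z) ∂radial

/-- `v = ∂_r u` in the sense of distributions on `(1, ∞) × ℝ`. -/
def IsWeakDr (u v : AxiField) : Prop :=
  ∀ φ : 𝓓(halfPlane, ℂ), pairing v φ = -pairing u (dr φ)

/-- `v = ∂_z u` in the sense of distributions on `(1, ∞) × ℝ`. -/
def IsWeakDz (u v : AxiField) : Prop :=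
  ∀ φ : 𝓓(halfPlane, ℂ), pairing v φ = -pairing u (dz φ)

/-- `ψ` solves `-(∂_r² + r⁻¹ ∂_r + ∂_z² - r⁻²) ψ = ω` in the sense of distributions on
`(1, ∞) × ℝ` and `ψ = 0` on `{1} × ℝ`; the boundary condition means that `ψ` has a representative
which is continuous up to the boundary and vanishes there. -/
structure IsStreamFunction (ω ψ : AxiField) : Prop where
  equation : ∀ φ : 𝓓(halfPlane, ℂ),
    pairing ψ (fun p => -(dr (dr φ) p - dr (divR φ) p + dz (dz φ) p - divR (divR φ) p))
      = pairing ω φ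
  boundary : ∃ Ψ : ℝ × ℝ → ℂ, ContinuousOn Ψ (Ici (1 : ℝ) ×ˢ univ) ∧
    (∀ z : ℝ, ∀ᵐ r ∂radial, ψ z r = Ψ (r, z)) ∧ ∀ z : ℝ, Ψ (1, z) = 0

/-- `(Vr, Vz)` are the components of the vector field given by the axisymmetric Biot-Savart law
from the streamfunction `ψ`: `Vr = -∂_z ψ` and `Vz = r⁻¹ ∂_r (r ψ)`, in the sense of distributions
on `(1, ∞) × ℝ`. -/
structure IsBiotSavart (ψ Vr Vz : AxiField) : Prop where
  radial_eq : ∀ φ : 𝓓(halfPlane, ℂ), pairing Vr φ = pairing ψ (dz φ)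
  vertical_eq : ∀ φ : 𝓓(halfPlane, ℂ),
    pairing Vz φ = -pairing ψ (fun p => (p.1 : ℂ) * dr (divR φ) p)

end AxiBiotSavart

end

open AxiBiotSavart

open MeasureTheory Set
open scoped ENNReal Distributions

noncomputable section

open Filter Topology

namespace AxiBiotSavart

/-! Existence. A Fourier transform in `z` splits the problem into ordinary differential equations,
one for each frequency `ζ`: `-(Y'' + Y'/r - Y/r²) + ζ² Y = f` on `(1, ∞)`, with `Y(1) = 0` and `Y →
0` at infinity. With `X = Y' + Y/r` this is the system `(rY)' = rX`, `X' = ζ² Y - f`. The whole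
corollary rests on weighted bounds for `Y` and `X` that are uniform in `ζ`.

They come from the maximum principle. Put `s = ρ - 2`. As `0 < s < 1`, the power `r^(-s)` is a
strict supersolution, and so is `r^(-s) / (1 + ζ² r² / 9)`, up to a constant, for sources of size
`r^(-ρ)` (`barrier_stream_ge`). Hence `ζ^k Y` lies in `L^∞_{ρ-2+k}` for `k = 0, 1, 2`
(`DirichletSolution.norm_Y_le`). Interpolating between `Y` and `X' = ζ² Y - f` places `ζ^k X` in
`L^∞_{ρ-1+k}` for `k = 0, 1` (`DirichletSolution.norm_X_le_of`). The velocity at frequency `ζ` is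
`(iζY, X)` and its derivatives are `iζ(X - Y/r)`, `ζ² Y`, `ζ² Y - f`, `-iζX`; all are covered, and
no second derivative of `Y` is ever estimated. Solutions exist by reduction of order from a growing
Bessel solution (`exists_radialSolution`).

The solution operators are bounded uniformly in `ζ`, and norm continuous away from `ζ = 0` by the
resolvent identity (`isMultiplier_of_resolvent`). They therefore act on the measures `g dΛ + ∑ a_m
δ_m` without increasing the total variation by more than a constant factor. Weak identities are
checked on single waves and superposed by Fubini (`pairing_congr`); the boundary condition is
obtained by superposing in the bounded continuous functions (`stream_boundary`).

Uniqueness. Let `ψ` solve the homogeneous problem and be the transform of a measure `m`. For a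
smooth compactly supported `β` put `w_β = ∫ β dm`. Testing the equation in `z` shows that `w_β`
vanishes at `r = 1`, decays, and satisfies `w_β'' + w_β'/r - w_β/r² = w_{ζ²β}`. Subtracting `k w_β`
and using the maximum principle gives `‖w_β‖ ≤ ‖w_{(1-ζ²/k)β}‖`. If `β` vanishes near zero and `k`
is large, the factor `1 - ζ²/k` is at most some `q < 1` on the support; iteration yields `w_β = 0`
(`IsHomogeneous.freqAverage_eq_zero`). So `m` lives at `ζ = 0`, and the frequency-zero problem has
only the trivial solution.

The norm is an infimum over representations. By uniqueness every representation of `ω` produces the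
same velocity and the same derivatives, so the bound can be proved for each representation and
passed to the infimum. -/

/-! ### Integration by parts for primitives of integrable functions. -/

lemma absolutelyContinuousOnInterval_integral {p : ℝ → ℂ} {a b : ℝ}
    (hp : IntervalIntegrable p volume a b) :
    AbsolutelyContinuousOnInterval (fun x => ∫ t in a..x, p t) a b := by
  have hre : IntervalIntegrable (fun t => (p t).re) volume a b :=
    ⟨hp.1.re, hp.2.re⟩
  have him : IntervalIntegrable (fun t => (p t).im) volume a b :=
    ⟨hp.1.im, hp.2.im⟩
  have h1 := hre.absolutelyContinuousOnInterval_intervalIntegral (c := a) (by simp)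
  have h2 := him.absolutelyContinuousOnInterval_intervalIntegral (c := a) (by simp)
  have l1 : AbsolutelyContinuousOnInterval (fun x => ((∫ t in a..x, (p t).re : ℝ) : ℂ)) a b := by
    have := h1
    rw [absolutelyContinuousOnInterval_iff] at this ⊢
    simpa [Complex.dist_eq, ← Complex.ofReal_sub, Real.dist_eq]
      using this
  have l2 : AbsolutelyContinuousOnInterval (fun x => ((∫ t in a..x, (p t).im : ℝ) : ℂ)) a b := by
    have := h2
    rw [absolutelyContinuousOnInterval_iff] at this ⊢
    simpa [Complex.dist_eq, ← Complex.ofReal_sub, Real.dist_eq]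
      using this
  have l3 := l1.add (l2.const_smul (Complex.I))
  have e : ∀ x ∈ uIcc a b, (∫ t in a..x, p t) =
      ((∫ t in a..x, (p t).re : ℝ) : ℂ) + Complex.I • ((∫ t in a..x, (p t).im : ℝ) : ℂ) := by
    intro x hx
    have hpx : IntervalIntegrable p volume a x := hp.mono_set (uIcc_subset_uIcc_left hx)
    have i1 : IntervalIntegrable (fun t => ((p t).re : ℂ)) volume a x :=
      ⟨hpx.1.re.ofReal, hpx.2.re.ofReal⟩
    have i2 : IntervalIntegrable (fun t => Complex.I * ((p t).im : ℂ)) volume a x :=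
      ⟨hpx.1.im.ofReal.const_mul _, hpx.2.im.ofReal.const_mul _⟩
    rw [smul_eq_mul, ← intervalIntegral.integral_ofReal, ← intervalIntegral.integral_ofReal,
      ← intervalIntegral.integral_const_mul, ← intervalIntegral.integral_add i1 i2]
    congr 1
    funext t
    rw [mul_comm Complex.I]
    exact (Complex.re_add_im (p t)).symm
  rw [absolutelyContinuousOnInterval_iff] at l3 ⊢
  intro ε hε
  obtain ⟨δ, hδ, h⟩ := l3 ε hε
  refine ⟨δ, hδ, fun E hE hs => ?_⟩
  have := h E hE hs
  refine lt_of_eq_of_lt (Finset.sum_congr rfl fun i hi => ?_) this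
  have hm := hE.1 i hi
  rw [e _ hm.1, e _ hm.2]
  rfl

/-- The product rule for a `C¹` function and the primitive of an integrable one. -/
lemma mul_primitive_sub {p h h' : ℝ → ℂ} {a b : ℝ} (c : ℂ) (hp : IntervalIntegrable p volume a b)
    (hh : ∀ x ∈ uIcc a b, HasDerivAt h (h' x) x) (hc : ContinuousOn h' (uIcc a b)) :
    h b * (c + ∫ t in a..b, p t) - h a * c =
      ∫ x in a..b, (h' x * (c + ∫ t in a..x, p t) + h x * p x) := by
  have hcon : ContinuousOn h (uIcc a b) := fun x hx => (hh x hx).continuousAt.continuousWithinAt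
  have hPac := absolutelyContinuousOnInterval_integral hp
  have hPcon := hPac.continuousOn
  have hint : IntervalIntegrable (fun x => h' x * (c + ∫ t in a..x, p t) + h x * p x) volume a b := by
    refine IntervalIntegrable.add ?_ ?_
    · exact (hc.mul (continuousOn_const.add hPcon)).intervalIntegrable
    · exact hp.continuousOn_mul hcon
  have hhac : AbsolutelyContinuousOnInterval h a b := by
    have hi : IntervalIntegrable h' volume a b := hc.intervalIntegrable
    have h1 := absolutelyContinuousOnInterval_integral hi
    rw [absolutelyContinuousOnInterval_iff] at h1 ⊢
    intro ε hε
    obtain ⟨δ, hδ, hsum⟩ := h1 ε hε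
    refine ⟨δ, hδ, fun E hE hs => ?_⟩
    refine lt_of_eq_of_lt (Finset.sum_congr rfl fun i hi => ?_) (hsum E hE hs)
    have hm := hE.1 i hi
    have key : ∀ x ∈ uIcc a b, ∫ t in a..x, h' t = h x - h a := fun x hx =>
      intervalIntegral.integral_eq_sub_of_hasDerivAt
        (fun y hy => hh y (uIcc_subset_uIcc_left hx hy))
        ((hc.mono (uIcc_subset_uIcc_left hx)).intervalIntegrable)
    rw [key _ hm.1, key _ hm.2, dist_sub_right]
  have hcac : AbsolutelyContinuousOnInterval (fun x => c + ∫ t in a..x, p t) a b := by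
    rw [absolutelyContinuousOnInterval_iff] at hPac ⊢
    simpa using hPac
  have hprod := hhac.smul hcac
  have hI := absolutelyContinuousOnInterval_integral hint
  have hg := hprod.sub hI
  -- Both sides, as functions of the upper endpoint, are absolutely continuous with the same
  -- derivative almost everywhere (Lebesgue differentiation for `p`), so they differ by a constant.
  obtain ⟨C, hC⟩ := hg.const_of_ae_hasDerivAt_zero (by
    filter_upwards [hp.ae_hasDerivAt_integral, hint.ae_hasDerivAt_integral] with x h1 h2 hx
    have d1 := (hh x hx).mul ((h1 hx a (by simp)).const_add c)
    have d2 := h2 hx a (by simp)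
    have := d1.sub d2
    simpa using this)
  have ha := hC a (by simp)
  have hb := hC b (by simp)
  simp only [Pi.sub_apply, smul_eq_mul, Pi.mul_apply, intervalIntegral.integral_same,
    add_zero, sub_zero] at ha hb
  rw [ha]
  linear_combination hb

/-! ### The radial equation as a first-order system, in integrated form because the source is merely
measurable. -/

/-- Solutions of the first-order system `(r Y)' = r X`, `X' = μ Y - f` on `[1, ∞)`, which for
`X = Y' + Y / r` is equivalent to `-(Y'' + Y' / r - Y / r ^ 2) + μ Y = f`. -/
structure RadialSolution (μ : ℝ) (f Y X : ℝ → ℂ) : Prop where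
  contY : Continuous Y
  contX : Continuous X
  int : ∀ r, 1 ≤ r → IntervalIntegrable f volume 1 r
  X_eq : ∀ r, 1 ≤ r → X r = X 1 + ∫ s in (1 : ℝ)..r, ((μ : ℂ) * Y s - f s)
  Y_eq : ∀ r : ℝ, 1 ≤ r → r * Y r = Y 1 + ∫ s in (1 : ℝ)..r, (s : ℂ) * X s

namespace RadialSolution

variable {μ : ℝ} {f Y X : ℝ → ℂ}

lemma intF (h : RadialSolution μ f Y X) {a b : ℝ} (ha : 1 ≤ a) (hb : 1 ≤ b) :
    IntervalIntegrable f volume a b := (h.int a ha).symm.trans (h.int b hb)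

lemma intG (h : RadialSolution μ f Y X) {a b : ℝ} (ha : 1 ≤ a) (hb : 1 ≤ b) :
    IntervalIntegrable (fun s => (μ : ℂ) * Y s - f s) volume a b :=
  ((continuous_const.mul h.contY).intervalIntegrable a b).sub (h.intF ha hb)

lemma X_sub (h : RadialSolution μ f Y X) {a b : ℝ} (ha : 1 ≤ a) (hb : 1 ≤ b) :
    X b - X a = ∫ s in a..b, ((μ : ℂ) * Y s - f s) := by
  rw [h.X_eq a ha, h.X_eq b hb, ← intervalIntegral.integral_interval_sub_left
    (h.intG le_rfl hb) (h.intG le_rfl ha)]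
  ring

lemma contsX (h : RadialSolution μ f Y X) : Continuous fun s : ℝ => (s : ℂ) * X s :=
  Complex.continuous_ofReal.mul h.contX

lemma Y_sub (h : RadialSolution μ f Y X) {a b : ℝ} (ha : 1 ≤ a) (hb : 1 ≤ b) :
    b * Y b - a * Y a = ∫ s in a..b, (s : ℂ) * X s := by
  rw [h.Y_eq a ha, h.Y_eq b hb, ← intervalIntegral.integral_interval_sub_left
    (h.contsX.intervalIntegrable 1 b) (h.contsX.intervalIntegrable 1 a)]
  ring

lemma hasDerivAt (h : RadialSolution μ f Y X) {r : ℝ} (hr : 1 < r) :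
    HasDerivAt (fun s : ℝ => s * Y s) (r * X r) r := by
  have h1 : HasDerivAt (fun u => Y 1 + ∫ s in (1 : ℝ)..u, (s : ℂ) * X s) (r * X r) r :=
    (intervalIntegral.integral_hasDerivAt_right (h.contsX.intervalIntegrable _ _)
      (h.contsX.stronglyMeasurableAtFilter _ _) h.contsX.continuousAt).const_add _
  refine h1.congr_of_eventuallyEq ?_
  filter_upwards [lt_mem_nhds hr] with s hs
  exact h.Y_eq s hs.le

lemma add {f₂ Y₂ X₂ : ℝ → ℂ} (h : RadialSolution μ f Y X) (h₂ : RadialSolution μ f₂ Y₂ X₂) :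
    RadialSolution μ (f + f₂) (Y + Y₂) (X + X₂) where
  contY := h.contY.add h₂.contY
  contX := h.contX.add h₂.contX
  int r hr := (h.int r hr).add (h₂.int r hr)
  X_eq r hr := by
    simp only [Pi.add_apply]
    rw [h.X_eq r hr, h₂.X_eq r hr, add_add_add_comm, ← intervalIntegral.integral_add
      (h.intG le_rfl hr) (h₂.intG le_rfl hr)]
    congr 1
    refine intervalIntegral.integral_congr fun s _ => ?_
    ring
  Y_eq r hr := by
    simp only [Pi.add_apply]
    rw [mul_add, h.Y_eq r hr, h₂.Y_eq r hr, add_add_add_comm, ← intervalIntegral.integral_add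
      (h.contsX.intervalIntegrable _ _) (h₂.contsX.intervalIntegrable _ _)]
    congr 1
    refine intervalIntegral.integral_congr fun s _ => ?_
    ring

lemma smul (h : RadialSolution μ f Y X) (c : ℂ) :
    RadialSolution μ (c • f) (c • Y) (c • X) where
  contY := h.contY.const_smul c
  contX := h.contX.const_smul c
  int r hr := (h.int r hr).smul c
  X_eq r hr := by
    simp only [Pi.smul_apply, smul_eq_mul]
    rw [h.X_eq r hr, mul_add, ← intervalIntegral.integral_const_mul]
    congr 1
    refine intervalIntegral.integral_congr fun s _ => ?_
    ring
  Y_eq r hr := by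
    simp only [Pi.smul_apply, smul_eq_mul]
    rw [mul_left_comm, h.Y_eq r hr, mul_add, ← intervalIntegral.integral_const_mul]
    congr 1
    refine intervalIntegral.integral_congr fun s _ => ?_
    ring

/-- Moving part of the zeroth-order term to the right-hand side. -/
lemma shift (h : RadialSolution μ f Y X) (ν : ℝ) :
    RadialSolution ν (f + ((ν - μ : ℝ) : ℂ) • Y) Y X where
  contY := h.contY
  contX := h.contX
  int r hr := (h.int r hr).add ((h.contY.const_smul _).intervalIntegrable _ _)
  X_eq r hr := by
    rw [h.X_eq r hr]
    congr 1
    refine intervalIntegral.integral_congr fun s _ => ?_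
    simp only [Pi.add_apply, Pi.smul_apply, smul_eq_mul, Complex.ofReal_sub]
    ring
  Y_eq := h.Y_eq

lemma congr_rhs (h : RadialSolution μ f Y X) {g : ℝ → ℂ} (hfg : f =ᵐ[radial] g) :
    RadialSolution μ g Y X := by
  have hae : ∀ r : ℝ, 1 ≤ r → ∀ᵐ s, s ∈ uIoc 1 r → f s = g s := by
    intro r hr
    filter_upwards [(ae_restrict_iff' measurableSet_Ioi).1 hfg] with s hs hsr
    rw [uIoc_of_le hr] at hsr
    exact hs hsr.1
  refine ⟨h.contY, h.contX, fun r hr => (h.int r hr).congr_ae ?_, fun r hr => ?_, h.Y_eq⟩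
  · exact (ae_restrict_iff' measurableSet_uIoc).2 (hae r hr)
  · rw [h.X_eq r hr]
    congr 1
    refine intervalIntegral.integral_congr_ae ?_
    filter_upwards [hae r hr] with s hs hsr
    rw [hs hsr]

end RadialSolution

/-! ### Maximum principle and comparison with barriers. -/

/-- The maximum principle for the system `(r z)' = r q`, `q' ≥ μ z`, in integrated form. -/
lemma nonpos_of_subsolution {z q : ℝ → ℝ} (hz : Continuous z)
    (hq : Continuous q) (hd : ∀ r, 1 < r → HasDerivAt (fun s => s * z s) (r * q r) r)
    (hqi : ∀ a b, 1 < a → a ≤ b → (∀ s ∈ Icc a b, 0 ≤ z s) → q a ≤ q b)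
    (h1 : z 1 ≤ 0) (hlim : Tendsto z atTop (𝓝 0)) {r : ℝ} (hr : 1 ≤ r) : z r ≤ 0 := by
  by_contra! hpos
  obtain ⟨R, hR⟩ := (hlim.eventually (gt_mem_nhds hpos)).exists_forall_of_atTop
  have hrR : r < R := by
    by_contra! h
    exact lt_irrefl _ (hR r h)
  obtain ⟨r₀, hr₀, hmax⟩ := isCompact_Icc.exists_isMaxOn (nonempty_Icc.2 (hr.trans hrR.le))
    hz.continuousOn
  have hz0 : 0 < z r₀ := hpos.trans_le (hmax ⟨hr, hrR.le⟩)
  have h10 : 1 < r₀ := lt_of_le_of_ne hr₀.1 (by rintro rfl; linarith)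
  have hmaxall : ∀ s, 1 ≤ s → z s ≤ z r₀ := by
    intro s hs
    rcases le_total s R with h | h
    · exact hmax ⟨hs, h⟩
    · exact (hR s h).le.trans (hmax ⟨hr, hrR.le⟩)
  have hloc : IsLocalMax z r₀ := by
    filter_upwards [lt_mem_nhds h10] with s hs
    exact hmaxall s hs.le
  have hdz : HasDerivAt z ((r₀ * q r₀ * r₀ - r₀ * z r₀ * 1) / r₀ ^ 2) r₀ := by
    refine ((hd r₀ h10).div (hasDerivAt_id r₀) (by simp; linarith)).congr_of_eventuallyEq ?_
    filter_upwards [lt_mem_nhds h10] with s hs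
    have : s ≠ 0 := by linarith
    simp only [Pi.div_apply, id]
    field_simp
  -- At the interior maximum `z' = 0`, so `(r z)' = r q` reads `z = r q` there.
  have hq0 : q r₀ * r₀ = z r₀ := by
    have h := hloc.hasDerivAt_eq_zero hdz
    have hne : r₀ ≠ 0 := by linarith
    field_simp at h
    linarith
  obtain ⟨δ, hδ, hball⟩ := Metric.eventually_nhds_iff.1 (hz.continuousAt.eventually (lt_mem_nhds hz0))
  set b := r₀ + δ / 2 with hb
  have hrb : r₀ < b := by linarith
  have hnn : ∀ s ∈ Icc r₀ b, 0 ≤ z s := by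
    intro s hs
    refine (hball ?_).le
    rw [Real.dist_eq, abs_lt]
    constructor <;> linarith [hs.1, hs.2]
  have hint : b * z b - r₀ * z r₀ = ∫ s in r₀..b, s * q s := by
    refine (intervalIntegral.integral_eq_sub_of_hasDerivAt (f := fun s => s * z s) ?_ ?_).symm
    · intro s hs
      rw [uIcc_of_le hrb.le] at hs
      exact hd s (h10.trans_le hs.1)
    · exact (continuous_id.mul hq).intervalIntegrable _ _
  -- To the right of `r₀`, as long as `z` stays positive, `q ≥ q r₀ = z r₀ / r₀`. So `b z(b) - r₀
  -- z(r₀)` is at least `(b² - r₀²) z(r₀) / (2 r₀)`, while maximality bounds it by `(b - r₀) z(r₀)`.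
  -- As `b + r₀ > 2 r₀`, these are incompatible.
  have hge : ∫ s in r₀..b, s * q r₀ ≤ ∫ s in r₀..b, s * q s := by
    refine intervalIntegral.integral_mono_on hrb.le
      ((continuous_id.mul continuous_const).intervalIntegrable _ _)
      ((continuous_id.mul hq).intervalIntegrable _ _) fun s hs => ?_
    refine mul_le_mul_of_nonneg_left ?_ (by linarith [hs.1])
    exact hqi r₀ s h10 hs.1 fun t ht => hnn t ⟨ht.1, ht.2.trans hs.2⟩
  rw [intervalIntegral.integral_mul_const, integral_id] at hge
  have hzb := hmaxall b (by linarith)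
  have hq0' : q r₀ = z r₀ / r₀ := by
    rw [← hq0]; field_simp
  rw [← hint, hq0'] at hge
  have h2 : (b ^ 2 - r₀ ^ 2) / 2 * (z r₀ / r₀) = (b ^ 2 - r₀ ^ 2) * z r₀ / (2 * r₀) := by
    field_simp
  rw [h2, div_le_iff₀ (by linarith)] at hge
  nlinarith [mul_pos (mul_pos (sub_pos.2 hrb) (sub_pos.2 hrb)) hz0,
    mul_nonneg (mul_nonneg (sub_nonneg.2 hzb) (by linarith : (0 : ℝ) ≤ b)) (by linarith : 0 ≤ r₀)]

/-- A barrier: `(r W)' = r V`, and `μ W - V'` dominates the right-hand side. -/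
structure Barrier (W V V' : ℝ → ℝ) : Prop where
  contW : ContinuousOn W (Ici 1)
  derivW : ∀ r, 1 < r → HasDerivAt (fun s => s * W s) (r * V r) r
  contV : ContinuousOn V (Ici 1)
  derivV : ∀ r, 1 < r → HasDerivAt V (V' r) r
  contV' : ContinuousOn V' (Ioi 1)
  nonneg : 0 ≤ W 1
  tendsto : Tendsto W atTop (𝓝 0)

/-- For every unit number `c` the real function `Re (c Y) - W` is a subsolution, hence nonpositive;
choosing for `c` the conjugate phase of `Y r` turns this into a bound on the modulus. -/
lemma RadialSolution.norm_le_barrier {μ : ℝ} (hμ : 0 ≤ μ) {f Y X : ℝ → ℂ}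
    (h : RadialSolution μ f Y X) (h1 : Y 1 = 0) (hlim : Tendsto Y atTop (𝓝 0))
    {W V V' : ℝ → ℝ} (hW : Barrier W V V')
    (hf : ∀ᵐ r ∂radial, ‖f r‖ ≤ μ * W r - V' r) {r : ℝ} (hr : 1 ≤ r) : ‖Y r‖ ≤ W r := by
  have key : ∀ c : ℂ, ‖c‖ = 1 → (c * Y r).re ≤ W r := by
    intro c hc
    -- The barrier is controlled on `[1, ∞)` only; composing with `max 1` gives the globally
    -- continuous functions that the maximum principle asks for.
    have hproj : ∀ s : ℝ, (1 : ℝ) ≤ s → max 1 s = s := fun s hs => max_eq_right hs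
    have hcm : Continuous fun s : ℝ => max 1 s := by fun_prop
    have hz : Continuous fun s => (c * Y s).re - W (max 1 s) := by
      refine (Complex.continuous_re.comp (continuous_const.mul h.contY)).sub ?_
      exact hW.contW.comp_continuous hcm fun s => mem_Ici.2 (le_max_left _ _)
    have hq : Continuous fun s => (c * X s).re - V (max 1 s) := by
      refine (Complex.continuous_re.comp (continuous_const.mul h.contX)).sub ?_
      exact hW.contV.comp_continuous hcm fun s => mem_Ici.2 (le_max_left _ _)
    have main := nonpos_of_subsolution hz hq ?_ ?_ ?_ ?_ hr
    · rw [hproj r hr] at main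
      linarith
    · intro s hs
      have d1 : HasDerivAt (fun s : ℝ => s * (c * Y s).re) (s * (c * X s).re) s := by
        have := Complex.reCLM.hasFDerivAt.comp_hasDerivAt s ((h.hasDerivAt hs).const_mul c)
        have e1 : ∀ (t : ℝ) (w : ℂ), (c * (t * w)).re = t * (c * w).re := by
          intro t w
          rw [mul_left_comm, Complex.re_ofReal_mul]
        simp only [Function.comp_def, Complex.reCLM_apply, e1] at this
        exact this
      have := d1.sub (hW.derivW s hs)
      have e2 : s * (c * X s).re - s * V s = s * ((c * X s).re - V (max 1 s)) := by
        rw [hproj s hs.le]; ring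
      rw [e2] at this
      refine this.congr_of_eventuallyEq ?_
      filter_upwards [lt_mem_nhds hs] with t ht
      simp only [Pi.sub_apply]
      rw [hproj t ht.le]; ring
    · intro a b ha hab hnn
      have hb : 1 < b := ha.trans_le hab
      have iG := h.intG ha.le hb.le
      have e1 : (c * X b).re - (c * X a).re =
          ∫ s in a..b, (c * ((μ : ℂ) * Y s - f s)).re := by
        rw [← Complex.sub_re, ← mul_sub, h.X_sub ha.le hb.le,
          ← intervalIntegral.integral_const_mul]
        have := Complex.reCLM.intervalIntegral_comp_comm (iG.const_mul c)
        exact this.symm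
      have iV : IntervalIntegrable V' volume a b := by
        refine ContinuousOn.intervalIntegrable (hW.contV'.mono ?_)
        rw [uIcc_of_le hab]
        exact fun s hs => ha.trans_le hs.1
      have e2 : V b - V a = ∫ s in a..b, V' s := by
        refine (intervalIntegral.integral_eq_sub_of_hasDerivAt (fun s hs => ?_) iV).symm
        rw [uIcc_of_le hab] at hs
        exact hW.derivV s (ha.trans_le hs.1)
      -- The integrand is at least `μ (Re (c Y) - W)`, by the bound on `f`, and this is nonnegative
      -- where the subsolution is.
      have e3 : 0 ≤ ∫ s in a..b, ((c * ((μ : ℂ) * Y s - f s)).re - V' s) := by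
        refine intervalIntegral.integral_nonneg_of_ae_restrict hab ?_
        have hf' : ∀ᵐ s ∂(volume.restrict (Icc a b)), ‖f s‖ ≤ μ * W s - V' s :=
          ae_restrict_of_ae_restrict_of_subset (fun s hs => ha.trans_le hs.1) hf
        filter_upwards [hf', ae_restrict_mem measurableSet_Icc] with s hs hsm
        have hzs := hnn s hsm
        rw [hproj s (ha.le.trans hsm.1)] at hzs
        have h3 : (c * f s).re ≤ ‖f s‖ := by
          refine (Complex.re_le_norm _).trans ?_
          rw [norm_mul, hc, one_mul]
        have h4 : (c * ((μ : ℂ) * Y s - f s)).re = μ * (c * Y s).re - (c * f s).re := by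
          rw [mul_sub, Complex.sub_re, mul_left_comm, Complex.re_ofReal_mul]
        simp only [Pi.zero_apply]
        rw [h4]
        nlinarith
      rw [intervalIntegral.integral_sub _ iV, ← e1, ← e2] at e3
      · rw [hproj a ha.le, hproj b hb.le]
        linarith
      · have := iG.const_mul c
        exact ⟨this.1.re, this.2.re⟩
    · simp [h1, hW.nonneg]
    · have t1 : Tendsto (fun s => (c * Y s).re) atTop (𝓝 0) := by
        have := (Complex.continuous_re.tendsto _).comp (hlim.const_mul c)
        simpa only [mul_zero, Complex.zero_re, Function.comp_def] using this
      have t2 : Tendsto (fun s => W (max 1 s)) atTop (𝓝 0) :=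
        hW.tendsto.congr' (by
          filter_upwards [eventually_ge_atTop 1] with s hs
          rw [hproj s hs])
      simpa using t1.sub t2
  by_cases hY : Y r = 0
  · have := key 1 (by simp)
    simpa [hY] using this
  · have hn : (‖Y r‖ : ℂ) ≠ 0 := by simpa using hY
    have := key (star (Y r) / ‖Y r‖) (by simp [hY])
    have e : star (Y r) / ‖Y r‖ * Y r = (‖Y r‖ : ℂ) := by
      rw [div_mul_eq_mul_div, div_eq_iff hn]
      have := Complex.conj_mul' (Y r)
      rw [sq] at this
      exact this
    rwa [e, Complex.ofReal_re] at this

/-! ### Explicit barriers and the resulting bounds on `Y`. -/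

lemma hasDerivAt_rpow_neg (s : ℝ) {r : ℝ} (hr : 0 < r) :
    HasDerivAt (fun r : ℝ => r ^ (-s)) (-s * r ^ (-s) / r) r := by
  have h := Real.hasDerivAt_rpow_const (x := r) (p := -s) (Or.inl hr.ne')
  rwa [Real.rpow_sub_one hr.ne', ← mul_div_assoc] at h

lemma Barrier.const_mul {W V V' : ℝ → ℝ} (h : Barrier W V V') {M : ℝ} (hM : 0 ≤ M) :
    Barrier (fun r => M * W r) (fun r => M * V r) (fun r => M * V' r) where
  contW := continuousOn_const.mul h.contW
  derivW r hr := by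
    have := (h.derivW r hr).const_mul M
    convert! this using 1
    · funext s; ring
    · ring
  contV := continuousOn_const.mul h.contV
  derivV r hr := (h.derivV r hr).const_mul M
  contV' := continuousOn_const.mul h.contV'
  nonneg := mul_nonneg hM h.nonneg
  tendsto := by simpa using h.tendsto.const_mul M

/-- The source produced by `r^(-s)` at frequency zero is `(1 - s²) r^(-s-2)`, positive precisely for
`s < 1`: this is where the upper bound on `ρ` enters. -/
lemma barrier_rpow {s : ℝ} (hs : 0 < s) :
    Barrier (fun r => r ^ (-s)) (fun r => (1 - s) * r ^ (-s) / r)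
      (fun r => -(1 - s ^ 2) * r ^ (-s) / r ^ 2) where
  contW := fun r hr => (hasDerivAt_rpow_neg s (zero_lt_one.trans_le hr)).continuousAt.continuousWithinAt
  derivW r hr := by
    have h0 : 0 < r := zero_lt_one.trans hr
    have := (hasDerivAt_id r).mul (hasDerivAt_rpow_neg s h0)
    convert! this using 1
    simp only [id]
    field_simp
    ring
  contV := fun r hr => by
    have h0 : 0 < r := zero_lt_one.trans_le hr
    exact (((hasDerivAt_rpow_neg s h0).const_mul (1 - s)).div (hasDerivAt_id r)
      h0.ne').continuousAt.continuousWithinAt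
  derivV r hr := by
    have h0 : 0 < r := zero_lt_one.trans hr
    have := ((hasDerivAt_rpow_neg s h0).const_mul (1 - s)).div (hasDerivAt_id r) h0.ne'
    convert! this using 1
    simp only [id]
    field_simp
    ring
  contV' := fun r hr => by
    have h0 : 0 < r := zero_lt_one.trans hr
    exact (((hasDerivAt_rpow_neg s h0).const_mul (-(1 - s ^ 2))).div ((hasDerivAt_id r).pow 2)
      (by simp [h0.ne'])).continuousAt.continuousWithinAt
  nonneg := by simp
  tendsto := tendsto_rpow_neg_atTop hs

lemma hasDerivAt_one_add_sq (k r : ℝ) :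
    HasDerivAt (fun r : ℝ => 1 + k * r ^ 2) (2 * k * r) r := by
  have := (((hasDerivAt_id r).pow 2).const_mul k).const_add 1
  convert! this using 1
  simp only [id]
  ring

/-- One function for both regimes: it behaves like `r^(-s)` where `k r² ≪ 1` and like `r^(-s-2) / k`
where `k r² ≫ 1`. The other two functions are `W' + W/r` and its derivative, written in terms of `k
r²`. -/
lemma barrier_stream {s k : ℝ} (hs : 0 < s) (hk : 0 ≤ k) :
    Barrier (fun r => r ^ (-s) / (1 + k * r ^ 2))
      (fun r => r ^ (-s) / r * ((1 - s) / (1 + k * r ^ 2) - 2 * (k * r ^ 2) / (1 + k * r ^ 2) ^ 2))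
      (fun r => r ^ (-s) / r ^ 2 *
        (-(s + 1) * ((1 - s) / (1 + k * r ^ 2) - 2 * (k * r ^ 2) / (1 + k * r ^ 2) ^ 2)
          - (1 - s) * (2 * (k * r ^ 2)) / (1 + k * r ^ 2) ^ 2
          - 4 * (k * r ^ 2) / (1 + k * r ^ 2) ^ 2
          + 8 * (k * r ^ 2) ^ 2 / (1 + k * r ^ 2) ^ 3)) := by
  have hG : ∀ r : ℝ, 0 < 1 + k * r ^ 2 := fun r => by positivity
  have dW : ∀ r : ℝ, 0 < r → HasDerivAt (fun r => r ^ (-s) / (1 + k * r ^ 2)) _ r := fun r h0 =>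
    (hasDerivAt_rpow_neg s h0).div (hasDerivAt_one_add_sq k r) (hG r).ne'
  have dP : ∀ r : ℝ, 0 < r → HasDerivAt (fun r => r ^ (-s) / r) _ r := fun r h0 =>
    (hasDerivAt_rpow_neg s h0).div (hasDerivAt_id r) h0.ne'
  have dA : ∀ r : ℝ, HasDerivAt (fun r => (1 - s) / (1 + k * r ^ 2)) _ r := fun r =>
    (hasDerivAt_const r (1 - s)).div (hasDerivAt_one_add_sq k r) (hG r).ne'
  have dN : ∀ r : ℝ, HasDerivAt (fun r => 2 * (k * r ^ 2)) _ r := fun r =>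
    ((((hasDerivAt_id r).pow 2).const_mul k).const_mul 2)
  have dB : ∀ r : ℝ, HasDerivAt (fun r => 2 * (k * r ^ 2) / (1 + k * r ^ 2) ^ 2) _ r := fun r =>
    (dN r).div ((hasDerivAt_one_add_sq k r).pow 2) (pow_pos (hG r) 2).ne'
  have dV : ∀ r : ℝ, 0 < r → HasDerivAt (fun r => r ^ (-s) / r *
      ((1 - s) / (1 + k * r ^ 2) - 2 * (k * r ^ 2) / (1 + k * r ^ 2) ^ 2)) _ r := fun r h0 =>
    (dP r h0).mul ((dA r).sub (dB r))
  refine ⟨fun r hr => (dW r (zero_lt_one.trans_le hr)).continuousAt.continuousWithinAt, ?_,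
    fun r hr => (dV r (zero_lt_one.trans_le hr)).continuousAt.continuousWithinAt, ?_, ?_, ?_, ?_⟩
  · intro r hr
    have h0 : 0 < r := zero_lt_one.trans hr
    have := (hasDerivAt_id r).mul (dW r h0)
    convert! this using 1
    simp only [id]
    have := (hG r).ne'
    field_simp
    ring
  · intro r hr
    have h0 : 0 < r := zero_lt_one.trans hr
    convert! dV r h0 using 1
    simp only [id]
    have := (hG r).ne'
    generalize r ^ (-s) = p
    field_simp
    ring
  · have hc : ContinuousOn (fun r : ℝ => r ^ (-s)) (Ioi 1) := fun r hr =>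
      (hasDerivAt_rpow_neg s (zero_lt_one.trans hr)).continuousAt.continuousWithinAt
    have h2 : ∀ r ∈ Ioi (1 : ℝ), r ^ 2 ≠ 0 := fun r hr => by
      have : (0 : ℝ) < r := zero_lt_one.trans hr
      positivity
    have h3 : ∀ r ∈ Ioi (1 : ℝ), 1 + k * r ^ 2 ≠ 0 := fun r _ => (hG r).ne'
    have h4 : ∀ r ∈ Ioi (1 : ℝ), (1 + k * r ^ 2) ^ 2 ≠ 0 := fun r _ => (pow_pos (hG r) 2).ne'
    have h5 : ∀ r ∈ Ioi (1 : ℝ), (1 + k * r ^ 2) ^ 3 ≠ 0 := fun r _ => (pow_pos (hG r) 3).ne'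
    fun_prop (disch := assumption)
  · have := (hG 1).le
    simp at this ⊢
    exact this
  · refine squeeze_zero' ?_ ?_ (tendsto_rpow_neg_atTop hs)
    · filter_upwards [eventually_ge_atTop 0] with r hr
      exact div_nonneg (Real.rpow_nonneg hr _) (hG r).le
    · filter_upwards [eventually_ge_atTop 0] with r hr
      refine div_le_self (Real.rpow_nonneg hr _) ?_
      have : 0 ≤ k * r ^ 2 := by positivity
      linarith

/-- With `t = μ r² / 9` everything scales as `r^(-s-2)` and a polynomial inequality in `t` remains.
The number 9 is `8 + 1`: of the term `9 t (1+t)²`, eight parts absorb `-8 t²` and one part absorbs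
`(1 - s²) t (1+t)²`. -/
lemma barrier_stream_ge {s μ r : ℝ} (hs0 : 0 < s) (hs : s < 1) (hμ : 0 ≤ μ) (hr : 1 < r) :
    (1 - s ^ 2) * r ^ (-(s + 2)) ≤ μ * (r ^ (-s) / (1 + μ / 9 * r ^ 2)) - r ^ (-s) / r ^ 2 *
        (-(s + 1) * ((1 - s) / (1 + μ / 9 * r ^ 2)
            - 2 * (μ / 9 * r ^ 2) / (1 + μ / 9 * r ^ 2) ^ 2)
          - (1 - s) * (2 * (μ / 9 * r ^ 2)) / (1 + μ / 9 * r ^ 2) ^ 2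
          - 4 * (μ / 9 * r ^ 2) / (1 + μ / 9 * r ^ 2) ^ 2
          + 8 * (μ / 9 * r ^ 2) ^ 2 / (1 + μ / 9 * r ^ 2) ^ 3) := by
  have h0 : 0 < r := by linarith
  obtain ⟨t, ht⟩ : ∃ t, t = μ / 9 * r ^ 2 := ⟨_, rfl⟩
  have ht0 : 0 ≤ t := by rw [ht]; positivity
  have hG : 0 < 1 + t := by linarith
  rw [← ht]
  have e1 : r ^ (-(s + 2)) = r ^ (-s) / r ^ 2 := by
    rw [neg_add, Real.rpow_add h0, Real.rpow_neg h0.le 2, Real.rpow_two]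
    rfl
  have e2 : μ * (r ^ (-s) / (1 + t)) = r ^ (-s) / r ^ 2 * (9 * t / (1 + t)) := by
    rw [ht]; field_simp
  have hp : 0 ≤ r ^ (-s) / r ^ 2 := by positivity
  rw [e1, e2, ← mul_sub, mul_comm]
  refine mul_le_mul_of_nonneg_left ?_ hp
  have e3 : 9 * t / (1 + t) - (-(s + 1) * ((1 - s) / (1 + t) - 2 * t / (1 + t) ^ 2)
          - (1 - s) * (2 * t) / (1 + t) ^ 2 - 4 * t / (1 + t) ^ 2 + 8 * t ^ 2 / (1 + t) ^ 3)
      = (9 * t * (1 + t) ^ 2 + (1 - s ^ 2) * (1 + t) ^ 2 + (4 - 4 * s) * t * (1 + t) - 8 * t ^ 2)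
        / (1 + t) ^ 3 := by
    field_simp
    ring
  rw [e3, le_div_iff₀ (by positivity)]
  have h1 : 0 ≤ (4 - 4 * s) * t * (1 + t) := by
    have : 0 ≤ 4 - 4 * s := by linarith
    positivity
  have h2 : (1 - s ^ 2) * (t * (1 + t) ^ 2) ≤ 1 * (t * (1 + t) ^ 2) :=
    mul_le_mul_of_nonneg_right (by nlinarith) (by positivity)
  nlinarith [mul_nonneg ht0 ht0, mul_nonneg ht0 (mul_nonneg ht0 ht0)]

lemma RadialSolution.norm_stream_le {ρ μ M : ℝ} (hρ2 : 2 < ρ) (hρ3 : ρ < 3) (hμ : 0 ≤ μ)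
    {f Y X : ℝ → ℂ} (h : RadialSolution μ f Y X) (h1 : Y 1 = 0) (hlim : Tendsto Y atTop (𝓝 0))
    (hM : 0 ≤ M) (hf : ∀ᵐ r ∂radial, ‖f r‖ ≤ M * r ^ (-ρ)) {r : ℝ} (hr : 1 ≤ r) :
    ‖Y r‖ ≤ M / (1 - (ρ - 2) ^ 2) * (r ^ (-(ρ - 2)) / (1 + μ / 9 * r ^ 2)) := by
  have hs0 : 0 < ρ - 2 := by linarith
  have hs1 : ρ - 2 < 1 := by linarith
  have hpos : 0 < 1 - (ρ - 2) ^ 2 := by nlinarith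
  refine h.norm_le_barrier hμ h1 hlim ((barrier_stream (k := μ / 9) hs0 (by positivity)).const_mul
    (div_nonneg hM hpos.le)) ?_ hr
  filter_upwards [hf, ae_restrict_mem measurableSet_Ioi] with t ht ht1
  refine ht.trans ?_
  have := mul_le_mul_of_nonneg_left (barrier_stream_ge hs0 hs1 hμ ht1) (div_nonneg hM hpos.le)
  refine le_of_eq_of_le ?_ (this.trans_eq (by ring))
  rw [← mul_assoc, div_mul_cancel₀ _ hpos.ne']
  congr 2
  ring

/-- A resolvent bound with the exact constant `1/μ` and the same weight on both sides: for `s < 1`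
the radial part of `r^(-s)` has a favourable sign and is dropped. Having no other constant is what
allows the uniqueness argument to be iterated. -/
lemma RadialSolution.norm_le_div {s μ M : ℝ} (hs0 : 0 < s) (hs1 : s < 1) (hμ : 0 < μ)
    {f Y X : ℝ → ℂ} (h : RadialSolution μ f Y X) (h1 : Y 1 = 0) (hlim : Tendsto Y atTop (𝓝 0))
    (hM : 0 ≤ M) (hf : ∀ᵐ r ∂radial, ‖f r‖ ≤ M * r ^ (-s)) {r : ℝ} (hr : 1 ≤ r) :
    ‖Y r‖ ≤ M / μ * r ^ (-s) := by
  refine h.norm_le_barrier hμ.le h1 hlim ((barrier_rpow hs0).const_mul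
    (div_nonneg hM hμ.le)) ?_ hr
  filter_upwards [hf, ae_restrict_mem measurableSet_Ioi] with t ht ht1
  refine ht.trans ?_
  have h0 : 0 < t := zero_lt_one.trans ht1
  have e : μ * (M / μ * t ^ (-s)) - M / μ * (-(1 - s ^ 2) * t ^ (-s) / t ^ 2) =
      M * t ^ (-s) + M / μ * ((1 - s ^ 2) * t ^ (-s) / t ^ 2) := by
    field_simp
    ring
  rw [e]
  have : 0 < 1 - s ^ 2 := by nlinarith
  have : 0 ≤ M / μ * ((1 - s ^ 2) * t ^ (-s) / t ^ 2) := by positivity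
  linarith

/-! ### Bound on the companion `X`. -/

/-- Interpolation between `Y` and `X'` for `X`. -/
lemma RadialSolution.norm_X_le {μ : ℝ} {f Y X : ℝ → ℂ} (h : RadialSolution μ f Y X)
    {r d K A : ℝ} (hr : 1 ≤ r) (hd : 0 < d)
    (hK : ∀ᵐ s ∂radial, r ≤ s → ‖(μ : ℂ) * Y s - f s‖ ≤ K)
    (hA : ‖Y r‖ ≤ A) (hA' : ‖Y (r + d)‖ ≤ A) : ‖X r‖ ≤ d * K + 2 * A / d := by
  have h0 : 0 < r := by linarith
  have hK' : ∀ s, r ≤ s → s ≤ r + d → ‖X s - X r‖ ≤ K * d := by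
    intro s hs hsd
    rw [h.X_sub hr (hr.trans hs)]
    have hae : ∀ᵐ t, t ∈ Ioc r s → ‖(μ : ℂ) * Y t - f t‖ ≤ K := by
      filter_upwards [(ae_restrict_iff' measurableSet_Ioi).1 hK] with t ht hts
      exact ht (hr.trans_lt hts.1) hts.1.le
    -- The bound by `K` holds almost everywhere only, so `0 ≤ K` has to be drawn from an interval of
    -- positive length.
    have hK0 : r < s → 0 ≤ K := fun hrs => by
      by_contra! hneg
      have : ∀ᵐ t, t ∉ Ioc r s := by
        filter_upwards [hae] with t ht hts
        exact (norm_nonneg _).not_gt ((ht hts).trans_lt hneg)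
      have h0 : volume (Ioc r s) = 0 := by
        rw [← compl_mem_ae_iff]
        exact this
      simp [hrs.not_ge] at h0
    rcases hs.eq_or_lt with rfl | hrs
    · rcases lt_or_ge K 0 with hn | hn
      · exfalso
        have : ∀ᵐ t, t ∉ Ioc r (r + d) := by
          filter_upwards [(ae_restrict_iff' measurableSet_Ioi).1 hK] with t ht hts
          exact (norm_nonneg _).not_gt ((ht (hr.trans_lt hts.1) hts.1.le).trans_lt hn)
        have h0 : volume (Ioc r (r + d)) = 0 := by
          rw [← compl_mem_ae_iff]
          exact this
        simp [hd.not_ge] at h0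
      · simp; positivity
    · have := intervalIntegral.norm_integral_le_of_norm_le_const_ae (a := r) (b := s) (C := K)
        (f := fun s => (μ : ℂ) * Y s - f s) (by rwa [uIoc_of_le hs])
      refine this.trans ?_
      rw [abs_of_nonneg (by linarith)]
      exact mul_le_mul_of_nonneg_left (by linarith) (hK0 hrs)
  have hm : 0 < d * (r + d / 2) := by positivity
  have e1 : ∫ s in r..(r + d), (s : ℂ) * X r = ((d * (r + d / 2) : ℝ) : ℂ) * X r := by
    rw [intervalIntegral.integral_mul_const, intervalIntegral.integral_ofReal, integral_id]
    congr 2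
    ring
  -- Over `[r, r + d]` the integral of `s X` equals the increment of `s Y`, and replacing `X s` by
  -- `X r` costs at most `K d`. The weight `d (r + d/2)` is the integral of `s`; since `(r + d) + r
  -- = 2 (r + d/2)`, division by it leaves `2A/d`, free of `r`.
  have e2 : ((d * (r + d / 2) : ℝ) : ℂ) * X r =
      ((r + d : ℝ) * Y (r + d) - r * Y r) - ∫ s in r..(r + d), (s : ℂ) * (X s - X r) := by
    rw [h.Y_sub hr (by linarith), ← e1, ← intervalIntegral.integral_sub]
    · refine intervalIntegral.integral_congr fun s _ => ?_
      ring
    · exact h.contsX.intervalIntegrable _ _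
    · exact (Complex.continuous_ofReal.mul (h.contX.sub continuous_const)).intervalIntegrable _ _
  have e3 : ‖∫ s in r..(r + d), (s : ℂ) * (X s - X r)‖ ≤ (d * (r + d / 2)) * (K * d) := by
    have : ∫ s in r..(r + d), s * (K * d) = (d * (r + d / 2)) * (K * d) := by
      rw [intervalIntegral.integral_mul_const, integral_id]
      ring
    rw [← this]
    refine intervalIntegral.norm_integral_le_of_norm_le (by linarith) ?_
      ((continuous_id.mul continuous_const).intervalIntegrable _ _)
    refine ae_of_all _ fun s hs => ?_
    have hs0 : 0 ≤ s := by linarith [hs.1]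
    rw [norm_mul, Complex.norm_real, Real.norm_of_nonneg hs0]
    exact mul_le_mul_of_nonneg_left (hK' s hs.1.le hs.2) hs0
  have e4 : (d * (r + d / 2)) * ‖X r‖ ≤ ((r + d) * A + r * A) + (d * (r + d / 2)) * (K * d) := by
    have : ‖((d * (r + d / 2) : ℝ) : ℂ) * X r‖ = (d * (r + d / 2)) * ‖X r‖ := by
      rw [norm_mul, Complex.norm_real, Real.norm_of_nonneg hm.le]
    rw [← this, e2]
    refine (norm_sub_le _ _).trans (add_le_add ((norm_sub_le _ _).trans (add_le_add ?_ ?_)) e3)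
    · rw [norm_mul, Complex.norm_real, Real.norm_of_nonneg (by linarith)]
      exact mul_le_mul_of_nonneg_left hA' (by linarith)
    · rw [norm_mul, Complex.norm_real, Real.norm_of_nonneg (by linarith)]
      exact mul_le_mul_of_nonneg_left hA (by linarith)
  have e5 : (r + d) * A + r * A = (d * (r + d / 2)) * (2 * A / d) := by
    field_simp
    ring
  rw [e5, ← mul_add] at e4
  have := le_of_mul_le_mul_left e4 hm
  linarith

/-! ### The growing homogeneous solution, a modified Bessel function given by its power series. -/

/-- The sum of a power series. -/
def powerSum (c : ℕ → ℝ) (t : ℝ) : ℝ := ∑' k, c k * t ^ k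

lemma summable_powerSum {c : ℕ → ℝ} (hc : ∀ k, |c k| ≤ ((k.factorial : ℝ))⁻¹) (t : ℝ) :
    Summable fun k => c k * t ^ k := by
  refine Summable.of_norm_bounded (Real.summable_pow_div_factorial |t|) fun k => ?_
  rw [norm_mul, norm_pow, Real.norm_eq_abs, Real.norm_eq_abs, div_eq_inv_mul]
  exact mul_le_mul_of_nonneg_right (hc k) (by positivity)

/-- Termwise differentiation, locally uniform by comparison with the exponential series. Through it
every differential identity for the Bessel functions becomes an identity between coefficients. -/
lemma hasDerivAt_powerSum {c : ℕ → ℝ} (hc : ∀ k, |c k| ≤ ((k.factorial : ℝ))⁻¹) (t : ℝ) :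
    HasDerivAt (fun t => t * powerSum (fun k => c k / (k + 1)) t) (powerSum c t) t := by
  have h := hasDerivAt_tsum_of_isPreconnected (u := fun k => (|t| + 1) ^ k / k.factorial)
    (g := fun k t => c k / (k + 1) * t ^ (k + 1)) (g' := fun k t => c k * t ^ k)
    (t := Metric.ball (0 : ℝ) (|t| + 1)) (y₀ := 0) (y := t)
    (Real.summable_pow_div_factorial _) Metric.isOpen_ball (convex_ball _ _).isPreconnected
    (fun n y _ => by
      have := (hasDerivAt_pow (n + 1) y).const_mul (c n / (n + 1))
      convert! this using 1
      push_cast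
      field_simp)
    (fun n y hy => by
      rw [norm_mul, norm_pow, Real.norm_eq_abs, div_eq_inv_mul]
      have hy' : ‖y‖ ≤ |t| + 1 := (mem_ball_zero_iff.1 hy).le
      exact mul_le_mul (hc n) (by gcongr) (by positivity) (by positivity))
    (by simp; positivity) (by simp [summable_zero]) (by simp)
  convert! h using 1
  funext y
  rw [powerSum, ← tsum_mul_left]
  exact tsum_congr fun k => by ring

/-- The coefficients of `I₁(2 √t) / √t`. -/
def coeffE (k : ℕ) : ℝ := ((k.factorial : ℝ) * (k + 1).factorial)⁻¹

/-- The coefficients of `I₀(2 √t)`. -/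
def coeffB (k : ℕ) : ℝ := ((k.factorial : ℝ) * k.factorial)⁻¹

lemma one_le_factorial_cast (k : ℕ) : (1 : ℝ) ≤ k.factorial := by
  exact_mod_cast Nat.succ_le_of_lt k.factorial_pos

lemma abs_inv_factorial_mul_le (k : ℕ) {m : ℝ} (hm : 1 ≤ m) :
    |((k.factorial : ℝ) * m)⁻¹| ≤ ((k.factorial : ℝ))⁻¹ := by
  have := one_le_factorial_cast k
  rw [abs_of_nonneg (by positivity)]
  exact inv_anti₀ (by positivity) (by nlinarith)

lemma coeffB_le (k : ℕ) : |coeffB k| ≤ ((k.factorial : ℝ))⁻¹ :=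
  abs_inv_factorial_mul_le k (one_le_factorial_cast _)

lemma coeffE_le (k : ℕ) : |coeffE k| ≤ ((k.factorial : ℝ))⁻¹ :=
  abs_inv_factorial_mul_le k (one_le_factorial_cast _)

/-- The function `I₁(2 √t) / √t`. -/
def besselE (t : ℝ) : ℝ := powerSum coeffE t

/-- The function `I₀(2 √t)`. -/
def besselB (t : ℝ) : ℝ := powerSum coeffB t

lemma coeffB_div (k : ℕ) : coeffB k / (k + 1) = coeffE k := by
  rw [coeffB, coeffE, Nat.factorial_succ]
  push_cast
  field_simp

/-- Together with `B' = E` this is the Bessel system: the substitution `t = μ r² / 4` turns `(tE)' =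
B`, `B' = E` into `(ru)' = rx`, `x' = μu` for `u = rE`, `x = 2B`. -/
lemma hasDerivAt_mul_besselE (t : ℝ) : HasDerivAt (fun t => t * besselE t) (besselB t) t := by
  have := hasDerivAt_powerSum coeffB_le t
  simp only [coeffB_div] at this
  exact this

lemma powerSum_eq {c : ℕ → ℝ} (hc : ∀ k, |c k| ≤ ((k.factorial : ℝ))⁻¹) (t : ℝ) :
    powerSum c t = c 0 + t * powerSum (fun k => c (k + 1)) t := by
  rw [powerSum, (summable_powerSum hc t).tsum_eq_zero_add, pow_zero, mul_one, powerSum,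
    ← tsum_mul_left]
  congr 1
  exact tsum_congr fun k => by ring

lemma hasDerivAt_besselB (t : ℝ) : HasDerivAt besselB (besselE t) t := by
  have h := (hasDerivAt_powerSum coeffE_le t).const_add (coeffB 0)
  have e : (fun k : ℕ => coeffE k / (k + 1)) = fun k => coeffB (k + 1) := by
    funext k
    rw [coeffB, coeffE, Nat.factorial_succ]
    push_cast
    field_simp
  rw [e] at h
  exact h.congr_of_eventuallyEq (Eventually.of_forall fun t => powerSum_eq coeffB_le t)

lemma exists_hasDerivAt_besselE (t : ℝ) : ∃ d, HasDerivAt besselE d t := by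
  have hd : ∀ k : ℕ, |((k.factorial : ℝ) * ((k + 2).factorial : ℝ))⁻¹| ≤ ((k.factorial : ℝ))⁻¹ :=
    fun k => abs_inv_factorial_mul_le k (one_le_factorial_cast _)
  have h := (hasDerivAt_powerSum hd t).const_add (coeffE 0)
  have e : (fun k : ℕ => ((k.factorial : ℝ) * ((k + 2).factorial : ℝ))⁻¹ / (k + 1)) =
      fun k => coeffE (k + 1) := by
    funext k
    rw [coeffE, Nat.factorial_succ k]
    push_cast
    field_simp
  rw [e] at h
  exact ⟨_, h.congr_of_eventuallyEq (Eventually.of_forall fun t => powerSum_eq coeffE_le t)⟩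

lemma continuous_besselE : Continuous besselE :=
  continuous_iff_continuousAt.2 fun t => (exists_hasDerivAt_besselE t).choose_spec.continuousAt

lemma continuous_besselB : Continuous besselB :=
  continuous_iff_continuousAt.2 fun t => (hasDerivAt_besselB t).continuousAt

lemma besselE_mono {t t' : ℝ} (ht : 0 ≤ t) (h : t ≤ t') : besselE t ≤ besselE t' := by
  refine (summable_powerSum coeffE_le t).tsum_le_tsum (fun k => ?_) (summable_powerSum coeffE_le t')
  have : 0 ≤ coeffE k := by unfold coeffE; positivity
  gcongr

lemma one_le_besselE {t : ℝ} (ht : 0 ≤ t) : 1 ≤ besselE t := by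
  have h0 : besselE 0 = 1 := by
    rw [besselE, powerSum_eq coeffE_le]
    simp [coeffE]
  rw [← h0]
  exact besselE_mono le_rfl ht

/-- The growing homogeneous solution `u = r E(μ r² / 4)`. -/
def growU (μ r : ℝ) : ℝ := r * besselE (μ / 4 * r ^ 2)

/-- The companion `u' + u / r` of the growing homogeneous solution. -/
def growX (μ r : ℝ) : ℝ := 2 * besselB (μ / 4 * r ^ 2)

lemma hasDerivAt_mul_growU (μ r : ℝ) :
    HasDerivAt (fun r => r * growU μ r) (r * growX μ r) r := by
  have hq : HasDerivAt (fun r : ℝ => μ / 4 * r ^ 2) (μ / 4 * (2 * r)) r := by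
    simpa using (hasDerivAt_pow 2 r).const_mul (μ / 4)
  -- As `μ` may vanish, `r u` cannot be treated as `(4/μ) t E(t)`. The product rule is used instead,
  -- with an unnamed derivative `d` of `E` that is eliminated by comparison with `(tE)' = B`.
  obtain ⟨d, hd⟩ := exists_hasDerivAt_besselE (μ / 4 * r ^ 2)
  have h1 := hasDerivAt_mul_besselE (μ / 4 * r ^ 2)
  have h2 : besselB (μ / 4 * r ^ 2) = besselE (μ / 4 * r ^ 2) + μ / 4 * r ^ 2 * d := by
    have := h1.unique ((hasDerivAt_id _).mul hd)
    simpa using this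
  have h3 := (hasDerivAt_pow 2 r).mul (hd.comp r hq)
  convert! h3 using 1
  · funext s
    simp only [growU, Pi.mul_apply, Function.comp]
    ring
  · simp only [growX, h2, Function.comp]
    push_cast
    ring

lemma hasDerivAt_growX (μ r : ℝ) : HasDerivAt (growX μ) (μ * growU μ r) r := by
  have hq : HasDerivAt (fun r : ℝ => μ / 4 * r ^ 2) (μ / 4 * (2 * r)) r := by
    simpa using (hasDerivAt_pow 2 r).const_mul (μ / 4)
  have := ((hasDerivAt_besselB (μ / 4 * r ^ 2)).comp r hq).const_mul 2
  convert! this using 1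
  rw [growU]
  ring

lemma continuous_growU (μ : ℝ) : Continuous (growU μ) :=
  continuous_id.mul (continuous_besselE.comp (by fun_prop))

lemma continuous_growX (μ : ℝ) : Continuous (growX μ) :=
  continuous_const.mul (continuous_besselB.comp (by fun_prop))

/-! ### Existence of decaying solutions by reduction of order. -/

lemma RadialSolution.of_continuousOn {μ : ℝ} {f Y X : ℝ → ℂ} (hY : ContinuousOn Y (Ici 1))
    (hX : ContinuousOn X (Ici 1)) (int : ∀ r, 1 ≤ r → IntervalIntegrable f volume 1 r)
    (X_eq : ∀ r, 1 ≤ r → X r = X 1 + ∫ s in (1 : ℝ)..r, ((μ : ℂ) * Y s - f s))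
    (Y_eq : ∀ r : ℝ, 1 ≤ r → r * Y r = Y 1 + ∫ s in (1 : ℝ)..r, (s : ℂ) * X s) :
    RadialSolution μ f (fun r => Y (max 1 r)) (fun r => X (max 1 r)) := by
  have hcm : Continuous fun s : ℝ => max 1 s := by fun_prop
  have hm : ∀ r s : ℝ, 1 ≤ r → s ∈ uIcc 1 r → max 1 s = s := by
    intro r s hr hs
    rw [uIcc_of_le hr] at hs
    exact max_eq_right hs.1
  refine ⟨hY.comp_continuous hcm fun s => mem_Ici.2 (le_max_left _ _),
    hX.comp_continuous hcm fun s => mem_Ici.2 (le_max_left _ _), int, fun r hr => ?_,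
    fun r hr => ?_⟩
  · rw [max_eq_right hr, max_self, X_eq r hr]
    congr 1
    refine intervalIntegral.integral_congr fun s hs => ?_
    rw [hm r s hr hs]
  · rw [max_eq_right hr, max_self, Y_eq r hr]
    congr 1
    refine intervalIntegral.integral_congr fun s hs => ?_
    rw [hm r s hr hs]

lemma intervalIntegrable_of_bound {f : ℝ → ℂ} (hfm : AEStronglyMeasurable f radial) {g : ℝ → ℝ}
    (hg : ContinuousOn g (Ici 1)) (hf : ∀ᵐ r ∂radial, ‖f r‖ ≤ g r) {r : ℝ} (hr : 1 ≤ r) :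
    IntervalIntegrable f volume 1 r := by
  have hgi : IntervalIntegrable g volume 1 r := by
    refine ContinuousOn.intervalIntegrable (hg.mono ?_)
    rw [uIcc_of_le hr]
    exact Icc_subset_Ici_self
  have hsub : uIoc 1 r ⊆ Ioi 1 := by
    rw [uIoc_of_le hr]
    exact Ioc_subset_Ioi_self
  refine hgi.mono_fun (hfm.mono_set hsub) ?_
  filter_upwards [ae_restrict_of_ae_restrict_of_subset hsub hf] with s hs
  exact hs.trans (le_abs_self _)

lemma continuousOn_rpow_Ici (p : ℝ) : ContinuousOn (fun r : ℝ => r ^ p) (Ici 1) :=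
  fun _ hr => (Real.continuousAt_rpow_const _ _
    (Or.inl (zero_lt_one.trans_le hr).ne')).continuousWithinAt

/-- Reduction of order: `Y = u v` with `v' = (c + Q) / (s u²)`, where `u = rE` is the growing
solution and `Q` accumulates `-t u f`. The constant `c` makes `v'` have total integral zero, so one
function `v` vanishes at `1` and at infinity. No Bessel asymptotics are needed: `E` is increasing,
so `Q` contributes at most `E(s)`, the kernel `1/(s u²)` pays for it and leaves `1/E(r)` on `[r,
∞)`, which cancels the growth of `u(r)`. The condition `ρ < 3` makes `Q / E` grow like `s^(3-ρ)`,
and `ρ > 2` makes `r^(2-ρ)` decay. -/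
lemma exists_radialSolution {ρ μ M : ℝ} (hρ2 : 2 < ρ) (hρ3 : ρ < 3) (hμ : 0 ≤ μ)
    {f : ℝ → ℂ} (hfm : AEStronglyMeasurable f radial) (hM : 0 ≤ M)
    (hf : ∀ᵐ r ∂radial, ‖f r‖ ≤ M * r ^ (-ρ)) :
    ∃ Y X : ℝ → ℂ, RadialSolution μ f Y X ∧ Y 1 = 0 ∧ Tendsto Y atTop (𝓝 0) := by
  set u : ℝ → ℝ := growU μ with hu
  set x : ℝ → ℝ := growX μ with hx
  have uc : Continuous u := continuous_growU μ
  have xc : Continuous x := continuous_growX μ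
  set E : ℝ → ℝ := fun r => besselE (μ / 4 * r ^ 2) with hE
  have Emono : ∀ r s : ℝ, 0 ≤ r → r ≤ s → E r ≤ E s := fun r s hr hrs =>
    besselE_mono (by positivity) (by gcongr)
  have E1 : ∀ r, 1 ≤ E r := fun r => one_le_besselE (by positivity)
  have uE : ∀ r, u r = r * E r := fun r => rfl
  have upos : ∀ r, 1 ≤ r → 0 < u r := fun r hr => by
    rw [uE]; exact mul_pos (by linarith) (by linarith [E1 r])
  have fint : ∀ r, 1 ≤ r → IntervalIntegrable f volume 1 r := fun r hr =>
    intervalIntegrable_of_bound hfm (continuousOn_const.mul (continuousOn_rpow_Ici _)) hf hr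
  have cu : Continuous fun t : ℝ => (t : ℂ) * (u t : ℂ) := by fun_prop
  have gint : ∀ r, 1 ≤ r → IntervalIntegrable (fun t => -((t : ℂ) * u t * f t)) volume 1 r :=
    fun r hr => ((fint r hr).continuousOn_mul cu.continuousOn).neg
  -- the accumulated source
  set Q : ℝ → ℂ := fun r => ∫ t in (1 : ℝ)..r, -((t : ℂ) * u t * f t) with hQ
  have Qc : ContinuousOn Q (Ici 1) := by
    intro r hr
    have hr' : (1 : ℝ) ≤ r := hr
    have h := (absolutelyContinuousOnInterval_integral (gint (r + 1) (by linarith))).continuousOn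
    rw [uIcc_of_le (by linarith)] at h
    have h2 := h r ⟨hr', by linarith⟩
    refine h2.mono_of_mem_nhdsWithin ?_
    rw [← Ici_inter_Iic]
    exact inter_mem_nhdsWithin _ (Iic_mem_nhds (by linarith))
  have Qb : ∀ s, 1 ≤ s → ‖Q s‖ ≤ E s * (M * (s ^ (3 - ρ) / (3 - ρ))) := by
    intro s hs
    have hi : IntervalIntegrable (fun t : ℝ => E s * (M * t ^ (2 - ρ))) volume 1 s := by
      refine ContinuousOn.intervalIntegrable ?_
      rw [uIcc_of_le hs]
      exact continuousOn_const.mul (continuousOn_const.mul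
        ((continuousOn_rpow_Ici _).mono Icc_subset_Ici_self))
    have h1 : ‖Q s‖ ≤ ∫ t in (1 : ℝ)..s, E s * (M * t ^ (2 - ρ)) := by
      refine intervalIntegral.norm_integral_le_of_norm_le hs ?_ hi
      filter_upwards [(ae_restrict_iff' measurableSet_Ioi).1 hf] with t ht hts
      have ht1 : 1 < t := hts.1
      have ht0 : 0 < t := by linarith
      rw [norm_neg, norm_mul, norm_mul, Complex.norm_real, Complex.norm_real,
        Real.norm_of_nonneg ht0.le, Real.norm_of_nonneg (upos t ht1.le).le, uE]
      have e : t ^ (2 - ρ) = t * t * t ^ (-ρ) := by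
        rw [sub_eq_add_neg, Real.rpow_add ht0, Real.rpow_two]; ring
      rw [e]
      calc t * (t * E t) * ‖f t‖ ≤ t * (t * E s) * (M * t ^ (-ρ)) := by
            have := Emono t s ht0.le hts.2
            have := E1 t
            have h5 : 0 ≤ t * (t * E s) := mul_nonneg ht0.le (mul_nonneg ht0.le (by linarith))
            have h6 := ht ht1
            gcongr
        _ = _ := by ring
    refine h1.trans ?_
    rw [intervalIntegral.integral_const_mul, intervalIntegral.integral_const_mul,
      integral_rpow (Or.inl (by linarith))]
    have : (2 - ρ + 1) = 3 - ρ := by ring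
    rw [this, Real.one_rpow]
    have := E1 s
    have h3 : 0 < 3 - ρ := by linarith
    gcongr
    linarith
  -- the kernel `1 / (s u²)`
  set w : ℝ → ℝ := fun s => (s * u s ^ 2)⁻¹ with hw
  have wc : ContinuousOn w (Ici 1) := by
    refine ContinuousOn.inv₀ (by fun_prop) fun s hs => ?_
    have h1 : (1 : ℝ) ≤ s := hs
    have := upos s h1
    positivity
  have wpos : ∀ s, 1 ≤ s → 0 < w s := fun s hs => by
    have := upos s hs
    simp only [hw]
    positivity
  -- Of the two factors `E s` in `u²` one cancels; the other is bounded below by `E r`, which keeps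
  -- the bound on the tail proportional to `1 / E r`.
  have wle : ∀ r s, 1 ≤ r → r ≤ s → w s * E s ≤ s ^ (-(3 : ℝ)) / E r := by
    intro r s hr hrs
    have hs : 0 < s := by linarith
    have h1 := Emono r s (by linarith) hrs
    have h2 := E1 r
    have h3 : 0 < E s := by linarith
    have e : w s * E s = s ^ (-(3 : ℝ)) / E s := by
      rw [Real.rpow_neg hs.le, show (3 : ℝ) = (3 : ℕ) by norm_num, Real.rpow_natCast]
      simp only [hw, uE]
      field_simp
    rw [e]
    gcongr
  set K₁ : ℝ := M / (3 - ρ) with hK₁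
  have hK₁0 : 0 ≤ K₁ := div_nonneg hM (by linarith)
  have pow3 : ∀ s : ℝ, 1 ≤ s → s ^ (-(3 : ℝ)) ≤ s ^ (-ρ) := fun s hs =>
    Real.rpow_le_rpow_of_exponent_le hs (by linarith)
  have bound : ∀ c : ℂ, ∀ r s : ℝ, 1 ≤ r → r ≤ s →
      ‖(c + Q s) * (w s : ℂ)‖ ≤ (‖c‖ + K₁) / E r * s ^ (-ρ) := by
    intro c r s hr hrs
    have hs : 1 ≤ s := hr.trans hrs
    have hs0 : 0 < s := by linarith
    have hEr := E1 r
    have hEs := E1 s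
    have hwp := wpos s hs
    have hwE := wle r s hr hrs
    rw [norm_mul, Complex.norm_real, Real.norm_of_nonneg hwp.le]
    have hs3 : 1 ≤ s ^ (3 - ρ) := Real.one_le_rpow hs (by linarith)
    have h1 : ‖c + Q s‖ ≤ (‖c‖ + K₁) * s ^ (3 - ρ) * E s := by
      refine (norm_add_le _ _).trans ?_
      have h2 := Qb s hs
      have h3 : ‖c‖ ≤ ‖c‖ * (s ^ (3 - ρ) * E s) :=
        le_mul_of_one_le_right (norm_nonneg _) (by nlinarith)
      have h4 : E s * (M * (s ^ (3 - ρ) / (3 - ρ))) = K₁ * (s ^ (3 - ρ) * E s) := by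
        rw [hK₁]; ring
      rw [h4] at h2
      linarith [h2, h3]
    calc ‖c + Q s‖ * w s ≤ (‖c‖ + K₁) * s ^ (3 - ρ) * E s * w s := by gcongr
      _ = (‖c‖ + K₁) * s ^ (3 - ρ) * (w s * E s) := by ring
      _ ≤ (‖c‖ + K₁) * s ^ (3 - ρ) * (s ^ (-(3 : ℝ)) / E r) := by gcongr
      _ = (‖c‖ + K₁) / E r * (s ^ (3 - ρ) * s ^ (-(3 : ℝ))) := by ring
      _ = _ := by
        rw [← Real.rpow_add hs0]
        congr 2
        ring
  have pc : ∀ c : ℂ, ContinuousOn (fun s => (c + Q s) * (w s : ℂ)) (Ici 1) := fun c =>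
    (continuousOn_const.add Qc).mul (Complex.continuous_ofReal.comp_continuousOn wc)
  have rint : ∀ r : ℝ, 1 ≤ r → IntegrableOn (fun s : ℝ => s ^ (-ρ)) (Ioi r) := fun r hr =>
    integrableOn_Ioi_rpow_of_lt (by linarith) (by linarith)
  have pint : ∀ c : ℂ, IntegrableOn (fun s => (c + Q s) * (w s : ℂ)) (Ioi 1) := by
    intro c
    refine Integrable.mono' ((rint 1 le_rfl).const_mul ((‖c‖ + K₁) / E 1)) ?_ ?_
    · exact ((pc c).mono Ioi_subset_Ici_self).aestronglyMeasurable measurableSet_Ioi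
    · filter_upwards [ae_restrict_mem measurableSet_Ioi] with s hs
      exact bound c 1 s le_rfl (le_of_lt hs)
  -- the constant making the solution decay
  obtain ⟨c, hc⟩ : ∃ c : ℂ, ∫ s in Ioi 1, (c + Q s) * (w s : ℂ) = 0 := by
    have wint : IntegrableOn w (Ioi 1) := by
      refine Integrable.mono' (rint 1 le_rfl) ?_ ?_
      · exact (wc.mono Ioi_subset_Ici_self).aestronglyMeasurable measurableSet_Ioi
      · filter_upwards [ae_restrict_mem measurableSet_Ioi] with s hs
        have hs1 : (1 : ℝ) ≤ s := le_of_lt hs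
        have h1 := wle 1 s le_rfl hs1
        have h2 := wpos s hs1
        have h3 : s ^ (-(3 : ℝ)) / E 1 ≤ s ^ (-(3 : ℝ)) :=
          div_le_self (Real.rpow_nonneg (by linarith) _) (E1 1)
        rw [Real.norm_of_nonneg h2.le]
        have h4 : w s ≤ w s * E s := le_mul_of_one_le_right h2.le (E1 s)
        exact h4.trans (h1.trans (h3.trans (pow3 s hs1)))
    have I0 : 0 < ∫ s in Ioi 1, w s := by
      rw [setIntegral_pos_iff_support_of_nonneg_ae _ wint]
      · have : Ioi (1 : ℝ) ⊆ Function.support w ∩ Ioi 1 := fun s hs =>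
          ⟨(wpos s (le_of_lt hs)).ne', hs⟩
        refine lt_of_lt_of_le ?_ (measure_mono this)
        simp
      · filter_upwards [ae_restrict_mem measurableSet_Ioi] with s hs
        exact (wpos s (le_of_lt hs)).le
    have hI0 : ((∫ s in Ioi 1, w s : ℝ) : ℂ) ≠ 0 := by exact_mod_cast I0.ne'
    have Qint := pint 0
    simp only [zero_add] at Qint
    refine ⟨-(∫ s in Ioi 1, Q s * (w s : ℂ)) / ((∫ s in Ioi 1, w s : ℝ) : ℂ), ?_⟩
    have hadd : ∀ c : ℂ, ∫ s in Ioi 1, (c + Q s) * (w s : ℂ) =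
        c * ((∫ s in Ioi 1, w s : ℝ) : ℂ) + ∫ s in Ioi 1, Q s * (w s : ℂ) := fun c => by
      simp_rw [add_mul]
      rw [← integral_complex_ofReal, ← integral_const_mul]
      exact integral_add (wint.ofReal.const_mul _) Qint
    rw [hadd, div_mul_cancel₀ _ hI0]
    ring
  set p : ℝ → ℂ := fun s => (c + Q s) * (w s : ℂ) with hp
  set v : ℝ → ℂ := fun r => ∫ s in (1 : ℝ)..r, p s with hv
  have pii : ∀ r, 1 ≤ r → IntervalIntegrable p volume 1 r := fun r hr => by
    refine ContinuousOn.intervalIntegrable ((pc c).mono ?_)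
    rw [uIcc_of_le hr]
    exact Icc_subset_Ici_self
  -- By the choice of `c` the primitive from `1` is minus the integral over the tail, so the decay
  -- of `v` can be read off.
  have vtail : ∀ r, 1 ≤ r → v r = -∫ s in Ioi r, p s := by
    intro r hr
    have := intervalIntegral.integral_Ioi_sub_Ioi (f := p) (pint c) hr
    rw [hc, zero_sub] at this
    exact this.symm
  have vc : ContinuousOn v (Ici 1) := by
    intro r hr
    have hr' : (1 : ℝ) ≤ r := hr
    have h := (absolutelyContinuousOnInterval_integral (pii (r + 1) (by linarith))).continuousOn
    rw [uIcc_of_le (by linarith)] at h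
    have h2 := h r ⟨hr', by linarith⟩
    refine h2.mono_of_mem_nhdsWithin ?_
    rw [← Ici_inter_Iic]
    exact inter_mem_nhdsWithin _ (Iic_mem_nhds (by linarith))
  set Y : ℝ → ℂ := fun r => (u r : ℂ) * v r with hY
  set X : ℝ → ℂ := fun r => (x r : ℂ) * v r + (((r * u r)⁻¹ : ℝ) : ℂ) * (c + Q r) with hX
  have v1 : v 1 = 0 := by simp [hv]
  have Q1 : Q 1 = 0 := by simp [hQ]
  have dru : ∀ s : ℝ, HasDerivAt (fun s : ℝ => (((s * u s : ℝ)) : ℂ)) ((s * x s : ℝ) : ℂ) s :=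
    fun s => (hasDerivAt_mul_growU μ s).ofReal_comp
  have dx : ∀ s : ℝ, HasDerivAt (fun s : ℝ => ((x s : ℝ) : ℂ)) ((μ * u s : ℝ) : ℂ) s :=
    fun s => (hasDerivAt_growX μ s).ofReal_comp
  have ivc : ContinuousOn (fun r : ℝ => (r * u r)⁻¹) (Ici 1) := by
    refine ContinuousOn.inv₀ (by fun_prop) fun s hs => ?_
    have h1 : (1 : ℝ) ≤ s := hs
    have := upos s h1
    positivity
  have Yc : ContinuousOn Y (Ici 1) :=
    (Complex.continuous_ofReal.comp uc).continuousOn.mul vc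
  have Xc : ContinuousOn X (Ici 1) :=
    ((Complex.continuous_ofReal.comp xc).continuousOn.mul vc).add
      ((Complex.continuous_ofReal.comp_continuousOn ivc).mul (continuousOn_const.add Qc))
  have Y_eq : ∀ r : ℝ, 1 ≤ r → r * Y r = Y 1 + ∫ s in (1 : ℝ)..r, (s : ℂ) * X s := by
    intro r hr
    have h := mul_primitive_sub (h := fun s : ℝ => (((s * u s : ℝ)) : ℂ))
      (h' := fun s => ((s * x s : ℝ) : ℂ)) 0 (pii r hr) (fun s _ => dru s) (by fun_prop)
    simp only [zero_add, mul_zero, sub_zero] at h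
    have e1 : Y 1 = 0 := by simp [hY, v1]
    rw [e1, zero_add, hY]
    simp only
    rw [← mul_assoc, ← Complex.ofReal_mul, hv, h]
    refine intervalIntegral.integral_congr fun s hs => ?_
    rw [uIcc_of_le hr] at hs
    have us := (upos s hs.1).ne'
    have hs0 : s ≠ 0 := by linarith [hs.1]
    have us' : (u s : ℂ) ≠ 0 := by exact_mod_cast us
    have hs0' : (s : ℂ) ≠ 0 := by exact_mod_cast hs0
    simp only [hX, hp, hv, hw]
    push_cast
    field_simp
  have X_eq : ∀ r, 1 ≤ r → X r = X 1 + ∫ s in (1 : ℝ)..r, ((μ : ℂ) * Y s - f s) := by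
    intro r hr
    have hsub : uIcc 1 r ⊆ Ici 1 := by
      rw [uIcc_of_le hr]
      exact Icc_subset_Ici_self
    have h1 := mul_primitive_sub (h := fun s : ℝ => ((x s : ℝ) : ℂ))
      (h' := fun s => ((μ * u s : ℝ) : ℂ)) 0 (pii r hr) (fun s _ => dx s) (by fun_prop)
    have dinv : ∀ s ∈ uIcc 1 r, HasDerivAt (fun s : ℝ => (((s * u s)⁻¹ : ℝ) : ℂ))
        ((-(s * x s) / (s * u s) ^ 2 : ℝ) : ℂ) s := fun s hs => by
      have hs1 : 1 ≤ s := hsub hs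
      have := upos s hs1
      exact ((hasDerivAt_mul_growU μ s).inv (by positivity)).ofReal_comp
    have cinv : ContinuousOn (fun s : ℝ => ((-(s * x s) / (s * u s) ^ 2 : ℝ) : ℂ)) (uIcc 1 r) := by
      refine Complex.continuous_ofReal.comp_continuousOn (ContinuousOn.div (by fun_prop)
        (by fun_prop) fun s hs => ?_)
      have hs1 : 1 ≤ s := hsub hs
      have := upos s hs1
      positivity
    have h2 := mul_primitive_sub c (gint r hr) dinv cinv
    have i1 : IntervalIntegrable (fun s => ((μ * u s : ℝ) : ℂ) * (0 + ∫ t in (1 : ℝ)..s, p t)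
        + ((x s : ℝ) : ℂ) * p s) volume 1 r := by
      refine ContinuousOn.intervalIntegrable (ContinuousOn.add (ContinuousOn.mul (by fun_prop)
        (continuousOn_const.add (vc.mono hsub))) (ContinuousOn.mul (by fun_prop)
        ((pc c).mono hsub)))
    have i2 : IntervalIntegrable (fun s => ((-(s * x s) / (s * u s) ^ 2 : ℝ) : ℂ) *
        (c + ∫ t in (1 : ℝ)..s, -((t : ℂ) * u t * f t)) + (((s * u s)⁻¹ : ℝ) : ℂ) *
        -((s : ℂ) * u s * f s)) volume 1 r := by
      refine IntervalIntegrable.add ?_ ?_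
      · exact (cinv.mul (continuousOn_const.add (Qc.mono hsub))).intervalIntegrable
      · exact (gint r hr).continuousOn_mul
          ((Complex.continuous_ofReal.comp_continuousOn (ivc.mono hsub)))
    have e := intervalIntegral.integral_add i1 i2
    rw [← h1, ← h2] at e
    have e' := (intervalIntegral.integral_congr (μ := volume) (a := 1) (b := r)
      (f := fun s => (μ : ℂ) * Y s - f s) fun s hs => ?_).trans e
    rotate_left
    · have hs1 : 1 ≤ s := hsub hs
      have us := (upos s hs1).ne'
      have hs0 : s ≠ 0 := by linarith
      have us' : (u s : ℂ) ≠ 0 := by exact_mod_cast us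
      have hs0' : (s : ℂ) ≠ 0 := by exact_mod_cast hs0
      simp only [hY, hp, hv, hw, zero_add]
      rw [show (∫ t in (1 : ℝ)..s, -((t : ℂ) * u t * f t)) = Q s from rfl]
      push_cast
      field_simp
      ring
    rw [e']
    simp only [hX, v1, Q1]
    simp only [hv, zero_add, mul_zero, sub_zero, add_zero]
    rw [show (∫ t in (1 : ℝ)..r, -((t : ℂ) * u t * f t)) = Q r from rfl]
    ring
  have Yb : ∀ r, 1 ≤ r → ‖Y r‖ ≤ (‖c‖ + K₁) / (ρ - 1) * r ^ (-(ρ - 2)) := by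
    intro r hr
    have hr0 : 0 < r := by linarith
    have hEr := E1 r
    have h1 : ‖v r‖ ≤ (‖c‖ + K₁) / E r * (r ^ (-(ρ - 1)) / (ρ - 1)) := by
      rw [vtail r hr, norm_neg]
      have h2 : ∫ s in Ioi r, (‖c‖ + K₁) / E r * s ^ (-ρ) =
          (‖c‖ + K₁) / E r * (r ^ (-(ρ - 1)) / (ρ - 1)) := by
        rw [integral_const_mul, integral_Ioi_rpow_of_lt (by linarith) hr0]
        congr 1
        rw [show -ρ + 1 = -(ρ - 1) by ring, neg_div_neg_eq]
      rw [← h2]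
      refine norm_integral_le_of_norm_le ((rint r hr).const_mul _) ?_
      filter_upwards [ae_restrict_mem measurableSet_Ioi] with s hs
      exact bound c r s hr (le_of_lt hs)
    have hρ1 : 0 < ρ - 1 := by linarith
    calc ‖Y r‖ = r * E r * ‖v r‖ := by
          simp only [hY]
          rw [norm_mul, Complex.norm_real, Real.norm_of_nonneg (upos r hr).le, uE]
      _ ≤ r * E r * ((‖c‖ + K₁) / E r * (r ^ (-(ρ - 1)) / (ρ - 1))) := by gcongr
      _ = (‖c‖ + K₁) / (ρ - 1) * (r ^ (1 : ℝ) * r ^ (-(ρ - 1))) := by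
          rw [Real.rpow_one]; field_simp
      _ = _ := by
          rw [← Real.rpow_add hr0]
          congr 2
          ring
  refine ⟨_, _, RadialSolution.of_continuousOn Yc Xc fint X_eq Y_eq, ?_, ?_⟩
  · simp [hY, v1]
  · refine squeeze_zero_norm' (a := fun r => (‖c‖ + K₁) / (ρ - 1) * r ^ (-(ρ - 2))) ?_ ?_
    · filter_upwards [eventually_ge_atTop 1] with r hr
      rw [max_eq_right hr]
      exact Yb r hr
    · simpa using (tendsto_rpow_neg_atTop (by linarith : 0 < ρ - 2)).const_mul
        ((‖c‖ + K₁) / (ρ - 1))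

/-! ### The weighted spaces -/

lemma WLinf.ae_norm_le {ρ : ℝ} (f : WLinf ρ) :
    ∀ᵐ r ∂radial, ‖(f : Profile) r‖ ≤ ‖f‖ * r ^ (-ρ) := by
  have h := ae_le_essSup (μ := radial)
    (f := fun r => ENNReal.ofReal (r ^ ρ) * ‖(f : Profile) r‖ₑ)
  filter_upwards [h, ae_restrict_mem measurableSet_Ioi] with r hr hr1
  have h0 : (0 : ℝ) < r := zero_lt_one.trans hr1
  have hp : 0 < r ^ ρ := Real.rpow_pos_of_pos h0 _
  have hfin : weightedSup ρ (f : Profile) ≠ ∞ := f.2.ne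
  have h2 := ENNReal.toReal_mono hfin hr
  rw [ENNReal.toReal_mul, ENNReal.toReal_ofReal hp.le, toReal_enorm] at h2
  rw [Real.rpow_neg h0.le, ← div_eq_mul_inv, le_div_iff₀ hp, mul_comm]
  exact h2

lemma weightedSup_le {σ M : ℝ} {F : ℝ → ℂ} (hF : ∀ᵐ r ∂radial, ‖F r‖ ≤ M * r ^ (-σ)) :
    weightedSup σ F ≤ ENNReal.ofReal M := by
  refine essSup_le_of_ae_le _ ?_
  filter_upwards [hF, ae_restrict_mem measurableSet_Ioi] with r hr hr1
  have h0 : (0 : ℝ) < r := zero_lt_one.trans hr1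
  have hp : 0 < r ^ σ := Real.rpow_pos_of_pos h0 _
  rw [← ofReal_norm, ← ENNReal.ofReal_mul hp.le]
  refine ENNReal.ofReal_le_ofReal ?_
  rwa [Real.rpow_neg h0.le, ← div_eq_mul_inv, le_div_iff₀ hp, mul_comm] at hr

/-- The element of `L^∞_σ` given by a function. -/
def WLinf.mk {σ M : ℝ} (F : ℝ → ℂ) (hm : AEStronglyMeasurable F radial)
    (hF : ∀ᵐ r ∂radial, ‖F r‖ ≤ M * r ^ (-σ)) : WLinf σ :=
  ⟨AEEqFun.mk F hm, by
    change weightedSup σ _ < ∞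
    rw [weightedSup_congr σ (AEEqFun.coeFn_mk F hm)]
    exact (weightedSup_le hF).trans_lt ENNReal.ofReal_lt_top⟩

lemma WLinf.coe_mk {σ M : ℝ} (F : ℝ → ℂ) (hm : AEStronglyMeasurable F radial)
    (hF : ∀ᵐ r ∂radial, ‖F r‖ ≤ M * r ^ (-σ)) : (WLinf.mk F hm hF : Profile) =ᵐ[radial] F :=
  AEEqFun.coeFn_mk F hm

lemma WLinf.norm_le {σ M : ℝ} (hM : 0 ≤ M) {f : WLinf σ}
    (hF : ∀ᵐ r ∂radial, ‖(f : Profile) r‖ ≤ M * r ^ (-σ)) : ‖f‖ ≤ M := by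
  rw [norm_def]
  exact ENNReal.toReal_le_of_le_ofReal hM (weightedSup_le hF)

lemma WLinf.ext_ae {σ : ℝ} {f g : WLinf σ} (h : (f : Profile) =ᵐ[radial] (g : Profile)) : f = g :=
  Subtype.ext (AEEqFun.ext h)

lemma WLinf.coe_add {σ : ℝ} (f g : WLinf σ) :
    ((f + g : WLinf σ) : Profile) =ᵐ[radial] fun r => (f : Profile) r + (g : Profile) r :=
  AEEqFun.coeFn_add _ _

lemma WLinf.coe_smul {σ : ℝ} (c : ℂ) (f : WLinf σ) :
    ((c • f : WLinf σ) : Profile) =ᵐ[radial] fun r => c * (f : Profile) r :=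
  AEEqFun.coeFn_smul _ _

lemma WLinf.coe_sub {σ : ℝ} (f g : WLinf σ) :
    ((f - g : WLinf σ) : Profile) =ᵐ[radial] fun r => (f : Profile) r - (g : Profile) r :=
  AEEqFun.coeFn_sub _ _

/-- A linear assignment of functions to the elements of `L^∞_ρ`, bounded into `L^∞_σ`. -/
structure BoundedAssignment (ρ σ C : ℝ) (Φ : WLinf ρ → ℝ → ℂ) : Prop where
  meas : ∀ f, AEStronglyMeasurable (Φ f) radial
  add : ∀ f g, ∀ᵐ r ∂radial, Φ (f + g) r = Φ f r + Φ g r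
  smul : ∀ (c : ℂ) (f), ∀ᵐ r ∂radial, Φ (c • f) r = c * Φ f r
  bound : ∀ f, ∀ᵐ r ∂radial, ‖Φ f r‖ ≤ C * ‖f‖ * r ^ (-σ)

namespace BoundedAssignment

variable {ρ σ C : ℝ} {Φ : WLinf ρ → ℝ → ℂ}

/-- The bounded operator given by a bounded assignment. -/
def op (h : BoundedAssignment ρ σ C Φ) : WLinf ρ →L[ℂ] WLinf σ :=
  LinearMap.mkContinuous
    { toFun := fun f => WLinf.mk (Φ f) (h.meas f) (h.bound f)
      map_add' := fun f g => WLinf.ext_ae <| by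
        filter_upwards [WLinf.coe_mk _ (h.meas (f + g)) (h.bound (f + g)), h.add f g,
          WLinf.coe_mk _ (h.meas f) (h.bound f), WLinf.coe_mk _ (h.meas g) (h.bound g),
          WLinf.coe_add (WLinf.mk _ (h.meas f) (h.bound f)) (WLinf.mk _ (h.meas g) (h.bound g))]
          with r h1 h2 h3 h4 h5
        rw [h1, h5, h3, h4, h2]
      map_smul' := fun c f => WLinf.ext_ae <| by
        filter_upwards [WLinf.coe_mk _ (h.meas (c • f)) (h.bound (c • f)), h.smul c f,
          WLinf.coe_mk _ (h.meas f) (h.bound f),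
          WLinf.coe_smul c (WLinf.mk _ (h.meas f) (h.bound f))] with r h1 h2 h3 h5
        rw [h1, RingHom.id_apply, h5, h3, h2] }
    -- The sign of `C` is not part of the hypotheses.
    (max C 0) fun f => WLinf.norm_le (by positivity) <| by
      filter_upwards [WLinf.coe_mk _ (h.meas f) (h.bound f), h.bound f,
        ae_restrict_mem measurableSet_Ioi] with r h1 h2 hr
      have h0 : (0 : ℝ) < r := zero_lt_one.trans hr
      simp only [LinearMap.coe_mk, AddHom.coe_mk]
      rw [h1]
      refine h2.trans ?_
      have := Real.rpow_nonneg h0.le (-σ)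
      gcongr
      exact le_max_left _ _

lemma coe_op (h : BoundedAssignment ρ σ C Φ) (f : WLinf ρ) :
    (h.op f : Profile) =ᵐ[radial] Φ f := WLinf.coe_mk _ (h.meas f) (h.bound f)

lemma norm_op_le (h : BoundedAssignment ρ σ C Φ) (hC : 0 ≤ C) : ‖h.op‖ ≤ C :=
  (LinearMap.mkContinuous_norm_le _ (le_max_right _ _) _).trans_eq (max_eq_left hC)

end BoundedAssignment

/-! ### Decaying solutions with Dirichlet condition -/

/-- Decaying solutions of the system at frequency `ζ` which vanish at `r = 1`. -/
structure DirichletSolution (ζ : ℝ) (f Y X : ℝ → ℂ) : Prop extends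
    RadialSolution (ζ ^ 2) f Y X where
  zero : Y 1 = 0
  tendsto : Tendsto Y atTop (𝓝 0)

namespace DirichletSolution

variable {ζ : ℝ} {f Y X : ℝ → ℂ}

lemma add {f₂ Y₂ X₂ : ℝ → ℂ} (h : DirichletSolution ζ f Y X) (h₂ : DirichletSolution ζ f₂ Y₂ X₂) :
    DirichletSolution ζ (f + f₂) (Y + Y₂) (X + X₂) where
  toRadialSolution := h.toRadialSolution.add h₂.toRadialSolution
  zero := by simp [h.zero, h₂.zero]
  tendsto := by simpa [Pi.add_def] using Tendsto.add h.tendsto h₂.tendsto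

lemma smul (h : DirichletSolution ζ f Y X) (c : ℂ) :
    DirichletSolution ζ (c • f) (c • Y) (c • X) where
  toRadialSolution := h.toRadialSolution.smul c
  zero := by simp [h.zero]
  tendsto := by simpa [Pi.smul_def] using h.tendsto.const_smul c

lemma shift (h : DirichletSolution ζ f Y X) (ξ : ℝ) :
    DirichletSolution ξ (f + ((ξ ^ 2 - ζ ^ 2 : ℝ) : ℂ) • Y) Y X where
  toRadialSolution := h.toRadialSolution.shift (ξ ^ 2)
  zero := h.zero
  tendsto := h.tendsto

/-- The constant in the estimates for the streamfunction. -/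
def _root_.AxiBiotSavart.streamConst (ρ : ℝ) : ℝ := 9 / (1 - (ρ - 2) ^ 2)

lemma _root_.AxiBiotSavart.streamConst_pos {ρ : ℝ} (hρ2 : 2 < ρ) (hρ3 : ρ < 3) :
    0 < streamConst ρ := div_pos (by norm_num) (by nlinarith)

variable {ρ M : ℝ}

/-- With `x = |ζ| r`, nine times the denominator `1 + x²/9` of the barrier dominates each of `1`,
`x` and `x²`. One estimate thus trades powers of `ζ` for powers of `1/r`. -/
lemma norm_Y_le (hρ2 : 2 < ρ) (hρ3 : ρ < 3) (h : DirichletSolution ζ f Y X) (hM : 0 ≤ M)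
    (hf : ∀ᵐ r ∂radial, ‖f r‖ ≤ M * r ^ (-ρ)) {r : ℝ} (hr : 1 ≤ r) :
    ‖Y r‖ ≤ streamConst ρ * M * r ^ (-(ρ - 2)) ∧
      |ζ| * ‖Y r‖ ≤ streamConst ρ * M * r ^ (-(ρ - 1)) ∧
      ζ ^ 2 * ‖Y r‖ ≤ streamConst ρ * M * r ^ (-ρ) := by
  have h0 : 0 < r := by linarith
  have hb := h.norm_stream_le hρ2 hρ3 (sq_nonneg ζ) h.zero h.tendsto hM hf hr
  have hpos : 0 < 1 - (ρ - 2) ^ 2 := by nlinarith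
  obtain ⟨A, hA⟩ : ∃ A, A = M / (1 - (ρ - 2) ^ 2) * r ^ (-(ρ - 2)) := ⟨_, rfl⟩
  have hA0 : 0 ≤ A := by rw [hA]; positivity
  have hG : 0 < 1 + ζ ^ 2 / 9 * r ^ 2 := by positivity
  rw [← mul_div_assoc, ← hA, le_div_iff₀ hG] at hb
  have e0 : streamConst ρ * M * r ^ (-(ρ - 2)) = 9 * A := by
    rw [hA, streamConst]; ring
  have e1 : r ^ (-(ρ - 1)) = r ^ (-(ρ - 2)) / r := by
    rw [← Real.rpow_sub_one h0.ne']; congr 1; ring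
  have e2 : r ^ (-ρ) = r ^ (-(ρ - 2)) / r ^ 2 := by
    rw [← Real.rpow_two, ← Real.rpow_sub h0]; congr 1; ring
  have hYn := norm_nonneg (Y r)
  have hsq : ζ ^ 2 = |ζ| ^ 2 := (sq_abs ζ).symm
  have hz := abs_nonneg ζ
  rw [e1, e2, ← mul_div_assoc, ← mul_div_assoc, e0, le_div_iff₀ h0, le_div_iff₀ (by positivity)]
  rw [hsq] at hb ⊢
  refine ⟨?_, ?_, ?_⟩
  · nlinarith [mul_nonneg hYn (mul_nonneg (sq_nonneg |ζ|) (sq_nonneg r))]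
  · nlinarith [mul_nonneg hYn (sq_nonneg (|ζ| * r - 3)), mul_nonneg hYn (sq_nonneg (|ζ| * r))]
  · nlinarith [mul_nonneg hYn (mul_nonneg (sq_nonneg |ζ|) (sq_nonneg r))]

/-- Both bounds come from the interpolation inequality: with step `d = r` and the first bound on
`Y`, or with step `d = 1/|ζ|` and the bound on `ζ² Y`. -/
lemma norm_X_le_of (hρ2 : 2 < ρ) (hρ3 : ρ < 3) (h : DirichletSolution ζ f Y X) (hM : 0 ≤ M)
    (hf : ∀ᵐ r ∂radial, ‖f r‖ ≤ M * r ^ (-ρ)) {r : ℝ} (hr : 1 ≤ r) :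
    ‖X r‖ ≤ (3 * streamConst ρ + 1) * M * r ^ (-(ρ - 1)) ∧
      |ζ| * ‖X r‖ ≤ (3 * streamConst ρ + 1) * M * r ^ (-ρ) := by
  have h0 : 0 < r := by linarith
  have hS := streamConst_pos hρ2 hρ3
  have hK : ∀ᵐ s ∂radial, r ≤ s →
      ‖((ζ ^ 2 : ℝ) : ℂ) * Y s - f s‖ ≤ (streamConst ρ + 1) * M * r ^ (-ρ) := by
    filter_upwards [hf, ae_restrict_mem measurableSet_Ioi] with s hs hs1 hrs
    have h1 := (h.norm_Y_le hρ2 hρ3 hM hf (r := s) (le_of_lt hs1)).2.2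
    refine (norm_sub_le _ _).trans ?_
    rw [norm_mul, Complex.norm_real, Real.norm_of_nonneg (sq_nonneg ζ)]
    have h2 : s ^ (-ρ) ≤ r ^ (-ρ) := Real.rpow_le_rpow_of_nonpos h0 hrs (by linarith)
    calc ζ ^ 2 * ‖Y s‖ + ‖f s‖ ≤ (streamConst ρ + 1) * M * s ^ (-ρ) := by linarith
      _ ≤ _ := by gcongr
  have hr1 : r ^ (-(ρ - 2)) = r * r ^ (-(ρ - 1)) := by
    rw [show -(ρ - 2) = 1 + -(ρ - 1) by ring, Real.rpow_add h0, Real.rpow_one]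
  have hr2 : r ^ (-(ρ - 1)) = r * r ^ (-ρ) := by
    rw [show -(ρ - 1) = 1 + -ρ by ring, Real.rpow_add h0, Real.rpow_one]
  constructor
  · have hb := fun s (hs : r ≤ s) => ((h.norm_Y_le hρ2 hρ3 hM hf (hr.trans hs)).1).trans
      (show _ ≤ streamConst ρ * M * r ^ (-(ρ - 2)) by
        have : s ^ (-(ρ - 2)) ≤ r ^ (-(ρ - 2)) :=
          Real.rpow_le_rpow_of_nonpos h0 hs (by linarith)
        gcongr)
    have := h.norm_X_le hr h0 hK (hb r le_rfl) (hb (r + r) (by linarith))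
    refine this.trans_eq ?_
    rw [hr1, hr2]
    field_simp
    ring
  · rcases eq_or_ne ζ 0 with rfl | hζ
    · simp
      positivity
    · have hz : 0 < |ζ| := abs_pos.2 hζ
      have hb := fun s (hs : r ≤ s) => (show ‖Y s‖ ≤ streamConst ρ * M * r ^ (-ρ) / ζ ^ 2 by
        rw [le_div_iff₀ (by positivity), mul_comm]
        refine ((h.norm_Y_le hρ2 hρ3 hM hf (hr.trans hs)).2.2).trans ?_
        have : s ^ (-ρ) ≤ r ^ (-ρ) :=
          Real.rpow_le_rpow_of_nonpos h0 hs (by linarith)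
        gcongr)
      have := h.norm_X_le hr (inv_pos.2 hz) hK (hb r le_rfl) (hb _ (by
        have := inv_pos.2 hz
        linarith))
      have h2 := mul_le_mul_of_nonneg_left this hz.le
      refine h2.trans_eq ?_
      rw [← sq_abs ζ]
      field_simp
      ring

lemma eq_zero (hρ2 : 2 < ρ) (hρ3 : ρ < 3) (h : DirichletSolution ζ f Y X)
    (hf : f =ᵐ[radial] 0) {r : ℝ} (hr : 1 ≤ r) : Y r = 0 ∧ X r = 0 := by
  have hf' : ∀ᵐ r ∂radial, ‖f r‖ ≤ 0 * r ^ (-ρ) := by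
    filter_upwards [hf] with r hr
    simp [hr]
  have h1 := (h.norm_Y_le hρ2 hρ3 le_rfl hf' hr).1
  have h2 := (h.norm_X_le_of hρ2 hρ3 le_rfl hf' hr).1
  simpa using And.intro h1 h2

end DirichletSolution

/-- The conditions on `ρ` stand inside the existential, so that the chosen solutions are functions
of `ρ`, `ζ`, `f` alone and carry no proofs as arguments. -/
lemma exists_dirichletSolution (ρ ζ : ℝ) (f : WLinf ρ) : ∃ P : (ℝ → ℂ) × (ℝ → ℂ),
    2 < ρ → ρ < 3 → DirichletSolution ζ (f : Profile) P.1 P.2 := by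
  by_cases h : 2 < ρ ∧ ρ < 3
  · obtain ⟨Y, X, h1, h2, h3⟩ := exists_radialSolution h.1 h.2 (sq_nonneg ζ)
      (f : Profile).aestronglyMeasurable (norm_nonneg f) (WLinf.ae_norm_le f)
    exact ⟨(Y, X), fun _ _ => ⟨h1, h2, h3⟩⟩
  · exact ⟨0, fun h1 h2 => absurd ⟨h1, h2⟩ h⟩

/-- The solution `Y` at frequency `ζ` with right-hand side `f`. -/
def solY (ρ ζ : ℝ) (f : WLinf ρ) : ℝ → ℂ := (exists_dirichletSolution ρ ζ f).choose.1

/-- The companion `X = Y' + Y / r` of the solution at frequency `ζ` with right-hand side `f`. -/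
def solX (ρ ζ : ℝ) (f : WLinf ρ) : ℝ → ℂ := (exists_dirichletSolution ρ ζ f).choose.2

section

variable {ρ : ℝ} (hρ2 : 2 < ρ) (hρ3 : ρ < 3)

include hρ2 hρ3

lemma dirichletSolution_sol (ζ : ℝ) (f : WLinf ρ) :
    DirichletSolution ζ (f : Profile) (solY ρ ζ f) (solX ρ ζ f) :=
  (exists_dirichletSolution ρ ζ f).choose_spec hρ2 hρ3

/-- The difference of two solutions has zero source, and the a priori bounds make it vanish.
Linearity in `f` and the resolvent identity are instances. -/
lemma sol_eq {ζ : ℝ} {f : WLinf ρ} {g Y X : ℝ → ℂ} (h : DirichletSolution ζ g Y X)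
    (hg : g =ᵐ[radial] (f : Profile)) {r : ℝ} (hr : 1 ≤ r) :
    solY ρ ζ f r = Y r ∧ solX ρ ζ f r = X r := by
  have h1 := (dirichletSolution_sol hρ2 hρ3 ζ f).add (h.smul (-1))
  have h2 := h1.eq_zero hρ2 hρ3 (by
    filter_upwards [hg] with r hr
    simp [hr]) hr
  simp only [Pi.add_apply, Pi.smul_apply, smul_eq_mul, neg_mul, one_mul] at h2
  exact ⟨by linear_combination h2.1, by linear_combination h2.2⟩

lemma sol_add (ζ : ℝ) (f g : WLinf ρ) {r : ℝ} (hr : 1 ≤ r) :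
    solY ρ ζ (f + g) r = solY ρ ζ f r + solY ρ ζ g r ∧
      solX ρ ζ (f + g) r = solX ρ ζ f r + solX ρ ζ g r :=
  sol_eq hρ2 hρ3 ((dirichletSolution_sol hρ2 hρ3 ζ f).add (dirichletSolution_sol hρ2 hρ3 ζ g))
    (WLinf.coe_add f g).symm hr

lemma sol_smul (ζ : ℝ) (c : ℂ) (f : WLinf ρ) {r : ℝ} (hr : 1 ≤ r) :
    solY ρ ζ (c • f) r = c * solY ρ ζ f r ∧ solX ρ ζ (c • f) r = c * solX ρ ζ f r :=
  sol_eq hρ2 hρ3 ((dirichletSolution_sol hρ2 hρ3 ζ f).smul c) (WLinf.coe_smul c f).symm hr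

/-- The resolvent identity, with `P` standing for `ξ ^ 2 Y`. -/
lemma sol_resolvent (ζ : ℝ) {ξ : ℝ} (hξ : ξ ≠ 0) {f P : WLinf ρ}
    (hP : (P : Profile) =ᵐ[radial] fun r => ((ξ ^ 2 : ℝ) : ℂ) * solY ρ ξ f r) {r : ℝ}
    (hr : 1 ≤ r) :
    solY ρ ζ f r = solY ρ ξ f r + (((ξ ^ 2 - ζ ^ 2) / ξ ^ 2 : ℝ) : ℂ) * solY ρ ζ P r ∧
      solX ρ ζ f r = solX ρ ξ f r + (((ξ ^ 2 - ζ ^ 2) / ξ ^ 2 : ℝ) : ℂ) * solX ρ ζ P r := by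
  have h1 := (dirichletSolution_sol hρ2 hρ3 ξ f).shift ζ
  have h2 := (dirichletSolution_sol hρ2 hρ3 ζ P).smul (((ξ ^ 2 - ζ ^ 2) / ξ ^ 2 : ℝ) : ℂ)
  refine sol_eq hρ2 hρ3 (h1.add h2) ?_ hr
  filter_upwards [hP] with s hs
  have : (ξ : ℂ) ≠ 0 := by exact_mod_cast hξ
  simp only [Pi.add_apply, Pi.smul_apply, smul_eq_mul, hs]
  push_cast
  field_simp
  ring

end

/-! ### The solution operators at a fixed frequency. -/

/-- The constant in the estimates for the solution operators. -/
def opConst (ρ : ℝ) : ℝ := 3 * streamConst ρ + 1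

lemma opConst_pos {ρ : ℝ} (hρ2 : 2 < ρ) (hρ3 : ρ < 3) : 0 < opConst ρ := by
  have := streamConst_pos hρ2 hρ3
  unfold opConst
  linarith

lemma boundedAssignment_Y {ρ σ : ℝ} (hρ2 : 2 < ρ) (hρ3 : ρ < 3) {k : ℕ} (hk : k ≤ 2)
    (hσ : σ = ρ - 2 + k) (ζ : ℝ) :
    BoundedAssignment ρ σ (opConst ρ) fun f r => ((ζ ^ k : ℝ) : ℂ) * solY ρ ζ f r where
  meas f := (continuous_const.mul (dirichletSolution_sol hρ2 hρ3 ζ f).contY).aestronglyMeasurable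
  add f g := by
    filter_upwards [ae_restrict_mem measurableSet_Ioi] with r hr
    rw [(sol_add hρ2 hρ3 ζ f g (le_of_lt hr)).1]
    ring
  smul c f := by
    filter_upwards [ae_restrict_mem measurableSet_Ioi] with r hr
    rw [(sol_smul hρ2 hρ3 ζ c f (le_of_lt hr)).1]
    ring
  bound f := by
    filter_upwards [ae_restrict_mem measurableSet_Ioi] with r hr
    have hr' : (1 : ℝ) < r := hr
    have h := (dirichletSolution_sol hρ2 hρ3 ζ f).norm_Y_le hρ2 hρ3 (norm_nonneg f)
      (WLinf.ae_norm_le f) hr'.le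
    have hS := streamConst_pos hρ2 hρ3
    have hp : 0 ≤ ‖f‖ * r ^ (-σ) := mul_nonneg (norm_nonneg f) (Real.rpow_nonneg (by linarith) _)
    have hle : streamConst ρ * ‖f‖ * r ^ (-σ) ≤ opConst ρ * ‖f‖ * r ^ (-σ) := by
      rw [mul_assoc, mul_assoc]
      refine mul_le_mul_of_nonneg_right ?_ hp
      unfold opConst
      linarith
    refine le_trans ?_ hle
    rw [norm_mul, Complex.norm_real, norm_pow, Real.norm_eq_abs, hσ]
    interval_cases k
    · simpa using h.1
    · have e : -(ρ - 2 + ((1 : ℕ) : ℝ)) = -(ρ - 1) := by push_cast; ring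
      rw [e, pow_one]
      exact h.2.1
    · have e : -(ρ - 2 + ((2 : ℕ) : ℝ)) = -ρ := by push_cast; ring
      rw [e, sq_abs]
      exact h.2.2

lemma boundedAssignment_X {ρ σ : ℝ} (hρ2 : 2 < ρ) (hρ3 : ρ < 3) {k : ℕ} (hk : k ≤ 1)
    (hσ : σ = ρ - 1 + k) (ζ : ℝ) :
    BoundedAssignment ρ σ (opConst ρ) fun f r => ((ζ ^ k : ℝ) : ℂ) * solX ρ ζ f r where
  meas f := (continuous_const.mul (dirichletSolution_sol hρ2 hρ3 ζ f).contX).aestronglyMeasurable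
  add f g := by
    filter_upwards [ae_restrict_mem measurableSet_Ioi] with r hr
    rw [(sol_add hρ2 hρ3 ζ f g (le_of_lt hr)).2]
    ring
  smul c f := by
    filter_upwards [ae_restrict_mem measurableSet_Ioi] with r hr
    rw [(sol_smul hρ2 hρ3 ζ c f (le_of_lt hr)).2]
    ring
  bound f := by
    filter_upwards [ae_restrict_mem measurableSet_Ioi] with r hr
    have hr' : (1 : ℝ) < r := hr
    have h := (dirichletSolution_sol hρ2 hρ3 ζ f).norm_X_le_of hρ2 hρ3 (norm_nonneg f)
      (WLinf.ae_norm_le f) hr'.le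
    rw [norm_mul, Complex.norm_real, norm_pow, Real.norm_eq_abs, hσ]
    interval_cases k
    · simpa [opConst] using h.1
    · have e : -(ρ - 1 + ((1 : ℕ) : ℝ)) = -ρ := by push_cast; ring
      rw [e, pow_one]
      exact h.2

/-- The operator `f ↦ ζ ^ k Y` from `L^∞_ρ` to `L^∞_{ρ - 2 + k}`. -/
def opY {ρ σ : ℝ} (hρ2 : 2 < ρ) (hρ3 : ρ < 3) {k : ℕ} (hk : k ≤ 2) (hσ : σ = ρ - 2 + k) (ζ : ℝ) :
    WLinf ρ →L[ℂ] WLinf σ := (boundedAssignment_Y hρ2 hρ3 hk hσ ζ).op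

/-- The operator `f ↦ ζ ^ k X` from `L^∞_ρ` to `L^∞_{ρ - 1 + k}`. -/
def opX {ρ σ : ℝ} (hρ2 : 2 < ρ) (hρ3 : ρ < 3) {k : ℕ} (hk : k ≤ 1) (hσ : σ = ρ - 1 + k) (ζ : ℝ) :
    WLinf ρ →L[ℂ] WLinf σ := (boundedAssignment_X hρ2 hρ3 hk hσ ζ).op

/-! ### Operator-valued multipliers and their dependence on the frequency. -/

/-- Operator-valued Fourier multipliers from `L^∞_ρ` to `F`: bounded, and continuous
away from the origin. -/
structure IsMultiplier {E F : Type*} [NormedAddCommGroup E] [NormedSpace ℂ E]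
    [NormedAddCommGroup F] [NormedSpace ℂ F] (C : ℝ) (A : ℝ → E →L[ℂ] F) : Prop where
  bound : ∀ ζ, ‖A ζ‖ ≤ C
  cont : ContinuousOn A {0}ᶜ

/-- As `ζ → ξ` the scalar `(ξ² - ζ²) / ξ²` tends to zero while `A ζ` remains bounded, so the uniform
bound alone yields norm continuity at `ξ ≠ 0`. The operator `P ξ` is meant to be `ξ²` times the
solution operator, which maps the source space to itself. -/
lemma isMultiplier_of_resolvent {E F : Type*} [NormedAddCommGroup E] [NormedSpace ℂ E]
    [NormedAddCommGroup F] [NormedSpace ℂ F] {C : ℝ} {A : ℝ → E →L[ℂ] F} {P : ℝ → E →L[ℂ] E}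
    (k : ℕ) (hA : ∀ ζ, ‖A ζ‖ ≤ C)
    (hres : ∀ ζ ξ, ξ ≠ 0 → A ζ = ((ζ ^ k / ξ ^ k : ℝ) : ℂ) • A ξ +
      (((ξ ^ 2 - ζ ^ 2) / ξ ^ 2 : ℝ) : ℂ) • (A ζ).comp (P ξ)) : IsMultiplier C A := by
  refine ⟨hA, fun ξ hξ => ContinuousAt.continuousWithinAt ?_⟩
  have hξ0 : ξ ≠ 0 := hξ
  have h1 : Tendsto (fun ζ : ℝ => ((ζ ^ k / ξ ^ k : ℝ) : ℂ) • A ξ) (𝓝 ξ) (𝓝 (A ξ)) := by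
    have hc : Continuous fun ζ : ℝ => ((ζ ^ k / ξ ^ k : ℝ) : ℂ) • A ξ := by fun_prop
    have := hc.tendsto ξ
    rwa [div_self (pow_ne_zero k hξ0), Complex.ofReal_one, one_smul] at this
  have h2 : Tendsto (fun ζ : ℝ => (((ξ ^ 2 - ζ ^ 2) / ξ ^ 2 : ℝ) : ℂ) • (A ζ).comp (P ξ))
      (𝓝 ξ) (𝓝 0) := by
    refine squeeze_zero_norm (a := fun ζ => |(ξ ^ 2 - ζ ^ 2) / ξ ^ 2| * (C * ‖P ξ‖)) ?_ ?_
    · intro ζ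
      rw [norm_smul, Complex.norm_real, Real.norm_eq_abs]
      refine mul_le_mul_of_nonneg_left (((A ζ).opNorm_comp_le _).trans ?_) (abs_nonneg _)
      exact mul_le_mul_of_nonneg_right (hA ζ) (norm_nonneg _)
    · have hc : Continuous fun ζ => |(ξ ^ 2 - ζ ^ 2) / ξ ^ 2| * (C * ‖P ξ‖) := by fun_prop
      simpa using hc.tendsto ξ
  have h3 := h1.add h2
  rw [add_zero] at h3
  exact h3.congr fun ζ => (hres ζ ξ hξ0).symm

namespace IsMultiplier

variable {E F G : Type*} [NormedAddCommGroup E] [NormedSpace ℂ E]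
    [NormedAddCommGroup F] [NormedSpace ℂ F] [NormedAddCommGroup G] [NormedSpace ℂ G]
    {C C' : ℝ} {A B : ℝ → E →L[ℂ] F}

lemma sub (hA : IsMultiplier C A) (hB : IsMultiplier C' B) :
    IsMultiplier (C + C') fun ζ => A ζ - B ζ :=
  ⟨fun ζ => (norm_sub_le _ _).trans (add_le_add (hA.bound ζ) (hB.bound ζ)), hA.cont.sub hB.cont⟩

lemma const_smul (hA : IsMultiplier C A) (c : ℂ) :
    IsMultiplier (‖c‖ * C) fun ζ => c • A ζ :=
  ⟨fun ζ => (norm_smul_le _ _).trans (mul_le_mul_of_nonneg_left (hA.bound ζ) (norm_nonneg _)),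
    hA.cont.const_smul c⟩

lemma const (L : E →L[ℂ] F) : IsMultiplier ‖L‖ fun _ : ℝ => L :=
  ⟨fun _ => le_rfl, continuousOn_const⟩

lemma clm_comp (hA : IsMultiplier C A) (L : F →L[ℂ] G) :
    IsMultiplier (‖L‖ * C) fun ζ => L.comp (A ζ) :=
  ⟨fun ζ => (L.opNorm_comp_le _).trans (mul_le_mul_of_nonneg_left (hA.bound ζ) (norm_nonneg _)),
    continuousOn_const.clm_comp hA.cont⟩

lemma mono (hA : IsMultiplier C A) (h : C ≤ C') : IsMultiplier C' A :=
  ⟨fun ζ => (hA.bound ζ).trans h, hA.cont⟩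

lemma integrable (hA : IsMultiplier C A) {g : ℝ → E} (hg : Integrable g) :
    Integrable fun ζ => A ζ (g ζ) := by
  refine Integrable.mono' (hg.norm.const_mul C) ?_ (ae_of_all _ fun ζ =>
    ((A ζ).le_opNorm _).trans (mul_le_mul_of_nonneg_right (hA.bound ζ) (norm_nonneg _)))
  -- The origin is a null set, so continuity elsewhere gives strong measurability.
  have h1 : AEStronglyMeasurable A (volume : Measure ℝ) := by
    have := hA.cont.aestronglyMeasurable (μ := volume) (measurableSet_singleton (0 : ℝ)).compl
    rwa [Measure.restrict_eq_self_of_ae_mem] at this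
    exact compl_mem_ae_iff.2 (by simp)
  exact (ContinuousLinearMap.id ℂ (E →L[ℂ] F)).aestronglyMeasurable_comp₂ h1 hg.1

lemma integral_norm_le (hA : IsMultiplier C A) {g : ℝ → E} (hg : Integrable g) :
    ∫ ζ, ‖A ζ (g ζ)‖ ≤ C * ∫ ζ, ‖g ζ‖ := by
  rw [← integral_const_mul]
  exact integral_mono (hA.integrable hg).norm (hg.norm.const_mul C) fun ζ =>
    ((A ζ).le_opNorm _).trans (mul_le_mul_of_nonneg_right (hA.bound ζ) (norm_nonneg _))

/-- The coefficient `a m` goes with `e^{imz}`, which is the wave of frequency `-m`; hence the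
evaluation at `-m`. -/
lemma summable (hA : IsMultiplier C A) {a : ℤ → E} (ha : Summable fun m => ‖a m‖) :
    Summable fun m : ℤ => ‖A (-m) (a m)‖ :=
  Summable.of_nonneg_of_le (fun _ => norm_nonneg _) (fun _ =>
    ((A _).le_opNorm _).trans (mul_le_mul_of_nonneg_right (hA.bound _) (norm_nonneg _)))
    (ha.mul_left C)

lemma tsum_norm_le (hA : IsMultiplier C A) {a : ℤ → E} (ha : Summable fun m => ‖a m‖) :
    ∑' m : ℤ, ‖A (-m) (a m)‖ ≤ C * ∑' m, ‖a m‖ := by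
  rw [← tsum_mul_left]
  exact (hA.summable ha).tsum_le_tsum (fun _ =>
    ((A _).le_opNorm _).trans (mul_le_mul_of_nonneg_right (hA.bound _) (norm_nonneg _)))
    (ha.mul_left C)

end IsMultiplier

section

variable {ρ σ : ℝ} {k : ℕ}

lemma coe_opY (hρ2 : 2 < ρ) (hρ3 : ρ < 3) (hk : k ≤ 2) (hσ : σ = ρ - 2 + k) (ζ : ℝ)
    (f : WLinf ρ) : (opY hρ2 hρ3 hk hσ ζ f : Profile) =ᵐ[radial]
      fun r => ((ζ ^ k : ℝ) : ℂ) * solY ρ ζ f r :=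
  (boundedAssignment_Y hρ2 hρ3 hk hσ ζ).coe_op f

lemma coe_opX (hρ2 : 2 < ρ) (hρ3 : ρ < 3) (hk : k ≤ 1) (hσ : σ = ρ - 1 + k) (ζ : ℝ)
    (f : WLinf ρ) : (opX hρ2 hρ3 hk hσ ζ f : Profile) =ᵐ[radial]
      fun r => ((ζ ^ k : ℝ) : ℂ) * solX ρ ζ f r :=
  (boundedAssignment_X hρ2 hρ3 hk hσ ζ).coe_op f

/-- The exponent of `ζ ^ 2 Y`. -/
lemma exponent_two (ρ : ℝ) : ρ = ρ - 2 + ((2 : ℕ) : ℝ) := by push_cast; ring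

lemma isMultiplier_opY (hρ2 : 2 < ρ) (hρ3 : ρ < 3) (hk : k ≤ 2) (hσ : σ = ρ - 2 + k) :
    IsMultiplier (opConst ρ) (opY hρ2 hρ3 hk hσ) := by
  refine isMultiplier_of_resolvent k
    (fun ζ => (boundedAssignment_Y hρ2 hρ3 hk hσ ζ).norm_op_le (opConst_pos hρ2 hρ3).le)
    (P := opY hρ2 hρ3 le_rfl (exponent_two ρ)) fun ζ ξ hξ => ?_
  ext1 f
  refine WLinf.ext_ae ?_
  simp only [add_apply, smul_apply,
    ContinuousLinearMap.comp_apply]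
  have hP := coe_opY hρ2 hρ3 le_rfl (exponent_two ρ) ξ f
  generalize opY hρ2 hρ3 le_rfl (exponent_two ρ) ξ f = P at hP
  filter_upwards [coe_opY hρ2 hρ3 hk hσ ζ f, coe_opY hρ2 hρ3 hk hσ ξ f,
    coe_opY hρ2 hρ3 hk hσ ζ P, WLinf.coe_add
      ((((ζ ^ k / ξ ^ k : ℝ) : ℂ)) • opY hρ2 hρ3 hk hσ ξ f)
      ((((ξ ^ 2 - ζ ^ 2) / ξ ^ 2 : ℝ) : ℂ) • opY hρ2 hρ3 hk hσ ζ P),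
    WLinf.coe_smul ((ζ ^ k / ξ ^ k : ℝ) : ℂ) (opY hρ2 hρ3 hk hσ ξ f),
    WLinf.coe_smul (((ξ ^ 2 - ζ ^ 2) / ξ ^ 2 : ℝ) : ℂ) (opY hρ2 hρ3 hk hσ ζ P),
    ae_restrict_mem measurableSet_Ioi] with r h1 h2 h3 h4 h5 h6 hr
  rw [h1, h4, h5, h6, h2, h3, (sol_resolvent hρ2 hρ3 ζ hξ hP (le_of_lt hr)).1]
  have : (ξ : ℂ) ≠ 0 := by exact_mod_cast hξ
  push_cast
  field_simp

lemma isMultiplier_opX (hρ2 : 2 < ρ) (hρ3 : ρ < 3) (hk : k ≤ 1) (hσ : σ = ρ - 1 + k) :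
    IsMultiplier (opConst ρ) (opX hρ2 hρ3 hk hσ) := by
  refine isMultiplier_of_resolvent k
    (fun ζ => (boundedAssignment_X hρ2 hρ3 hk hσ ζ).norm_op_le (opConst_pos hρ2 hρ3).le)
    (P := opY hρ2 hρ3 le_rfl (exponent_two ρ)) fun ζ ξ hξ => ?_
  ext1 f
  refine WLinf.ext_ae ?_
  simp only [add_apply, smul_apply,
    ContinuousLinearMap.comp_apply]
  have hP := coe_opY hρ2 hρ3 le_rfl (exponent_two ρ) ξ f
  generalize opY hρ2 hρ3 le_rfl (exponent_two ρ) ξ f = P at hP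
  filter_upwards [coe_opX hρ2 hρ3 hk hσ ζ f, coe_opX hρ2 hρ3 hk hσ ξ f,
    coe_opX hρ2 hρ3 hk hσ ζ P, WLinf.coe_add
      ((((ζ ^ k / ξ ^ k : ℝ) : ℂ)) • opX hρ2 hρ3 hk hσ ξ f)
      ((((ξ ^ 2 - ζ ^ 2) / ξ ^ 2 : ℝ) : ℂ) • opX hρ2 hρ3 hk hσ ζ P),
    WLinf.coe_smul ((ζ ^ k / ξ ^ k : ℝ) : ℂ) (opX hρ2 hρ3 hk hσ ξ f),
    WLinf.coe_smul (((ξ ^ 2 - ζ ^ 2) / ξ ^ 2 : ℝ) : ℂ) (opX hρ2 hρ3 hk hσ ζ P),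
    ae_restrict_mem measurableSet_Ioi] with r h1 h2 h3 h4 h5 h6 hr
  rw [h1, h4, h5, h6, h2, h3, (sol_resolvent hρ2 hρ3 ζ hξ hP (le_of_lt hr)).2]
  have : (ξ : ℂ) ≠ 0 := by exact_mod_cast hξ
  push_cast
  field_simp

end

lemma boundedAssignment_div {ρ σ : ℝ} (hσ : σ = ρ + 1) :
    BoundedAssignment ρ σ 1 fun f r => (f : Profile) r / r where
  meas f := by
    exact (f : Profile).aestronglyMeasurable.div₀
      Complex.continuous_ofReal.aestronglyMeasurable
  add f g := by
    filter_upwards [WLinf.coe_add f g] with r hr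
    rw [hr]; ring
  smul c f := by
    filter_upwards [WLinf.coe_smul c f] with r hr
    rw [hr]; ring
  bound f := by
    filter_upwards [WLinf.ae_norm_le f, ae_restrict_mem measurableSet_Ioi] with r hr hr1
    have h0 : (0 : ℝ) < r := zero_lt_one.trans hr1
    rw [norm_div, Complex.norm_real, Real.norm_of_nonneg h0.le, div_le_iff₀ h0, one_mul, hσ]
    refine hr.trans_eq ?_
    rw [neg_add, Real.rpow_add h0, Real.rpow_neg_one]
    field_simp

/-- Division by `r`, from `L^∞_ρ` to `L^∞_{ρ + 1}`. -/
def divOp {ρ σ : ℝ} (hσ : σ = ρ + 1) : WLinf ρ →L[ℂ] WLinf σ := (boundedAssignment_div hσ).op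

lemma coe_divOp {ρ σ : ℝ} (hσ : σ = ρ + 1) (f : WLinf ρ) :
    (divOp hσ f : Profile) =ᵐ[radial] fun r => (f : Profile) r / r :=
  (boundedAssignment_div hσ).coe_op f

lemma norm_divOp_le {ρ σ : ℝ} (hσ : σ = ρ + 1) : ‖(divOp hσ : WLinf ρ →L[ℂ] WLinf σ)‖ ≤ 1 :=
  (boundedAssignment_div hσ).norm_op_le zero_le_one

/-! ### Superposition of waves and Fubini. -/

section FourierSuperposition

variable {E F : Type*} [NormedAddCommGroup E] [NormedSpace ℂ E]
  [NormedAddCommGroup F] [NormedSpace ℂ F]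

/-- The character `z ↦ e^{-izζ}`. -/
def wave (ζ z : ℝ) : ℂ := Complex.exp (-(Complex.I * z * ζ))

lemma norm_wave (ζ z : ℝ) : ‖wave ζ z‖ = 1 := by
  have : -(Complex.I * z * ζ) = ((-(z * ζ) : ℝ) : ℂ) * Complex.I := by push_cast; ring
  rw [wave, this, Complex.norm_exp_ofReal_mul_I]

lemma continuous_wave : Continuous fun p : ℝ × ℝ => wave p.1 p.2 := by
  unfold wave
  fun_prop

lemma continuous_wave_left (z : ℝ) : Continuous fun ζ => wave ζ z := by
  unfold wave
  fun_prop

lemma continuous_wave_right (ζ : ℝ) : Continuous (wave ζ) := by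
  unfold wave
  fun_prop

lemma wave_neg_int (m : ℤ) (z : ℝ) :
    Complex.exp (Complex.I * m * z) = wave (-(m : ℝ)) z := by
  rw [wave]
  congr 1
  push_cast
  ring

/-- The normalization of the Fourier transform. -/
def fourierNorm : ℂ := (((Real.sqrt (2 * Real.pi))⁻¹ : ℝ) : ℂ)

/-- The Fourier transform of the `E`-valued measure `g dΛ + ∑ a_m δ_m`. -/
def fourierSum (g : ℝ → E) (a : ℤ → E) (z : ℝ) : E :=
  fourierNorm • (∫ ζ : ℝ, wave ζ z • g ζ) + ∑' m : ℤ, wave (-(m : ℝ)) z • a m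

lemma fourierX_eq {ρ : ℝ} (g : ℝ → WLinf ρ) (a : ℤ → WLinf ρ) :
    fourierX ρ g a = fourierSum g a := by
  funext z
  simp only [fourierX, fourierSum, wave_neg_int]
  rfl

variable {g : ℝ → E} {a : ℤ → E}

lemma integrable_wave_smul (hg : Integrable g) (z : ℝ) : Integrable fun ζ => wave ζ z • g ζ :=
  hg.bdd_smul 1 (continuous_wave_left z).aestronglyMeasurable
    (ae_of_all _ fun ζ => (norm_wave ζ z).le)

lemma norm_fourierSum_le (ha : Summable fun m => ‖a m‖) (z : ℝ) :
    ‖fourierSum g a z‖ ≤ ‖fourierNorm‖ * (∫ ζ, ‖g ζ‖) + ∑' m, ‖a m‖ := by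
  refine (norm_add_le _ _).trans (add_le_add ?_ ?_)
  · rw [norm_smul]
    refine mul_le_mul_of_nonneg_left ((norm_integral_le_integral_norm _).trans_eq ?_)
      (norm_nonneg _)
    simp [norm_smul, norm_wave]
  · refine (norm_tsum_le_tsum_norm (by simpa [norm_smul, norm_wave] using ha)).trans_eq ?_
    simp [norm_smul, norm_wave]

lemma integrable_prod_wave {ℓ : ℝ → E →L[ℂ] F} (hℓ : Continuous ℓ)
    (hi : Integrable fun z => ‖ℓ z‖) (hg : Integrable g) :
    Integrable fun p : ℝ × ℝ => wave p.2 p.1 • ℓ p.1 (g p.2) := by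
  refine Integrable.mono' (hi.mul_prod hg.norm) ?_ (ae_of_all _ fun p => ?_)
  · refine AEStronglyMeasurable.smul
      (continuous_wave.comp continuous_swap).aestronglyMeasurable ?_
    exact (ContinuousLinearMap.id ℂ (E →L[ℂ] F)).aestronglyMeasurable_comp₂
      (hℓ.comp continuous_fst).aestronglyMeasurable hg.1.comp_snd
  · rw [norm_smul, norm_wave, one_mul]
    exact (ℓ p.1).le_opNorm _

variable [CompleteSpace E]

lemma summable_wave_smul (ha : Summable fun m => ‖a m‖) (z : ℝ) :
    Summable fun m : ℤ => wave (-(m : ℝ)) z • a m :=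
  Summable.of_norm (by simpa [norm_smul, norm_wave] using ha)

lemma continuous_fourierSum (hg : Integrable g) (ha : Summable fun m => ‖a m‖) :
    Continuous (fourierSum g a) := by
  refine Continuous.add (Continuous.const_smul ?_ _) ?_
  · refine continuous_of_dominated (fun z => (integrable_wave_smul hg z).1)
      (bound := fun ζ => ‖g ζ‖) (fun z => ae_of_all _ fun ζ => ?_) hg.norm
      (ae_of_all _ fun ζ => (continuous_wave_right ζ).smul continuous_const)
    rw [norm_smul, norm_wave, one_mul]
  · refine continuous_tsum (fun m => (continuous_wave_right _).smul continuous_const) ha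
      fun m z => ?_
    rw [norm_smul, norm_wave, one_mul]

variable [CompleteSpace F]

lemma clm_fourierSum (L : E →L[ℂ] F) (hg : Integrable g) (ha : Summable fun m => ‖a m‖) (z : ℝ) :
    L (fourierSum g a z) = fourierSum (fun ζ => L (g ζ)) (fun m => L (a m)) z := by
  rw [fourierSum, fourierSum, map_add, map_smul,
    ← L.integral_comp_comm (integrable_wave_smul hg z), L.map_tsum (summable_wave_smul ha z)]
  simp only [map_smul]

/-- Integration of a Fourier superposition against operators depending on `z`. -/
lemma integral_clm_fourierSum {ℓ : ℝ → E →L[ℂ] F} (hℓ : Continuous ℓ)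
    (hi : Integrable fun z => ‖ℓ z‖) (hg : Integrable g) (ha : Summable fun m => ‖a m‖) :
    ∫ z, ℓ z (fourierSum g a z) = fourierNorm • (∫ ζ, ∫ z, wave ζ z • ℓ z (g ζ)) +
      ∑' m : ℤ, ∫ z, wave (-(m : ℝ)) z • ℓ z (a m) := by
  have hp := integrable_prod_wave hℓ hi hg
  have e : ∀ z, ℓ z (fourierSum g a z) = fourierNorm • (∫ ζ, wave ζ z • ℓ z (g ζ)) +
      ∑' m : ℤ, wave (-(m : ℝ)) z • ℓ z (a m) := fun z => clm_fourierSum (ℓ z) hg ha z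
  have hterm : ∀ m : ℤ, Integrable fun z => wave (-(m : ℝ)) z • ℓ z (a m) := fun m => by
    refine Integrable.mono' (hi.mul_const ‖a m‖) ?_ (ae_of_all _ fun z => ?_)
    · exact ((continuous_wave_right _).smul
        (hℓ.clm_apply continuous_const)).aestronglyMeasurable
    · rw [norm_smul, norm_wave, one_mul]
      exact (ℓ z).le_opNorm _
  have hsum : Summable fun m : ℤ => ∫ z, ‖wave (-(m : ℝ)) z • ℓ z (a m)‖ := by
    refine Summable.of_nonneg_of_le (fun m => integral_nonneg fun z => norm_nonneg _)
      (fun m => ?_) (ha.mul_left (∫ z, ‖ℓ z‖))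
    rw [← integral_mul_const]
    refine integral_mono (hterm m).norm (hi.mul_const _) fun z => ?_
    simp only
    rw [norm_smul, norm_wave, one_mul]
    exact (ℓ z).le_opNorm _
  have hs := hasSum_integral_of_summable_integral_norm hterm hsum
  have hint2 : Integrable fun z => ∑' m : ℤ, wave (-(m : ℝ)) z • ℓ z (a m) := by
    have hc : Continuous fun z => ∑' m : ℤ, wave (-(m : ℝ)) z • ℓ z (a m) := by
      -- The atomic part is itself a superposition, with zero density, so its continuity is already
      -- known.
      have h1 : Continuous fun z => ℓ z (fourierSum (0 : ℝ → E) a z) :=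
        hℓ.clm_apply (continuous_fourierSum (integrable_zero _ _ _) ha)
      refine h1.congr fun z => ?_
      rw [clm_fourierSum (ℓ z) (integrable_zero _ _ _) ha z]
      simp [fourierSum]
    refine Integrable.mono' (hi.mul_const (∑' m, ‖a m‖)) hc.aestronglyMeasurable
      (ae_of_all _ fun z => ?_)
    refine tsum_of_norm_bounded (ha.hasSum.mul_left ‖ℓ z‖) fun m => ?_
    rw [norm_smul, norm_wave, one_mul]
    exact (ℓ z).le_opNorm _
  simp_rw [e]
  have hint1 : Integrable fun z => fourierNorm • ∫ ζ, wave ζ z • ℓ z (g ζ) :=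
    hp.integral_prod_left.smul fourierNorm
  rw [integral_add hint1 hint2, integral_smul, hs.tsum_eq,
    integral_integral_swap (f := fun z ζ => wave ζ z • ℓ z (g ζ)) hp]

/-- Two superpositions of waves agree under the integral if the waves do. -/
lemma integral_clm_fourierSum_congr {E' : Type*} [NormedAddCommGroup E'] [NormedSpace ℂ E']
    [CompleteSpace E'] {ℓ : ℝ → E →L[ℂ] F} {ℓ' : ℝ → E' →L[ℂ] F} (hℓ : Continuous ℓ)
    (hi : Integrable fun z => ‖ℓ z‖) (hℓ' : Continuous ℓ') (hi' : Integrable fun z => ‖ℓ' z‖)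
    (hg : Integrable g) (ha : Summable fun m => ‖a m‖) {g' : ℝ → E'} {a' : ℤ → E'}
    (hg' : Integrable g') (ha' : Summable fun m => ‖a' m‖)
    (h1 : ∀ ζ, ∫ z, wave ζ z • ℓ z (g ζ) = ∫ z, wave ζ z • ℓ' z (g' ζ))
    (h2 : ∀ m : ℤ, ∫ z, wave (-(m : ℝ)) z • ℓ z (a m) = ∫ z, wave (-(m : ℝ)) z • ℓ' z (a' m)) :
    ∫ z, ℓ z (fourierSum g a z) = ∫ z, ℓ' z (fourierSum g' a' z) := by
  rw [integral_clm_fourierSum hℓ hi hg ha, integral_clm_fourierSum hℓ' hi' hg' ha']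
  simp only [h1, h2]

end FourierSuperposition

/-! ### Pairing of profiles with test functions -/

lemma norm_le_of_nonneg {ρ : ℝ} (hρ : 0 ≤ ρ) (f : WLinf ρ) :
    ∀ᵐ r ∂radial, ‖(f : Profile) r‖ ≤ ‖f‖ := by
  filter_upwards [WLinf.ae_norm_le f, ae_restrict_mem measurableSet_Ioi] with r hr hr1
  refine hr.trans (mul_le_of_le_one_right (norm_nonneg _) ?_)
  exact Real.rpow_le_one_of_one_le_of_nonpos (le_of_lt hr1) (by linarith)

lemma integrable_profile_mul {ρ : ℝ} (hρ : 0 ≤ ρ) (f : WLinf ρ) {h : ℝ → ℂ}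
    (hi : Integrable h) : Integrable (fun r => (f : Profile) r * h r) radial :=
  hi.restrict.bdd_mul (f : Profile).aestronglyMeasurable (norm_le_of_nonneg hρ f)

/-- Pairing of a profile with an integrable function. -/
def profilePairing {ρ : ℝ} (hρ : 0 ≤ ρ) {h : ℝ → ℂ} (hi : Integrable h) : WLinf ρ →L[ℂ] ℂ :=
  LinearMap.mkContinuous
    { toFun := fun f => ∫ r, (f : Profile) r * h r ∂radial
      map_add' := fun f g => by
        rw [← integral_add (integrable_profile_mul hρ f hi) (integrable_profile_mul hρ g hi)]
        refine integral_congr_ae ?_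
        filter_upwards [WLinf.coe_add f g] with r hr
        rw [hr]; ring
      map_smul' := fun c f => by
        rw [RingHom.id_apply, smul_eq_mul, ← integral_const_mul]
        refine integral_congr_ae ?_
        filter_upwards [WLinf.coe_smul c f] with r hr
        rw [hr]; ring }
    (∫ r, ‖h r‖) fun f => by
      simp only [LinearMap.coe_mk, AddHom.coe_mk]
      rw [mul_comm, ← integral_const_mul]
      refine (norm_integral_le_of_norm_le (hi.norm.const_mul ‖f‖).restrict ?_).trans ?_
      · filter_upwards [norm_le_of_nonneg hρ f] with r hr
        rw [norm_mul]
        exact mul_le_mul_of_nonneg_right hr (norm_nonneg _)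
      · exact setIntegral_le_integral (hi.norm.const_mul ‖f‖)
          (ae_of_all _ fun r => by positivity)

lemma profilePairing_apply {ρ : ℝ} (hρ : 0 ≤ ρ) {h : ℝ → ℂ} (hi : Integrable h) (f : WLinf ρ) :
    profilePairing hρ hi f = ∫ r, (f : Profile) r * h r ∂radial := rfl

lemma norm_profilePairing_le {ρ : ℝ} (hρ : 0 ≤ ρ) {h : ℝ → ℂ} (hi : Integrable h) :
    ‖profilePairing hρ hi‖ ≤ ∫ r, ‖h r‖ :=
  LinearMap.mkContinuous_norm_le _ (integral_nonneg fun _ => norm_nonneg _) _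

/-- Continuous functions on the plane with compact support. -/
structure IsPlaneTest (θ : ℝ × ℝ → ℂ) : Prop where
  cont : Continuous θ
  supp : HasCompactSupport θ

namespace IsPlaneTest

variable {θ : ℝ × ℝ → ℂ}

lemma exists_bound (hθ : IsPlaneTest θ) :
    ∃ R > 0, ∀ p : ℝ × ℝ, (R < |p.1| ∨ R < |p.2|) → θ p = 0 := by
  obtain ⟨R, hR⟩ := hθ.supp.isCompact.isBounded.subset_closedBall (0 : ℝ × ℝ)
  refine ⟨max R 1, by positivity, fun p hp => ?_⟩
  by_contra hne
  have h1 := hR (subset_tsupport θ hne)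
  rw [mem_closedBall_zero_iff, Prod.norm_def, max_le_iff, Real.norm_eq_abs, Real.norm_eq_abs] at h1
  have := le_max_left R 1
  rcases hp with h | h <;> linarith

lemma slice_r (hθ : IsPlaneTest θ) (z : ℝ) :
    Continuous (fun r => θ (r, z)) ∧ HasCompactSupport fun r => θ (r, z) := by
  obtain ⟨R, -, hR⟩ := hθ.exists_bound
  refine ⟨hθ.cont.comp (by fun_prop), HasCompactSupport.of_support_subset_isCompact
    (isCompact_Icc (a := -R) (b := R)) fun r hr => ?_⟩
  rw [mem_Icc, ← abs_le]
  by_contra! h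
  exact hr (hR _ (Or.inl h))

lemma slice_z (hθ : IsPlaneTest θ) (r : ℝ) :
    Continuous (fun z => θ (r, z)) ∧ HasCompactSupport fun z => θ (r, z) := by
  obtain ⟨R, -, hR⟩ := hθ.exists_bound
  refine ⟨hθ.cont.comp (by fun_prop), HasCompactSupport.of_support_subset_isCompact
    (isCompact_Icc (a := -R) (b := R)) fun r hr => ?_⟩
  rw [mem_Icc, ← abs_le]
  by_contra! h
  exact hr (hR _ (Or.inr h))

lemma integrable_r (hθ : IsPlaneTest θ) (z : ℝ) : Integrable fun r => θ (r, z) :=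
  (hθ.slice_r z).1.integrable_of_hasCompactSupport (hθ.slice_r z).2

/-- Pairing of a profile with the slice of a test function at height `z`. -/
def slicePairing {ρ : ℝ} (hρ : 0 ≤ ρ) (hθ : IsPlaneTest θ) (z : ℝ) : WLinf ρ →L[ℂ] ℂ :=
  profilePairing hρ (hθ.integrable_r z)

lemma slicePairing_apply {ρ : ℝ} (hρ : 0 ≤ ρ) (hθ : IsPlaneTest θ) (z : ℝ) (f : WLinf ρ) :
    hθ.slicePairing hρ z f = ∫ r, (f : Profile) r * θ (r, z) ∂radial := rfl

lemma continuous_slicePairing {ρ : ℝ} (hρ : 0 ≤ ρ) (hθ : IsPlaneTest θ) :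
    Continuous (hθ.slicePairing hρ) := by
  obtain ⟨R, hR0, hR⟩ := hθ.exists_bound
  refine continuous_iff_continuousAt.2 fun z₀ => ?_
  rw [ContinuousAt, tendsto_iff_norm_sub_tendsto_zero]
  -- The operator norm of a difference of slice pairings is at most the `L¹` distance of the slices,
  -- all supported in `[-R, R]`.
  have hc : Continuous fun z => ∫ r in (-R)..R, ‖θ (r, z) - θ (r, z₀)‖ := by
    refine intervalIntegral.continuous_parametric_intervalIntegral_of_continuous' ?_ _ _
    have := hθ.cont
    simp only [Function.uncurry_def]
    fun_prop
  have ht := hc.tendsto z₀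
  simp only [sub_self, norm_zero, intervalIntegral.integral_zero] at ht
  refine squeeze_zero (fun _ => norm_nonneg _) (fun z => ?_) ht
  have e : hθ.slicePairing hρ z - hθ.slicePairing hρ z₀ =
      profilePairing hρ ((hθ.integrable_r z).sub (hθ.integrable_r z₀)) := by
    ext f
    rw [sub_apply, slicePairing_apply, slicePairing_apply, profilePairing_apply,
      ← integral_sub (integrable_profile_mul hρ f (hθ.integrable_r z))
        (integrable_profile_mul hρ f (hθ.integrable_r z₀))]
    refine integral_congr_ae (ae_of_all _ fun r => ?_)
    simp only [Pi.sub_apply]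
    ring
  rw [e]
  refine (norm_profilePairing_le hρ _).trans_eq ?_
  rw [intervalIntegral.integral_of_le (by linarith), ← integral_Icc_eq_integral_Ioc,
    setIntegral_eq_integral_of_forall_compl_eq_zero]
  · rfl
  · intro r hr
    rw [mem_Icc, ← abs_le, not_le] at hr
    rw [hR _ (Or.inl hr), hR _ (Or.inl hr)]
    simp

lemma slicePairing_eq_zero {ρ : ℝ} (hρ : 0 ≤ ρ) (hθ : IsPlaneTest θ) {R : ℝ}
    (hR : ∀ p : ℝ × ℝ, (R < |p.1| ∨ R < |p.2|) → θ p = 0) {z : ℝ} (hz : R < |z|) :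
    hθ.slicePairing hρ z = 0 := by
  ext f
  rw [slicePairing_apply]
  have h0 : ∀ r : ℝ, θ (r, z) = 0 := fun r => hR (r, z) (Or.inr hz)
  simp [h0]

lemma hasCompactSupport_slicePairing {ρ : ℝ} (hρ : 0 ≤ ρ) (hθ : IsPlaneTest θ) :
    HasCompactSupport (hθ.slicePairing hρ) := by
  obtain ⟨R, -, hR⟩ := hθ.exists_bound
  refine HasCompactSupport.of_support_subset_isCompact
    (isCompact_Icc (a := -R) (b := R)) fun z hz => ?_
  rw [mem_Icc, ← abs_le]
  by_contra! h
  exact hz (hθ.slicePairing_eq_zero hρ hR h)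

lemma integrable_norm_slicePairing {ρ : ℝ} (hρ : 0 ≤ ρ) (hθ : IsPlaneTest θ) :
    Integrable fun z => ‖(hθ.slicePairing hρ z : WLinf ρ →L[ℂ] ℂ)‖ :=
  ((hθ.continuous_slicePairing hρ).integrable_of_hasCompactSupport
    (hθ.hasCompactSupport_slicePairing hρ)).norm

end IsPlaneTest

/-- The pairing of the wave `e^{-izζ} f` with a function of `(r, z)`. -/
def wavePairing (ζ : ℝ) (f : ℝ → ℂ) (θ : ℝ × ℝ → ℂ) : ℂ :=
  ∫ z, wave ζ z * ∫ r, f r * θ (r, z) ∂radial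

lemma Represents.pairing_eq {ρ : ℝ} {g : ℝ → WLinf ρ} {a : ℤ → WLinf ρ} {u : AxiField}
    (hρ : 0 ≤ ρ) (h : Represents ρ g a u) {θ : ℝ × ℝ → ℂ} (hθ : IsPlaneTest θ) :
    pairing u θ = ∫ z, hθ.slicePairing hρ z (fourierSum g a z) := by
  rw [pairing]
  refine integral_congr_ae (ae_of_all _ fun z => ?_)
  simp only
  rw [h.eq z, fourierX_eq]
  rfl

/-- Superposition: an identity between pairings holds for fields if it does for waves. -/
lemma pairing_congr {ρ ρ' : ℝ} (hρ : 0 ≤ ρ) (hρ' : 0 ≤ ρ') {g : ℝ → WLinf ρ} {a : ℤ → WLinf ρ}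
    {u : AxiField} (h : Represents ρ g a u) {g' : ℝ → WLinf ρ'} {a' : ℤ → WLinf ρ'}
    {u' : AxiField} (h' : Represents ρ' g' a' u') {θ θ' : ℝ × ℝ → ℂ} (hθ : IsPlaneTest θ)
    (hθ' : IsPlaneTest θ')
    (h1 : ∀ ζ, wavePairing ζ (g ζ : Profile) θ = wavePairing ζ (g' ζ : Profile) θ')
    (h2 : ∀ m : ℤ, wavePairing (-(m : ℝ)) (a m : Profile) θ =
      wavePairing (-(m : ℝ)) (a' m : Profile) θ') :
    pairing u θ = pairing u' θ' := by
  rw [h.pairing_eq hρ hθ, h'.pairing_eq hρ' hθ']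
  exact integral_clm_fourierSum_congr (hθ.continuous_slicePairing hρ)
    (hθ.integrable_norm_slicePairing hρ) (hθ'.continuous_slicePairing hρ')
    (hθ'.integrable_norm_slicePairing hρ') h.integrable h.summable h'.integrable h'.summable h1 h2

open scoped ContDiff

/-! ### Test functions -/

/-- Smooth functions with compact support in `(1, ∞)`. -/
structure IsRadialTest (α : ℝ → ℂ) : Prop where
  smooth : ContDiff ℝ ∞ α
  supp : HasCompactSupport α
  sub : tsupport α ⊆ Ioi 1

/-- Smooth functions with compact support in `(1, ∞) × ℝ`. -/
structure IsTest (φ : ℝ × ℝ → ℂ) : Prop where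
  smooth : ContDiff ℝ ∞ φ
  supp : HasCompactSupport φ
  sub : tsupport φ ⊆ (halfPlane : Set (ℝ × ℝ))

lemma isTest_coe (φ : 𝓓(halfPlane, ℂ)) : IsTest φ :=
  ⟨φ.contDiff, φ.hasCompactSupport, φ.tsupport_subset⟩

/-- The bundled test function. -/
def IsTest.toTestFunction {φ : ℝ × ℝ → ℂ} (h : IsTest φ) : 𝓓(halfPlane, ℂ) :=
  ⟨φ, h.smooth, h.supp, h.sub⟩

namespace IsRadialTest

variable {α : ℝ → ℂ}

lemma deriv (h : IsRadialTest α) : IsRadialTest (deriv α) where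
  smooth := (contDiff_infty_iff_deriv.1 h.smooth).2
  supp := h.supp.deriv
  sub := (tsupport_deriv_subset).trans h.sub

lemma mul_left (h : IsRadialTest α) {β : ℝ → ℂ} (hβ : ContDiffOn ℝ ∞ β (Ioi 1)) :
    IsRadialTest (fun r => β r * α r) where
  smooth := by
    refine contDiff_iff_contDiffAt.2 fun r => ?_
    by_cases hr : r ∈ tsupport α
    · exact (hβ.contDiffAt (Ioi_mem_nhds (h.sub hr))).mul h.smooth.contDiffAt
    · have : (fun r => β r * α r) =ᶠ[𝓝 r] fun _ => 0 := by
        filter_upwards [(isClosed_tsupport α).isOpen_compl.mem_nhds hr] with s hs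
        rw [image_eq_zero_of_notMem_tsupport hs, mul_zero]
      exact contDiffAt_const.congr_of_eventuallyEq this
  supp := h.supp.mul_left
  sub := (tsupport_mul_subset_right).trans h.sub

lemma div_r (h : IsRadialTest α) : IsRadialTest (fun r => α r / r) := by
  have := h.mul_left (β := fun r : ℝ => ((r : ℝ) : ℂ)⁻¹) (by
    refine ContDiffOn.inv (Complex.ofRealCLM.contDiff.contDiffOn) fun r hr => ?_
    have : r ≠ 0 := (zero_lt_one.trans hr).ne'
    exact_mod_cast this)
  simpa only [div_eq_mul_inv, mul_comm] using this

lemma exists_bound (h : IsRadialTest α) : ∃ R, 1 < R ∧ ∀ r, r ∉ Ioo 1 R → r ∉ tsupport α := by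
  obtain ⟨R, hR⟩ := h.supp.isCompact.isBounded.subset_closedBall (0 : ℝ)
  refine ⟨max R 1 + 1, by linarith [le_max_right R 1], fun r hr hs => hr ⟨h.sub hs, ?_⟩⟩
  have h1 := mem_closedBall_zero_iff.1 (hR hs)
  have h2 := le_abs_self r
  rw [Real.norm_eq_abs] at h1
  linarith [le_max_left R 1]

lemma integrable (h : IsRadialTest α) : Integrable α :=
  h.smooth.continuous.integrable_of_hasCompactSupport h.supp

lemma hasDerivAt (h : IsRadialTest α) (r : ℝ) : HasDerivAt α (_root_.deriv α r) r :=
  (h.smooth.differentiable (by simp) r).hasDerivAt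

/-- Integration by parts on `(1, ∞)`. -/
lemma integral_mul_deriv (h : IsRadialTest α) {P p : ℝ → ℂ}
    (hp : ∀ r, 1 ≤ r → IntervalIntegrable p volume 1 r)
    (hP : ∀ r, 1 ≤ r → P r = P 1 + ∫ s in (1 : ℝ)..r, p s) :
    ∫ r, P r * _root_.deriv α r ∂radial = -∫ r, p r * α r ∂radial := by
  obtain ⟨R, hR, hout⟩ := h.exists_bound
  have hα : ∀ r, r ∉ Ioo 1 R → α r = 0 := fun r hr => image_eq_zero_of_notMem_tsupport (hout r hr)
  have hα' : ∀ r, r ∉ Ioo 1 R → _root_.deriv α r = 0 := fun r hr =>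
    image_eq_zero_of_notMem_tsupport fun hs => hout r hr (tsupport_deriv_subset hs)
  -- The boundary terms vanish because `α` is zero at `1` and at `R`.
  have key := mul_primitive_sub (P 1) (hp R hR.le) (fun x _ => h.hasDerivAt x)
    h.deriv.smooth.continuous.continuousOn
  rw [hα R (by simp), hα 1 (by simp)] at key
  have conv : ∀ (F β : ℝ → ℂ), (∀ r, r ∉ Ioo 1 R → β r = 0) →
      ∫ r, F r * β r ∂radial = ∫ r in (1 : ℝ)..R, F r * β r := by
    intro F β hβ
    rw [intervalIntegral.integral_of_le hR.le]
    have hsub : Ioc (1 : ℝ) R ⊆ Ioi 1 := fun r hr => hr.1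
    have h0 : ∀ r ∈ Ioi (1 : ℝ) \ Ioc 1 R, F r * β r = 0 := fun r hr => by
      rw [hβ r fun h => hr.2 ⟨h.1, h.2.le⟩, mul_zero]
    exact setIntegral_eq_of_subset_of_forall_sdiff_eq_zero measurableSet_Ioi hsub h0
  rw [conv _ _ hα', conv _ _ hα]
  have i1 : IntervalIntegrable (fun r => P r * _root_.deriv α r) volume 1 R := by
    refine ContinuousOn.intervalIntegrable (ContinuousOn.mul ?_
      h.deriv.smooth.continuous.continuousOn)
    refine ((absolutelyContinuousOnInterval_integral (hp R hR.le)).continuousOn.const_add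
      (P 1)).congr fun r hr => ?_
    rw [uIcc_of_le hR.le] at hr
    exact hP r hr.1
  have i2 : IntervalIntegrable (fun r => p r * α r) volume 1 R :=
    (hp R hR.le).mul_continuousOn h.smooth.continuous.continuousOn
  have e : ∫ x in (1 : ℝ)..R, (_root_.deriv α x * (P 1 + ∫ t in (1 : ℝ)..x, p t) + α x * p x) =
      ∫ x in (1 : ℝ)..R, (P x * _root_.deriv α x + p x * α x) := by
    refine intervalIntegral.integral_congr fun x hx => ?_
    rw [uIcc_of_le hR.le] at hx
    rw [hP x hx.1]
    ring
  rw [e, intervalIntegral.integral_add i1 i2] at key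
  linear_combination -key

end IsRadialTest

namespace IsTest

variable {φ : ℝ × ℝ → ℂ}

lemma plane (h : IsTest φ) : IsPlaneTest φ := ⟨h.smooth.continuous, h.supp⟩

lemma hasDerivAt_r (h : IsTest φ) (p : ℝ × ℝ) :
    HasDerivAt (fun r => φ (r, p.2)) (fderiv ℝ φ p (1, 0)) p.1 := by
  have h1 : HasFDerivAt φ (fderiv ℝ φ p) (p.1, p.2) :=
    (h.smooth.differentiable (by simp) p).hasFDerivAt
  exact h1.comp_hasDerivAt p.1 ((hasDerivAt_id p.1).prodMk (hasDerivAt_const p.1 p.2))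

lemma hasDerivAt_z (h : IsTest φ) (p : ℝ × ℝ) :
    HasDerivAt (fun z => φ (p.1, z)) (fderiv ℝ φ p (0, 1)) p.2 := by
  have h1 : HasFDerivAt φ (fderiv ℝ φ p) (p.1, p.2) :=
    (h.smooth.differentiable (by simp) p).hasFDerivAt
  exact h1.comp_hasDerivAt p.2 ((hasDerivAt_const p.2 p.1).prodMk (hasDerivAt_id p.2))

lemma fderiv_apply (h : IsTest φ) (v : ℝ × ℝ) : IsTest fun p => fderiv ℝ φ p v where
  smooth := (h.smooth.fderiv_right (m := ∞) (by rfl)).clm_apply contDiff_const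
  supp := h.supp.fderiv_apply ℝ v
  sub := (tsupport_fderiv_apply_subset ℝ v).trans h.sub

lemma dr_eq (h : IsTest φ) : dr φ = fun p => fderiv ℝ φ p (1, 0) :=
  funext fun p => (h.hasDerivAt_r p).deriv

lemma dz_eq (h : IsTest φ) : dz φ = fun p => fderiv ℝ φ p (0, 1) :=
  funext fun p => (h.hasDerivAt_z p).deriv

lemma dr (h : IsTest φ) : IsTest (dr φ) := by
  rw [h.dr_eq]
  exact h.fderiv_apply _

lemma dz (h : IsTest φ) : IsTest (dz φ) := by
  rw [h.dz_eq]
  exact h.fderiv_apply _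

lemma mul_left (h : IsTest φ) {β : ℝ × ℝ → ℂ}
    (hβ : ContDiffOn ℝ ∞ β (halfPlane : Set (ℝ × ℝ))) : IsTest (fun p => β p * φ p) where
  smooth := by
    refine contDiff_iff_contDiffAt.2 fun r => ?_
    by_cases hr : r ∈ tsupport φ
    · exact (hβ.contDiffAt (halfPlane.isOpen.mem_nhds (h.sub hr))).mul h.smooth.contDiffAt
    · have : (fun r => β r * φ r) =ᶠ[𝓝 r] fun _ => 0 := by
        filter_upwards [(isClosed_tsupport φ).isOpen_compl.mem_nhds hr] with s hs
        rw [image_eq_zero_of_notMem_tsupport hs, mul_zero]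
      exact contDiffAt_const.congr_of_eventuallyEq this
  supp := h.supp.mul_left
  sub := (tsupport_mul_subset_right).trans h.sub

lemma mul_r (h : IsTest φ) : IsTest (fun p => (p.1 : ℂ) * φ p) :=
  h.mul_left (Complex.ofRealCLM.contDiff.comp contDiff_fst).contDiffOn

lemma divR (h : IsTest φ) : IsTest (divR φ) := by
  have := h.mul_left (β := fun p : ℝ × ℝ => ((p.1 : ℝ) : ℂ)⁻¹) (by
    refine ContDiffOn.inv (Complex.ofRealCLM.contDiff.comp contDiff_fst).contDiffOn fun p hp => ?_
    have h1 : (1 : ℝ) < p.1 := hp.1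
    have : p.1 ≠ 0 := by linarith
    exact_mod_cast this)
  unfold AxiBiotSavart.divR
  simpa only [div_eq_mul_inv, mul_comm] using this

lemma add {φ' : ℝ × ℝ → ℂ} (h : IsTest φ) (h' : IsTest φ') : IsTest (fun p => φ p + φ' p) where
  smooth := h.smooth.add h'.smooth
  supp := h.supp.add h'.supp
  sub := (tsupport_add φ φ').trans (union_subset h.sub h'.sub)

lemma neg (h : IsTest φ) : IsTest (fun p => -φ p) where
  smooth := h.smooth.neg
  supp := h.supp.neg
  sub := by
    have : tsupport (fun p => -φ p) = tsupport φ := tsupport_neg φ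
    rw [this]
    exact h.sub

lemma sub' {φ' : ℝ × ℝ → ℂ} (h : IsTest φ) (h' : IsTest φ') : IsTest (fun p => φ p - φ' p) := by
  simpa only [sub_eq_add_neg] using h.add h'.neg

lemma slice (h : IsTest φ) (z : ℝ) : IsRadialTest fun r => φ (r, z) where
  smooth := h.smooth.comp (contDiff_id.prodMk contDiff_const)
  supp := (h.plane.slice_r z).2
  sub := by
    intro r hr
    have hc : Continuous fun r : ℝ => (r, z) := by fun_prop
    have : tsupport (fun r => φ (r, z)) ⊆ (fun r : ℝ => (r, z)) ⁻¹' tsupport φ := by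
      refine closure_minimal (fun s hs => subset_tsupport φ hs) ?_
      exact (isClosed_tsupport φ).preimage hc
    exact (h.sub (this hr)).1

end IsTest

/-! ### Pairings of waves -/

/-- Bounded measurable functions on `(1, ∞)`. -/
structure IsBddRadial (f : ℝ → ℂ) : Prop where
  meas : AEStronglyMeasurable f radial
  bdd : ∃ M : ℝ, ∀ᵐ r ∂radial, ‖f r‖ ≤ M

lemma isBddRadial_coe {ρ : ℝ} (hρ : 0 ≤ ρ) (f : WLinf ρ) : IsBddRadial (f : Profile) :=
  ⟨(f : Profile).aestronglyMeasurable, ‖f‖, norm_le_of_nonneg hρ f⟩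

lemma IsBddRadial.congr {f g : ℝ → ℂ} (h : IsBddRadial f) (hfg : f =ᵐ[radial] g) :
    IsBddRadial g := by
  obtain ⟨M, hM⟩ := h.bdd
  refine ⟨h.meas.congr hfg, M, ?_⟩
  filter_upwards [hM, hfg] with r h1 h2
  rwa [← h2]

lemma IsBddRadial.integrable_mul {f : ℝ → ℂ} (h : IsBddRadial f) {α : ℝ → ℂ}
    (hα : Integrable α) : Integrable (fun r => f r * α r) radial := by
  obtain ⟨M, hM⟩ := h.bdd
  exact hα.restrict.bdd_mul h.meas hM

section wavePairing

variable {ζ : ℝ} {f g : ℝ → ℂ} {θ : ℝ × ℝ → ℂ}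

lemma wavePairing_congr_ae (h : f =ᵐ[radial] g) : wavePairing ζ f θ = wavePairing ζ g θ := by
  unfold wavePairing
  refine integral_congr_ae (ae_of_all _ fun z => ?_)
  simp only
  congr 1
  refine integral_congr_ae ?_
  filter_upwards [h] with r hr
  rw [hr]

lemma wavePairing_of_slices {θ' : ℝ × ℝ → ℂ}
    (h : ∀ z, ∫ r, f r * θ (r, z) ∂radial = ∫ r, g r * θ' (r, z) ∂radial) :
    wavePairing ζ f θ = wavePairing ζ g θ' := by
  unfold wavePairing
  simp only [h]

lemma wavePairing_const_mul (c : ℂ) :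
    wavePairing ζ (fun r => c * f r) θ = c * wavePairing ζ f θ := by
  unfold wavePairing
  rw [← integral_const_mul]
  refine integral_congr_ae (ae_of_all _ fun z => ?_)
  simp only
  rw [mul_left_comm, ← integral_const_mul c]
  simp only [mul_assoc]

lemma wavePairing_neg : wavePairing ζ f (fun p => -θ p) = -wavePairing ζ f θ := by
  unfold wavePairing
  simp only [mul_neg, integral_neg]

lemma integrable_prod_wavePairing (hf : IsBddRadial f) (hθ : IsPlaneTest θ) :
    Integrable (fun p : ℝ × ℝ => wave ζ p.1 * (f p.2 * θ (p.2, p.1)))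
      ((volume : Measure ℝ).prod radial) := by
  obtain ⟨M, hM⟩ := hf.bdd
  have h1 : Integrable (fun p : ℝ × ℝ => θ (p.2, p.1)) ((volume : Measure ℝ).prod radial) := by
    have h2 : Integrable θ (volume : Measure (ℝ × ℝ)) :=
      hθ.cont.integrable_of_hasCompactSupport hθ.supp
    have h3 : Integrable (fun p : ℝ × ℝ => θ (p.2, p.1))
        ((volume : Measure ℝ).prod (volume : Measure ℝ)) := Integrable.swap h2
    have e : (volume : Measure ℝ).prod radial =
        ((volume : Measure ℝ).prod volume).restrict (univ ×ˢ Ioi 1) := by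
      rw [← Measure.prod_restrict, Measure.restrict_univ]
    rw [e]
    exact h3.restrict
  have h4 : Integrable (fun p : ℝ × ℝ => f p.2 * θ (p.2, p.1))
      ((volume : Measure ℝ).prod radial) := by
    refine h1.bdd_mul (c := M) hf.meas.comp_snd ?_
    exact Measure.quasiMeasurePreserving_snd.ae hM
  refine h4.bdd_mul (c := 1) ?_ (ae_of_all _ fun p => (norm_wave _ _).le)
  exact ((continuous_wave_right ζ).comp continuous_fst).aestronglyMeasurable

lemma integrable_wavePairing (hf : IsBddRadial f) (hθ : IsPlaneTest θ) :
    Integrable fun z => wave ζ z * ∫ r, f r * θ (r, z) ∂radial := by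
  have := (integrable_prod_wavePairing (ζ := ζ) hf hθ).integral_prod_left
  simpa only [integral_const_mul] using this

/-- Puts the `z` integral inside, so that integration by parts in `z` takes place at fixed `r`. -/
lemma wavePairing_swap (hf : IsBddRadial f) (hθ : IsPlaneTest θ) :
    wavePairing ζ f θ = ∫ r, f r * (∫ z, wave ζ z * θ (r, z)) ∂radial := by
  have h := integral_integral_swap (f := fun z r => wave ζ z * (f r * θ (r, z)))
    (integrable_prod_wavePairing (ζ := ζ) hf hθ)
  simp only [integral_const_mul] at h
  rw [wavePairing, h]
  refine integral_congr_ae (ae_of_all _ fun r => ?_)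
  simp only
  rw [← integral_const_mul]
  refine integral_congr_ae (ae_of_all _ fun z => ?_)
  simp only
  ring

lemma wavePairing_add_right (hf : IsBddRadial f) (hθ : IsPlaneTest θ) {θ' : ℝ × ℝ → ℂ}
    (hθ' : IsPlaneTest θ') :
    wavePairing ζ f (fun p => θ p + θ' p) = wavePairing ζ f θ + wavePairing ζ f θ' := by
  unfold wavePairing
  rw [← integral_add (integrable_wavePairing hf hθ) (integrable_wavePairing hf hθ')]
  refine integral_congr_ae (ae_of_all _ fun z => ?_)
  simp only
  rw [← mul_add, ← integral_add (hf.integrable_mul (hθ.integrable_r z))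
    (hf.integrable_mul (hθ'.integrable_r z))]
  simp only [mul_add]

lemma wavePairing_add_left (hf : IsBddRadial f) (hg : IsBddRadial g) (hθ : IsPlaneTest θ) :
    wavePairing ζ (fun r => f r + g r) θ = wavePairing ζ f θ + wavePairing ζ g θ := by
  unfold wavePairing
  rw [← integral_add (integrable_wavePairing hf hθ) (integrable_wavePairing hg hθ)]
  refine integral_congr_ae (ae_of_all _ fun z => ?_)
  simp only
  rw [← mul_add, ← integral_add (hf.integrable_mul (hθ.integrable_r z))
    (hg.integrable_mul (hθ.integrable_r z))]
  simp only [add_mul]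

lemma hasDerivAt_wave (ζ z : ℝ) : HasDerivAt (wave ζ) (-(Complex.I * ζ) * wave ζ z) z := by
  have h1 : HasDerivAt (fun z : ℝ => -(Complex.I * z * ζ)) (-(Complex.I * ζ)) z := by
    have h2 : HasDerivAt (fun z : ℝ => (z : ℂ)) 1 z := (hasDerivAt_id z).ofReal_comp
    have := ((h2.const_mul Complex.I).mul_const (ζ : ℂ)).fun_neg
    simpa only [mul_one] using this
  have := h1.cexp
  rw [mul_comm]
  exact this

/-- The wave has `z`-derivative `-iζ` times itself, and integration by parts changes the sign. -/
lemma wavePairing_dz (hf : IsBddRadial f) (hθ : IsTest θ) :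
    wavePairing ζ f (dz θ) = Complex.I * ζ * wavePairing ζ f θ := by
  rw [wavePairing_swap hf hθ.dz.plane, wavePairing_swap hf hθ.plane, ← integral_const_mul]
  refine integral_congr_ae (ae_of_all _ fun r => ?_)
  simp only
  have hs := hθ.plane.slice_z r
  have hs' := hθ.dz.plane.slice_z r
  have i1 : Integrable fun z => θ (r, z) := hs.1.integrable_of_hasCompactSupport hs.2
  have i2 : Integrable fun z => dz θ (r, z) := hs'.1.integrable_of_hasCompactSupport hs'.2
  have hw : ∀ {k : ℝ → ℂ}, Integrable k → Integrable fun z => wave ζ z * k z := fun hk =>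
    hk.bdd_mul (c := 1) (continuous_wave_right ζ).aestronglyMeasurable
      (ae_of_all _ fun p => (norm_wave _ _).le)
  have hibp := integral_mul_deriv_eq_deriv_mul_of_integrable (u := wave ζ)
    (u' := fun z => -(Complex.I * ζ) * wave ζ z) (v := fun z => θ (r, z))
    (v' := fun z => dz θ (r, z)) (fun z _ => hasDerivAt_wave ζ z)
    (fun z _ => by
      have := hθ.hasDerivAt_z (r, z)
      rw [hθ.dz_eq]
      exact this) (hw i2)
    (by
      have := (hw i1).const_mul (-(Complex.I * ζ))
      refine this.congr (ae_of_all _ fun z => ?_)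
      simp only [Pi.mul_apply]
      ring) (hw i1)
  rw [hibp]
  simp only [mul_assoc]
  rw [integral_const_mul]
  ring

end wavePairing

/-! ### Weak identities for the radial system -/

lemma radial_congr {F G : ℝ → ℂ} (h : ∀ r : ℝ, 1 < r → F r = G r) :
    ∫ r, F r ∂radial = ∫ r, G r ∂radial :=
  setIntegral_congr_fun measurableSet_Ioi fun r hr => h r hr

namespace RadialSolution

variable {μ : ℝ} {f Y X α : ℝ → ℂ}

lemma integral_X_mul_deriv (h : RadialSolution μ f Y X) (hα : IsRadialTest α) :
    ∫ r, X r * deriv α r ∂radial = -∫ r, ((μ : ℂ) * Y r - f r) * α r ∂radial :=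
  hα.integral_mul_deriv (fun _ hr => h.intG le_rfl hr) h.X_eq

/-- The weak form of `X = r⁻¹ (rY)'`: integrate `rY` by parts against `α / r`. -/
lemma integral_X_mul (h : RadialSolution μ f Y X) (hα : IsRadialTest α) :
    ∫ r, X r * α r ∂radial = ∫ r, Y r * -(r * deriv (fun s : ℝ => α s / s) r) ∂radial := by
  have key := hα.div_r.integral_mul_deriv (P := fun r => r * Y r) (p := fun r => r * X r)
    (fun _ _ => h.contsX.intervalIntegrable _ _) (fun r hr => by simpa using h.Y_eq r hr)
  have e1 : ∫ r, X r * α r ∂radial = ∫ r, r * X r * (α r / r) ∂radial :=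
    radial_congr fun r hr => by
      have : (r : ℂ) ≠ 0 := by exact_mod_cast (zero_lt_one.trans hr).ne'
      field_simp
  rw [e1, ← neg_eq_iff_eq_neg.2 key, ← integral_neg]
  exact radial_congr fun r _ => by ring

end RadialSolution

lemma deriv_div_of_isRadialTest {α : ℝ → ℂ} (hα : IsRadialTest α) {r : ℝ} (hr : 1 < r) :
    deriv (fun s : ℝ => α s / s) r = deriv α r / r - α r / (r : ℂ) ^ 2 := by
  have h0 : (r : ℂ) ≠ 0 := by exact_mod_cast (zero_lt_one.trans hr).ne'
  have h1 : HasDerivAt (fun s : ℝ => (s : ℂ)) 1 r := (hasDerivAt_id r).ofReal_comp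
  have h2 := ((hα.hasDerivAt r).fun_div h1 h0).deriv
  rw [h2]
  field_simp

/-- The weak form of `Y' = X - Y/r`, used for `∂_r 𝒱^r`. -/
lemma RadialSolution.integral_sub_div_mul {μ : ℝ} {f Y X α : ℝ → ℂ}
    (h : RadialSolution μ f Y X) (hα : IsRadialTest α) (hX : IsBddRadial X) (hY : IsBddRadial Y) :
    ∫ r, (X r - Y r / r) * α r ∂radial = ∫ r, Y r * -deriv α r ∂radial := by
  have i1 := hX.integrable_mul hα.integrable
  have i2 := hY.integrable_mul hα.div_r.integrable
  have e1 : ∫ r, (X r - Y r / r) * α r ∂radial =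
      ∫ r, (X r * α r - Y r * (α r / r)) ∂radial := radial_congr fun r _ => by ring
  have i3 : Integrable (fun r : ℝ => Y r * -(r * deriv (fun s : ℝ => α s / s) r)) radial := by
    have h1 := (hα.div_r.deriv.mul_left (β := fun r : ℝ => (r : ℂ))
      Complex.ofRealCLM.contDiff.contDiffOn).integrable.neg
    exact hY.integrable_mul h1
  rw [e1, integral_sub i1 i2, h.integral_X_mul hα, ← integral_sub i3 i2]
  refine radial_congr fun r hr => ?_
  have h0 : (r : ℂ) ≠ 0 := by exact_mod_cast (zero_lt_one.trans hr).ne'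
  rw [deriv_div_of_isRadialTest hα hr]
  field_simp
  ring

/-! ### The multipliers of the Biot-Savart law -/

/-- The negative of the operator `∂_r ^ 2 + r⁻¹ ∂_r + ∂_z ^ 2 - r⁻²`, transposed. -/
def streamTest (φ : ℝ × ℝ → ℂ) (p : ℝ × ℝ) : ℂ :=
  -(dr (dr φ) p - dr (divR φ) p + dz (dz φ) p - divR (divR φ) p)

lemma IsTest.streamTest {φ : ℝ × ℝ → ℂ} (h : IsTest φ) : IsTest (streamTest φ) :=
  (((h.dr.dr.sub' h.divR.dr).add h.dz.dz).sub' h.divR.divR).neg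

section Multipliers

variable {ρ : ℝ} (hρ2 : 2 < ρ) (hρ3 : ρ < 3)

/-- The solution operator `ω ↦ ψ` at frequency `ζ`. -/
def streamOp (ζ : ℝ) : WLinf ρ →L[ℂ] WLinf (ρ - 2) :=
  opY hρ2 hρ3 (k := 0) (by norm_num) (by simp) ζ

/-- `ω ↦ 𝒱^r` at frequency `ζ`. -/
def radialOp (ζ : ℝ) : WLinf ρ →L[ℂ] WLinf (ρ - 1) :=
  Complex.I • opY hρ2 hρ3 (k := 1) (by norm_num) (by push_cast; ring) ζ

/-- `ω ↦ 𝒱^z` at frequency `ζ`. -/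
def verticalOp (ζ : ℝ) : WLinf ρ →L[ℂ] WLinf (ρ - 1) :=
  opX hρ2 hρ3 (k := 0) (by norm_num) (by simp) ζ

/-- `ω ↦ ∂_r 𝒱^r` at frequency `ζ`. -/
def drRadialOp (ζ : ℝ) : WLinf ρ →L[ℂ] WLinf ρ :=
  Complex.I • (opX hρ2 hρ3 (k := 1) (by norm_num) (by push_cast; ring) ζ -
    (divOp (ρ := ρ - 1) (σ := ρ) (by ring)).comp
      (opY hρ2 hρ3 (k := 1) (by norm_num) (by push_cast; ring) ζ))

/-- `ω ↦ ∂_z 𝒱^r` at frequency `ζ`. -/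
def dzRadialOp (ζ : ℝ) : WLinf ρ →L[ℂ] WLinf ρ :=
  opY hρ2 hρ3 (k := 2) (by norm_num) (by push_cast; ring) ζ

/-- `ω ↦ ∂_r 𝒱^z` at frequency `ζ`. -/
def drVerticalOp (ζ : ℝ) : WLinf ρ →L[ℂ] WLinf ρ :=
  dzRadialOp hρ2 hρ3 ζ - ContinuousLinearMap.id ℂ (WLinf ρ)

/-- `ω ↦ ∂_z 𝒱^z` at frequency `ζ`. -/
def dzVerticalOp (ζ : ℝ) : WLinf ρ →L[ℂ] WLinf ρ :=
  (-Complex.I) • opX hρ2 hρ3 (k := 1) (by norm_num) (by push_cast; ring) ζ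

lemma isMultiplier_streamOp : IsMultiplier (opConst ρ) (streamOp hρ2 hρ3) :=
  isMultiplier_opY hρ2 hρ3 (k := 0) (by norm_num) (by simp)

lemma isMultiplier_radialOp : IsMultiplier (opConst ρ) (radialOp hρ2 hρ3) := by
  have h := (isMultiplier_opY hρ2 hρ3 (σ := ρ - 1) (k := 1) (by norm_num)
    (by push_cast; ring)).const_smul Complex.I
  rwa [Complex.norm_I, one_mul] at h

lemma isMultiplier_verticalOp : IsMultiplier (opConst ρ) (verticalOp hρ2 hρ3) :=
  isMultiplier_opX hρ2 hρ3 (k := 0) (by norm_num) (by simp)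

/-- Since `Y' = X - Y/r`, the bounds for `ζX` and for `ζY` divided by `r` each contribute one
`opConst`. -/
lemma isMultiplier_drRadialOp : IsMultiplier (2 * opConst ρ) (drRadialOp hρ2 hρ3) := by
  have hd := norm_divOp_le (ρ := ρ - 1) (σ := ρ) (by ring)
  refine (((isMultiplier_opX hρ2 hρ3 _ _).sub
    ((isMultiplier_opY hρ2 hρ3 _ _).clm_comp _)).const_smul Complex.I).mono ?_
  rw [Complex.norm_I, one_mul, two_mul]
  have := mul_le_of_le_one_left (opConst_pos hρ2 hρ3).le hd
  linarith

lemma isMultiplier_dzRadialOp : IsMultiplier (opConst ρ) (dzRadialOp hρ2 hρ3) :=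
  isMultiplier_opY hρ2 hρ3 (k := 2) (by norm_num) (by push_cast; ring)

/-- The derivative of `𝒱^z = X` is read off from the equation as `ζ² Y - f`; the source itself
accounts for the summand `1`. -/
lemma isMultiplier_drVerticalOp : IsMultiplier (opConst ρ + 1) (drVerticalOp hρ2 hρ3) :=
  ((isMultiplier_dzRadialOp hρ2 hρ3).sub (IsMultiplier.const _)).mono
    (by linarith [ContinuousLinearMap.norm_id_le (𝕜 := ℂ) (E := WLinf ρ)])

lemma isMultiplier_dzVerticalOp : IsMultiplier (opConst ρ) (dzVerticalOp hρ2 hρ3) := by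
  have h := (isMultiplier_opX hρ2 hρ3 (σ := ρ) (k := 1) (by norm_num)
    (by push_cast; ring)).const_smul (-Complex.I)
  rwa [norm_neg, Complex.norm_I, one_mul] at h

variable (ζ : ℝ) (f : WLinf ρ)

lemma coe_streamOp : (streamOp hρ2 hρ3 ζ f : Profile) =ᵐ[radial] solY ρ ζ f := by
  refine (coe_opY hρ2 hρ3 _ _ ζ f).trans (ae_of_all _ fun r => ?_)
  simp

lemma coe_verticalOp : (verticalOp hρ2 hρ3 ζ f : Profile) =ᵐ[radial] solX ρ ζ f := by
  refine (coe_opX hρ2 hρ3 _ _ ζ f).trans (ae_of_all _ fun r => ?_)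
  simp

lemma coe_radialOp : (radialOp hρ2 hρ3 ζ f : Profile) =ᵐ[radial]
    fun r => Complex.I * ζ * solY ρ ζ f r := by
  filter_upwards [WLinf.coe_smul Complex.I
    (opY hρ2 hρ3 (σ := ρ - 1) (k := 1) (by norm_num) (by push_cast; ring) ζ f),
    coe_opY hρ2 hρ3 (σ := ρ - 1) (k := 1) (by norm_num) (by push_cast; ring) ζ f] with r h1 h2
  rw [radialOp, smul_apply, h1, h2]
  push_cast
  ring

lemma coe_drRadialOp : (drRadialOp hρ2 hρ3 ζ f : Profile) =ᵐ[radial]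
    fun r => Complex.I * ζ * (solX ρ ζ f r - solY ρ ζ f r / r) := by
  rw [drRadialOp, smul_apply, sub_apply, ContinuousLinearMap.comp_apply]
  have h2 := coe_opY hρ2 hρ3 (σ := ρ - 1) (k := 1) (by norm_num) (by push_cast; ring) ζ f
  have h3 := coe_opX hρ2 hρ3 (σ := ρ) (k := 1) (by norm_num) (by push_cast; ring) ζ f
  generalize opY hρ2 hρ3 (σ := ρ - 1) (k := 1) (by norm_num) (by push_cast; ring) ζ f = y at h2 ⊢
  generalize opX hρ2 hρ3 (σ := ρ) (k := 1) (by norm_num) (by push_cast; ring) ζ f = x at h3 ⊢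
  filter_upwards [WLinf.coe_smul Complex.I (x - divOp (ρ := ρ - 1) (σ := ρ) (by ring) y),
    WLinf.coe_sub x (divOp (ρ := ρ - 1) (σ := ρ) (by ring) y),
    coe_divOp (ρ := ρ - 1) (σ := ρ) (by ring) y, h2, h3] with r h4 h5 h6 h7 h8
  rw [h4, h5, h6, h7, h8]
  push_cast
  ring

lemma coe_dzRadialOp : (dzRadialOp hρ2 hρ3 ζ f : Profile) =ᵐ[radial]
    fun r => ((ζ ^ 2 : ℝ) : ℂ) * solY ρ ζ f r :=
  coe_opY hρ2 hρ3 _ _ ζ f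

lemma coe_drVerticalOp : (drVerticalOp hρ2 hρ3 ζ f : Profile) =ᵐ[radial]
    fun r => ((ζ ^ 2 : ℝ) : ℂ) * solY ρ ζ f r - (f : Profile) r := by
  filter_upwards [WLinf.coe_sub (dzRadialOp hρ2 hρ3 ζ f) f, coe_dzRadialOp hρ2 hρ3 ζ f]
    with r h1 h2
  rw [← h2]
  exact h1

lemma coe_dzVerticalOp : (dzVerticalOp hρ2 hρ3 ζ f : Profile) =ᵐ[radial]
    fun r => -(Complex.I * ζ) * solX ρ ζ f r := by
  filter_upwards [WLinf.coe_smul (-Complex.I)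
    (opX hρ2 hρ3 (σ := ρ) (k := 1) (by norm_num) (by push_cast; ring) ζ f),
    coe_opX hρ2 hρ3 (σ := ρ) (k := 1) (by norm_num) (by push_cast; ring) ζ f] with r h1 h2
  rw [dzVerticalOp, smul_apply, h1, h2]
  push_cast
  ring

include hρ2 hρ3 in
lemma isBddRadial_solY : IsBddRadial (solY ρ ζ f) :=
  (isBddRadial_coe (by linarith) (streamOp hρ2 hρ3 ζ f)).congr (coe_streamOp hρ2 hρ3 ζ f)

include hρ2 hρ3 in
lemma isBddRadial_solX : IsBddRadial (solX ρ ζ f) :=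
  (isBddRadial_coe (by linarith) (verticalOp hρ2 hρ3 ζ f)).congr (coe_verticalOp hρ2 hρ3 ζ f)

variable {φ : ℝ × ℝ → ℂ} (hφ : IsTest φ)

include hφ

/-- The radial part of the transposed operator factors as `r ∂_r r⁻¹ ∂_r`, the transpose of the
first-order system. Two integrations by parts, first on `Y` and then on `X`, turn it into `ζ² Y -
f`, and the term `∂_z²` cancels `ζ² Y`. -/
lemma wavePairing_streamTest : wavePairing ζ (streamOp hρ2 hρ3 ζ f : Profile) (streamTest φ) =
    wavePairing ζ (f : Profile) φ := by
  have hS := dirichletSolution_sol hρ2 hρ3 ζ f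
  have hY := isBddRadial_solY hρ2 hρ3 ζ f
  have hf := isBddRadial_coe (by linarith) f
  rw [wavePairing_congr_ae (coe_streamOp hρ2 hρ3 ζ f)]
  have h1 : wavePairing ζ (solY ρ ζ f) (streamTest φ) = wavePairing ζ (solY ρ ζ f)
      fun p => -((p.1 : ℂ) * dr (divR (dr φ)) p) + -dz (dz φ) p := by
    refine wavePairing_of_slices fun z => radial_congr fun r hr => ?_
    congr 1
    have h0 : (r : ℂ) ≠ 0 := by exact_mod_cast (zero_lt_one.trans hr).ne'
    have e1 : dr (divR φ) (r, z) = dr φ (r, z) / r - φ (r, z) / (r : ℂ) ^ 2 :=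
      deriv_div_of_isRadialTest (hφ.slice z) hr
    have e2 : dr (divR (dr φ)) (r, z) = dr (dr φ) (r, z) / r - dr φ (r, z) / (r : ℂ) ^ 2 :=
      deriv_div_of_isRadialTest (hφ.dr.slice z) hr
    have e3 : divR (divR φ) (r, z) = φ (r, z) / (r : ℂ) ^ 2 := by
      simp only [divR]
      field_simp
    simp only [streamTest]
    rw [e1, e2, e3]
    field_simp
    ring
  have h2 : wavePairing ζ (solY ρ ζ f) (fun p => -((p.1 : ℂ) * dr (divR (dr φ)) p)) =
      wavePairing ζ (fun r => (f : Profile) r + -((ζ ^ 2 : ℝ) : ℂ) * solY ρ ζ f r) φ := by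
    refine wavePairing_of_slices fun z => ?_
    have e1 := hS.integral_X_mul (hφ.dr.slice z)
    have e2 := hS.integral_X_mul_deriv (hφ.slice z)
    refine e1.symm.trans (e2.trans ?_)
    rw [← integral_neg]
    exact radial_congr fun r _ => by ring
  have hb : IsBddRadial fun r => -((ζ ^ 2 : ℝ) : ℂ) * solY ρ ζ f r := by
    obtain ⟨M, hM⟩ := hY.bdd
    refine ⟨hY.meas.const_mul _, ‖-((ζ ^ 2 : ℝ) : ℂ)‖ * M, ?_⟩
    filter_upwards [hM] with r hr
    rw [norm_mul]
    exact mul_le_mul_of_nonneg_left hr (norm_nonneg _)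
  rw [h1, wavePairing_add_right hY (hφ.dr.divR.dr.mul_r.neg).plane hφ.dz.dz.neg.plane, h2,
    wavePairing_add_left hf hb hφ.plane, wavePairing_const_mul, wavePairing_neg,
    wavePairing_dz hY hφ.dz, wavePairing_dz hY hφ]
  push_cast
  linear_combination (-(ζ : ℂ) ^ 2 * wavePairing ζ (solY ρ ζ f) φ) * Complex.I_sq

lemma wavePairing_radialOp : wavePairing ζ (radialOp hρ2 hρ3 ζ f : Profile) φ =
    wavePairing ζ (streamOp hρ2 hρ3 ζ f : Profile) (dz φ) := by
  rw [wavePairing_congr_ae (coe_radialOp hρ2 hρ3 ζ f),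
    wavePairing_congr_ae (coe_streamOp hρ2 hρ3 ζ f),
    wavePairing_dz (isBddRadial_solY hρ2 hρ3 ζ f) hφ, wavePairing_const_mul]

lemma wavePairing_verticalOp : wavePairing ζ (verticalOp hρ2 hρ3 ζ f : Profile) φ =
    wavePairing ζ (streamOp hρ2 hρ3 ζ f : Profile) (fun p => -((p.1 : ℂ) * dr (divR φ) p)) := by
  rw [wavePairing_congr_ae (coe_verticalOp hρ2 hρ3 ζ f),
    wavePairing_congr_ae (coe_streamOp hρ2 hρ3 ζ f)]
  exact wavePairing_of_slices fun z =>
    (dirichletSolution_sol hρ2 hρ3 ζ f).integral_X_mul (hφ.slice z)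

lemma wavePairing_drRadialOp : wavePairing ζ (drRadialOp hρ2 hρ3 ζ f : Profile) φ =
    wavePairing ζ (radialOp hρ2 hρ3 ζ f : Profile) (fun p => -dr φ p) := by
  rw [wavePairing_congr_ae (coe_drRadialOp hρ2 hρ3 ζ f),
    wavePairing_congr_ae (coe_radialOp hρ2 hρ3 ζ f), wavePairing_const_mul, wavePairing_const_mul]
  congr 1
  exact wavePairing_of_slices fun z => (dirichletSolution_sol hρ2 hρ3 ζ f).integral_sub_div_mul
    (hφ.slice z) (isBddRadial_solX hρ2 hρ3 ζ f) (isBddRadial_solY hρ2 hρ3 ζ f)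

lemma wavePairing_dzRadialOp : wavePairing ζ (dzRadialOp hρ2 hρ3 ζ f : Profile) φ =
    wavePairing ζ (radialOp hρ2 hρ3 ζ f : Profile) (fun p => -dz φ p) := by
  rw [wavePairing_congr_ae (coe_dzRadialOp hρ2 hρ3 ζ f),
    wavePairing_congr_ae (coe_radialOp hρ2 hρ3 ζ f), wavePairing_const_mul, wavePairing_const_mul,
    wavePairing_neg, wavePairing_dz (isBddRadial_solY hρ2 hρ3 ζ f) hφ]
  push_cast
  linear_combination ((ζ : ℂ) ^ 2 * wavePairing ζ (solY ρ ζ f) φ) * Complex.I_sq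

lemma wavePairing_drVerticalOp : wavePairing ζ (drVerticalOp hρ2 hρ3 ζ f : Profile) φ =
    wavePairing ζ (verticalOp hρ2 hρ3 ζ f : Profile) (fun p => -dr φ p) := by
  rw [wavePairing_congr_ae (coe_drVerticalOp hρ2 hρ3 ζ f),
    wavePairing_congr_ae (coe_verticalOp hρ2 hρ3 ζ f), wavePairing_neg, ← neg_eq_iff_eq_neg,
    ← wavePairing_neg]
  refine wavePairing_of_slices fun z => ?_
  refine Eq.trans ?_ ((dirichletSolution_sol hρ2 hρ3 ζ f).integral_X_mul_deriv
    (hφ.slice z)).symm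
  simp only [mul_neg, integral_neg]

lemma wavePairing_dzVerticalOp : wavePairing ζ (dzVerticalOp hρ2 hρ3 ζ f : Profile) φ =
    wavePairing ζ (verticalOp hρ2 hρ3 ζ f : Profile) (fun p => -dz φ p) := by
  rw [wavePairing_congr_ae (coe_dzVerticalOp hρ2 hρ3 ζ f),
    wavePairing_congr_ae (coe_verticalOp hρ2 hρ3 ζ f), wavePairing_neg,
    wavePairing_dz (isBddRadial_solX hρ2 hρ3 ζ f) hφ, wavePairing_const_mul]
  ring

end Multipliers

/-! ### Fields given by multipliers -/

section MultiplierField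

variable {ρ σ σ' C C' : ℝ} {A : ℝ → WLinf ρ →L[ℂ] WLinf σ} {B : ℝ → WLinf ρ →L[ℂ] WLinf σ'}
  {g : ℝ → WLinf ρ} {a : ℤ → WLinf ρ}

/-- The field obtained by applying the multiplier `A` to the Fourier transform of
`g dΛ + ∑ a_m δ_m`. -/
def multField (A : ℝ → WLinf ρ →L[ℂ] WLinf σ) (g : ℝ → WLinf ρ) (a : ℤ → WLinf ρ) : AxiField :=
  fun z => (fourierX σ (fun ζ => A ζ (g ζ)) (fun m => A (-m) (a m)) z : Profile)

lemma IsMultiplier.represents (hA : IsMultiplier C A) (hg : Integrable g)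
    (ha : Summable fun m => ‖a m‖) :
    Represents σ (fun ζ => A ζ (g ζ)) (fun m => A (-m) (a m)) (multField A g a) :=
  ⟨hA.integrable hg, hA.summable ha, fun _ => rfl⟩

lemma Represents.fxNorm_le {u : AxiField} (h : Represents ρ g a u) :
    fxNorm ρ u ≤ (∫ ζ, ‖g ζ‖) + ∑' m, ‖a m‖ := by
  refine csInf_le ⟨0, ?_⟩ ⟨g, a, h, rfl⟩
  rintro N ⟨g', a', -, rfl⟩
  exact add_nonneg (integral_nonneg fun _ => norm_nonneg _) (tsum_nonneg fun _ => norm_nonneg _)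

lemma IsMultiplier.fxNorm_le (hA : IsMultiplier C A) (hg : Integrable g)
    (ha : Summable fun m => ‖a m‖) :
    fxNorm σ (multField A g a) ≤ C * ((∫ ζ, ‖g ζ‖) + ∑' m, ‖a m‖) := by
  refine (hA.represents hg ha).fxNorm_le.trans ?_
  rw [mul_add]
  exact add_le_add (hA.integral_norm_le hg) (hA.tsum_norm_le ha)

lemma pairing_neg (u : AxiField) (θ : ℝ × ℝ → ℂ) : pairing u (fun p => -θ p) = -pairing u θ := by
  unfold pairing
  simp only [mul_neg, integral_neg]

lemma pairing_multField (hσ : 0 ≤ σ) (hσ' : 0 ≤ σ') (hA : IsMultiplier C A)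
    (hB : IsMultiplier C' B) (hg : Integrable g) (ha : Summable fun m => ‖a m‖)
    {θ θ' : ℝ × ℝ → ℂ} (hθ : IsPlaneTest θ) (hθ' : IsPlaneTest θ')
    (h : ∀ ζ f, wavePairing ζ (A ζ f : Profile) θ = wavePairing ζ (B ζ f : Profile) θ') :
    pairing (multField A g a) θ = pairing (multField B g a) θ' :=
  pairing_congr hσ hσ' (hA.represents hg ha) (hB.represents hg ha) hθ hθ' (fun ζ => h ζ _)
    fun _ => h _ _

end MultiplierField

/-! ### Streamfunction, velocity and its derivatives as multiplier fields. -/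

section Existence

variable {ρ : ℝ} (hρ2 : 2 < ρ) (hρ3 : ρ < 3) {g : ℝ → WLinf ρ} {a : ℤ → WLinf ρ}

include hρ2 hρ3

lemma stream_equation {w : AxiField} (h : Represents ρ g a w) (φ : 𝓓(halfPlane, ℂ)) :
    pairing (multField (streamOp hρ2 hρ3) g a)
      (fun p => -(dr (dr φ) p - dr (divR φ) p + dz (dz φ) p - divR (divR φ) p)) =
      pairing w φ :=
  pairing_congr (by linarith) (by linarith)
    ((isMultiplier_streamOp hρ2 hρ3).represents h.integrable h.summable) h
    (isTest_coe φ).streamTest.plane (isTest_coe φ).plane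
    (fun ζ => wavePairing_streamTest hρ2 hρ3 ζ _ (isTest_coe φ))
    fun m => wavePairing_streamTest hρ2 hρ3 _ _ (isTest_coe φ)

variable (hg : Integrable g) (ha : Summable fun m => ‖a m‖)

include hg ha

lemma isBiotSavart_multField : IsBiotSavart (multField (streamOp hρ2 hρ3) g a)
    (multField (radialOp hρ2 hρ3) g a) (multField (verticalOp hρ2 hρ3) g a) where
  radial_eq φ := pairing_multField (by linarith) (by linarith) (isMultiplier_radialOp hρ2 hρ3)
    (isMultiplier_streamOp hρ2 hρ3) hg ha (isTest_coe φ).plane (isTest_coe φ).dz.plane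
    fun ζ f => wavePairing_radialOp hρ2 hρ3 ζ f (isTest_coe φ)
  vertical_eq φ := by
    rw [← pairing_neg]
    exact pairing_multField (by linarith) (by linarith) (isMultiplier_verticalOp hρ2 hρ3)
      (isMultiplier_streamOp hρ2 hρ3) hg ha (isTest_coe φ).plane
      (isTest_coe φ).divR.dr.mul_r.neg.plane
      fun ζ f => wavePairing_verticalOp hρ2 hρ3 ζ f (isTest_coe φ)

lemma isWeakDr_radial : IsWeakDr (multField (radialOp hρ2 hρ3) g a)
    (multField (drRadialOp hρ2 hρ3) g a) := fun φ => by
  rw [← pairing_neg]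
  exact pairing_multField (by linarith) (by linarith) (isMultiplier_drRadialOp hρ2 hρ3)
    (isMultiplier_radialOp hρ2 hρ3) hg ha (isTest_coe φ).plane (isTest_coe φ).dr.neg.plane
    fun ζ f => wavePairing_drRadialOp hρ2 hρ3 ζ f (isTest_coe φ)

lemma isWeakDz_radial : IsWeakDz (multField (radialOp hρ2 hρ3) g a)
    (multField (dzRadialOp hρ2 hρ3) g a) := fun φ => by
  rw [← pairing_neg]
  exact pairing_multField (by linarith) (by linarith) (isMultiplier_dzRadialOp hρ2 hρ3)
    (isMultiplier_radialOp hρ2 hρ3) hg ha (isTest_coe φ).plane (isTest_coe φ).dz.neg.plane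
    fun ζ f => wavePairing_dzRadialOp hρ2 hρ3 ζ f (isTest_coe φ)

lemma isWeakDr_vertical : IsWeakDr (multField (verticalOp hρ2 hρ3) g a)
    (multField (drVerticalOp hρ2 hρ3) g a) := fun φ => by
  rw [← pairing_neg]
  exact pairing_multField (by linarith) (by linarith) (isMultiplier_drVerticalOp hρ2 hρ3)
    (isMultiplier_verticalOp hρ2 hρ3) hg ha (isTest_coe φ).plane (isTest_coe φ).dr.neg.plane
    fun ζ f => wavePairing_drVerticalOp hρ2 hρ3 ζ f (isTest_coe φ)

lemma isWeakDz_vertical : IsWeakDz (multField (verticalOp hρ2 hρ3) g a)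
    (multField (dzVerticalOp hρ2 hρ3) g a) := fun φ => by
  rw [← pairing_neg]
  exact pairing_multField (by linarith) (by linarith) (isMultiplier_dzVerticalOp hρ2 hρ3)
    (isMultiplier_verticalOp hρ2 hρ3) hg ha (isTest_coe φ).plane (isTest_coe φ).dz.neg.plane
    fun ζ f => wavePairing_dzVerticalOp hρ2 hρ3 ζ f (isTest_coe φ)

end Existence

/-! ### The representative that is continuous up to the boundary -/

section Boundary

open scoped BoundedContinuousFunction

variable {ρ : ℝ} (hρ2 : 2 < ρ) (hρ3 : ρ < 3)

include hρ2 hρ3 in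
lemma norm_solY_le (ζ : ℝ) (f : WLinf ρ) {r : ℝ} (hr : 1 ≤ r) :
    ‖solY ρ ζ f r‖ ≤ opConst ρ * ‖f‖ := by
  have h := ((dirichletSolution_sol hρ2 hρ3 ζ f).norm_Y_le hρ2 hρ3 (norm_nonneg f)
    (WLinf.ae_norm_le f) hr).1
  have hS := streamConst_pos hρ2 hρ3
  have h1 : r ^ (-(ρ - 2)) ≤ 1 := Real.rpow_le_one_of_one_le_of_nonpos hr (by linarith)
  have h2 : 0 ≤ streamConst ρ * ‖f‖ := by positivity
  refine h.trans ((mul_le_of_le_one_right h2 h1).trans ?_)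
  refine mul_le_mul_of_nonneg_right ?_ (norm_nonneg f)
  unfold opConst
  linarith

/-- The solution at frequency `ζ` as a bounded continuous function, constant for `r ≤ 1`. -/
def boundedSol (ζ : ℝ) (f : WLinf ρ) : ℝ →ᵇ ℂ :=
  BoundedContinuousFunction.ofNormedAddCommGroup (fun r => solY ρ ζ f (max 1 r))
    ((dirichletSolution_sol hρ2 hρ3 ζ f).contY.comp (by fun_prop)) (opConst ρ * ‖f‖)
    fun _ => norm_solY_le hρ2 hρ3 ζ f (le_max_left _ _)

/-- The solution operator with values in the bounded continuous functions. -/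
def boundedSolOp (ζ : ℝ) : WLinf ρ →L[ℂ] (ℝ →ᵇ ℂ) :=
  LinearMap.mkContinuous
    { toFun := boundedSol hρ2 hρ3 ζ
      map_add' := fun f g => by
        ext r
        exact (sol_add hρ2 hρ3 ζ f g (le_max_left _ _)).1
      map_smul' := fun c f => by
        ext r
        exact (sol_smul hρ2 hρ3 ζ c f (le_max_left _ _)).1 }
    (opConst ρ) fun f =>
      (BoundedContinuousFunction.norm_le
        (mul_nonneg (opConst_pos hρ2 hρ3).le (norm_nonneg f))).2
        fun _ => norm_solY_le hρ2 hρ3 ζ f (le_max_left _ _)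

lemma boundedSolOp_apply (ζ : ℝ) (f : WLinf ρ) (r : ℝ) :
    boundedSolOp hρ2 hρ3 ζ f r = solY ρ ζ f (max 1 r) := rfl

/-- The resolvent identity holds at every `r ≥ 1` and not only almost everywhere, so it is an
identity of operators into the bounded continuous functions. -/
lemma isMultiplier_boundedSolOp : IsMultiplier (opConst ρ) (boundedSolOp hρ2 hρ3) := by
  refine isMultiplier_of_resolvent 0
    (fun ζ => LinearMap.mkContinuous_norm_le _ (opConst_pos hρ2 hρ3).le _)
    (P := opY hρ2 hρ3 le_rfl (exponent_two ρ)) fun ζ ξ hξ => ?_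
  ext f r
  have hP := coe_opY hρ2 hρ3 le_rfl (exponent_two ρ) ξ f
  have h := (sol_resolvent hρ2 hρ3 ζ hξ hP (le_max_left 1 r)).1
  simp only [add_apply, smul_apply, ContinuousLinearMap.comp_apply,
    BoundedContinuousFunction.coe_add, BoundedContinuousFunction.coe_smul, Pi.add_apply,
    boundedSolOp_apply, smul_eq_mul, pow_zero, div_one, Complex.ofReal_one, one_mul]
  exact h

/-- The restriction of a bounded continuous function to `(1, ∞)`. -/
def restrictRadial : (ℝ →ᵇ ℂ) →L[ℂ] WLinf 0 :=
  LinearMap.mkContinuous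
    { toFun := fun F => WLinf.mk (M := ‖F‖) F F.continuous.aestronglyMeasurable
        (ae_of_all _ fun r => by simpa using F.norm_coe_le_norm r)
      map_add' := fun F G => Subtype.ext (AEEqFun.mk_add_mk F G _ _).symm
      map_smul' := fun c F => Subtype.ext (AEEqFun.smul_mk c F _).symm }
    1 fun F => by
      rw [one_mul]
      refine WLinf.norm_le (norm_nonneg F) ?_
      filter_upwards [WLinf.coe_mk (σ := 0) (M := ‖F‖) F F.continuous.aestronglyMeasurable
        (ae_of_all _ fun r => by simpa using F.norm_coe_le_norm r)] with r hr
      refine (congrArg norm hr).trans_le ?_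
      simpa using F.norm_coe_le_norm r

lemma coe_restrictRadial (F : ℝ →ᵇ ℂ) : (restrictRadial F : Profile) =ᵐ[radial] F :=
  AEEqFun.coeFn_mk _ _

/-- The inclusion of `L^∞_σ` into `L^∞`. -/
def inclusionOp {σ : ℝ} (hσ : 0 ≤ σ) : WLinf σ →L[ℂ] WLinf 0 :=
  (show BoundedAssignment σ 0 1 fun f => (f : Profile) from
    { meas := fun f => (f : Profile).aestronglyMeasurable
      add := fun f g => WLinf.coe_add f g
      smul := fun c f => WLinf.coe_smul c f
      bound := fun f => by simpa using norm_le_of_nonneg hσ f }).op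

lemma coe_inclusionOp {σ : ℝ} (hσ : 0 ≤ σ) (f : WLinf σ) :
    (inclusionOp hσ f : Profile) =ᵐ[radial] (f : Profile) :=
  BoundedAssignment.coe_op _ f

variable {g : ℝ → WLinf ρ} {a : ℤ → WLinf ρ}

/-- The superposition is carried out in the Banach space of bounded continuous functions, where
evaluation at `r = 1` is a bounded operator and so kills the sum along with each term. Continuity in
`z` for the sup norm gives joint continuity. -/
lemma stream_boundary (hg : Integrable g) (ha : Summable fun m => ‖a m‖) :
    ∃ Ψ : ℝ × ℝ → ℂ, ContinuousOn Ψ (Ici (1 : ℝ) ×ˢ univ) ∧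
      (∀ z : ℝ, ∀ᵐ r ∂radial, multField (streamOp hρ2 hρ3) g a z r = Ψ (r, z)) ∧
      ∀ z : ℝ, Ψ (1, z) = 0 := by
  have hB := isMultiplier_boundedSolOp hρ2 hρ3
  have hA := isMultiplier_streamOp hρ2 hρ3
  have hσ : 0 ≤ ρ - 2 := by linarith
  let V : ℝ → ℝ →ᵇ ℂ := fourierSum (fun ζ => boundedSolOp hρ2 hρ3 ζ (g ζ))
    fun m : ℤ => boundedSolOp hρ2 hρ3 (-m) (a m)
  have hV : Continuous V := continuous_fourierSum (hB.integrable hg) (hB.summable ha)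
  refine ⟨fun p => V p.2 p.1, Continuous.continuousOn ?_, fun z => ?_, fun z => ?_⟩
  · exact (hV.comp continuous_snd).eval continuous_fst
  -- The two superpositions are compared in the common target `L^∞`, since bounded operators pass
  -- through them.
  · have hcomp : ∀ ζ f, restrictRadial (boundedSolOp hρ2 hρ3 ζ f) =
        inclusionOp hσ (streamOp hρ2 hρ3 ζ f) := fun ζ f => by
      refine WLinf.ext_ae ?_
      filter_upwards [coe_restrictRadial (boundedSolOp hρ2 hρ3 ζ f),
        coe_inclusionOp hσ (streamOp hρ2 hρ3 ζ f), coe_streamOp hρ2 hρ3 ζ f,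
        ae_restrict_mem measurableSet_Ioi] with r h1 h2 h3 hr
      rw [h1, h2, h3, boundedSolOp_apply, max_eq_right (le_of_lt hr)]
    have h1 : restrictRadial (V z) = inclusionOp hσ
        (fourierX (ρ - 2) (fun ζ => streamOp hρ2 hρ3 ζ (g ζ))
          (fun m : ℤ => streamOp hρ2 hρ3 (-m) (a m)) z) := by
      rw [fourierX_eq, clm_fourierSum _ (hB.integrable hg) (hB.summable ha),
        clm_fourierSum _ (hA.integrable hg) (hA.summable ha)]
      simp only [hcomp]
    have h2 := coe_restrictRadial (V z)
    rw [h1] at h2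
    filter_upwards [h2, coe_inclusionOp hσ (fourierX (ρ - 2) (fun ζ => streamOp hρ2 hρ3 ζ (g ζ))
          (fun m : ℤ => streamOp hρ2 hρ3 (-m) (a m)) z)] with r h3 h4
    rw [← h3, h4]
    rfl
  · have h1 := clm_fourierSum (BoundedContinuousFunction.evalCLM ℂ (1 : ℝ)) (hB.integrable hg)
      (hB.summable ha) z
    have h0 : ∀ ζ f, boundedSolOp hρ2 hρ3 ζ f 1 = 0 := fun ζ f => by
      rw [boundedSolOp_apply, max_self, (dirichletSolution_sol hρ2 hρ3 ζ f).zero]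
    refine h1.trans ?_
    simp [fourierSum, BoundedContinuousFunction.evalCLM_apply, h0]

lemma isStreamFunction_multField {w : AxiField} (h : Represents ρ g a w) :
    IsStreamFunction w (multField (streamOp hρ2 hρ3) g a) :=
  ⟨stream_equation hρ2 hρ3 h, stream_boundary hρ2 hρ3 h.integrable h.summable⟩

end Boundary

/-! ### Tensor products and uniqueness of fields -/

lemma IsRadialTest.tensor {α χ : ℝ → ℂ} (hα : IsRadialTest α) (hχ : ContDiff ℝ ∞ χ)
    (hs : HasCompactSupport χ) : IsTest fun p => α p.1 * χ p.2 where
  smooth := (hα.smooth.comp contDiff_fst).mul (hχ.comp contDiff_snd)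
  supp := by
    refine HasCompactSupport.of_support_subset_isCompact
      (hα.supp.isCompact.prod hs.isCompact) fun p hp => ?_
    exact ⟨subset_tsupport _ (left_ne_zero_of_mul hp), subset_tsupport _ (right_ne_zero_of_mul hp)⟩
  sub := by
    have h1 : tsupport (fun p : ℝ × ℝ => α p.1 * χ p.2) ⊆ tsupport α ×ˢ tsupport χ := by
      refine closure_minimal (fun p hp => ?_) ((isClosed_tsupport α).prod (isClosed_tsupport χ))
      exact ⟨subset_tsupport _ (left_ne_zero_of_mul hp),
        subset_tsupport _ (right_ne_zero_of_mul hp)⟩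
    exact fun p hp => ⟨hα.sub (h1 hp).1, mem_univ _⟩

lemma isRadialTest_ofReal {α : ℝ → ℝ} (h1 : ContDiff ℝ ∞ α) (h2 : HasCompactSupport α)
    (h3 : tsupport α ⊆ Ioi 1) : IsRadialTest fun r => (α r : ℂ) where
  smooth := Complex.ofRealCLM.contDiff.comp h1
  supp := h2.comp_left (g := ((↑) : ℝ → ℂ)) Complex.ofReal_zero
  sub := (tsupport_comp_subset (g := ((↑) : ℝ → ℂ)) Complex.ofReal_zero α).trans h3

lemma ae_radial_eq_zero {f : ℝ → ℂ} (hf : LocallyIntegrableOn f (Ioi 1))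
    (h : ∀ α, IsRadialTest α → ∫ r, f r * α r ∂radial = 0) : ∀ᵐ r ∂radial, f r = 0 := by
  rw [ae_restrict_iff' measurableSet_Ioi]
  refine isOpen_Ioi.ae_eq_zero_of_integral_contDiff_smul_eq_zero hf fun α h1 h2 h3 => ?_
  rw [← h _ (isRadialTest_ofReal h1 h2 h3),
    ← setIntegral_eq_integral_of_forall_compl_eq_zero (s := Ioi (1 : ℝ))]
  · refine integral_congr_ae (ae_of_all _ fun r => ?_)
    simp only [Complex.real_smul]
    ring
  · intro r hr
    rw [image_eq_zero_of_notMem_tsupport fun hs => hr (h3 hs), zero_smul]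

lemma IsBddRadial.locallyIntegrableOn {f : ℝ → ℂ} (h : IsBddRadial f) :
    LocallyIntegrableOn f (Ioi 1) := by
  obtain ⟨M, hM⟩ := h.bdd
  refine (locallyIntegrableOn_iff isOpen_Ioi.isLocallyClosed).2 fun k hk hkc => ?_
  have hle : (volume : Measure ℝ).restrict k ≤ radial := Measure.restrict_mono hk le_rfl
  exact IntegrableOn.of_bound hkc.measure_lt_top (h.meas.mono_measure hle) M
    (hle.absolutelyContinuous hM)

/-- A profile is determined by its pairings. -/
lemma WLinf.eq_zero_of_pairing {σ : ℝ} (hσ : 0 ≤ σ) {f : WLinf σ}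
    (h : ∀ α, IsRadialTest α → ∫ r, (f : Profile) r * α r ∂radial = 0) : f = 0 := by
  refine WLinf.ext_ae ?_
  filter_upwards [ae_radial_eq_zero (isBddRadial_coe hσ f).locallyIntegrableOn h,
    AEEqFun.coeFn_zero (μ := radial) (β := ℂ)] with r h1 h2
  rw [h1]
  exact h2.symm

lemma pairing_tensor {u : AxiField} {α χ : ℝ → ℂ} :
    pairing u (fun p => α p.1 * χ p.2) = ∫ z, χ z * ∫ r, u z r * α r ∂radial := by
  unfold pairing
  refine integral_congr_ae (ae_of_all _ fun z => ?_)
  simp only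
  rw [← integral_const_mul]
  refine integral_congr_ae (ae_of_all _ fun r => ?_)
  simp only
  ring

lemma eq_zero_of_integral_mul_eq_zero {k : ℝ → ℂ} (hk : Continuous k)
    (h : ∀ χ : ℝ → ℂ, ContDiff ℝ ∞ χ → HasCompactSupport χ → ∫ z, χ z * k z = 0) : k = 0 := by
  refine Continuous.ae_eq_iff_eq (μ := volume) hk continuous_zero |>.1 ?_
  refine ae_eq_zero_of_integral_contDiff_smul_eq_zero hk.locallyIntegrable fun χ h1 h2 => ?_
  rw [← h (fun z => (χ z : ℂ)) (Complex.ofRealCLM.contDiff.comp h1)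
    (h2.comp_left (g := ((↑) : ℝ → ℂ)) Complex.ofReal_zero)]
  simp only [Complex.real_smul]

section

variable {σ : ℝ} {g g' : ℝ → WLinf σ} {a a' : ℤ → WLinf σ} {u u' : AxiField}

lemma Represents.sub (h : Represents σ g a u) (h' : Represents σ g' a' u') :
    Represents σ (g - g') (a - a') (u - u') where
  integrable := h.integrable.sub h'.integrable
  summable := (h.summable.add h'.summable).of_nonneg_of_le (fun _ => norm_nonneg _)
    fun m => norm_sub_le (a m) (a' m)
  eq z := by
    have e : fourierSum (g - g') (a - a') z = fourierSum g a z - fourierSum g' a' z := by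
      simp only [fourierSum, Pi.sub_apply, smul_sub]
      rw [integral_sub (integrable_wave_smul h.integrable z)
        (integrable_wave_smul h'.integrable z), (summable_wave_smul h.summable z).tsum_sub
        (summable_wave_smul h'.summable z), smul_sub]
      abel
    rw [fourierX_eq, e, Pi.sub_apply, h.eq, h'.eq, fourierX_eq, fourierX_eq]
    rfl

lemma Represents.pairing_sub (hσ : 0 ≤ σ) (h : Represents σ g a u) (h' : Represents σ g' a' u')
    {θ : ℝ × ℝ → ℂ} (hθ : IsPlaneTest θ) : pairing (u - u') θ = pairing u θ - pairing u' θ := by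
  have hi : ∀ {g : ℝ → WLinf σ} {a : ℤ → WLinf σ}, Integrable g → (Summable fun m => ‖a m‖) →
      Integrable fun z => hθ.slicePairing hσ z (fourierSum g a z) := fun hg ha =>
    (((hθ.continuous_slicePairing hσ).clm_apply
      (continuous_fourierSum hg ha))).integrable_of_hasCompactSupport
      ((hθ.hasCompactSupport_slicePairing hσ).mono' fun z hz => subset_tsupport _ fun h0 => hz (by
        simp only [h0, zero_apply]))
  rw [(h.sub h').pairing_eq hσ hθ, h.pairing_eq hσ hθ, h'.pairing_eq hσ hθ,
    ← integral_sub (hi h.integrable h.summable) (hi h'.integrable h'.summable)]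
  refine integral_congr_ae (ae_of_all _ fun z => ?_)
  simp only
  rw [← map_sub]
  congr 1
  refine Subtype.ext ?_
  have e := (h.sub h').eq z
  rw [Pi.sub_apply, h.eq, h'.eq, fourierX_eq, fourierX_eq, fourierX_eq] at e
  exact e.symm

/-- A field in `FX` is determined by its pairings. -/
lemma Represents.eq_zero_of_pairing (hσ : 0 ≤ σ) (h : Represents σ g a u)
    (h0 : ∀ φ, IsTest φ → pairing u φ = 0) : u = 0 := by
  funext z
  have h1 : fourierX σ g a z = 0 := by
    refine WLinf.eq_zero_of_pairing hσ fun α hα => ?_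
    -- Tensor products of test functions separate the variables; continuity in `z` upgrades
    -- vanishing almost everywhere to vanishing at each `z`.
    have hk : Continuous fun z => profilePairing hσ hα.integrable (fourierX σ g a z) := by
      rw [fourierX_eq]
      exact (profilePairing hσ hα.integrable).continuous.comp
        (continuous_fourierSum h.integrable h.summable)
    refine congrFun (eq_zero_of_integral_mul_eq_zero hk fun χ h1 h2 => ?_) z
    rw [← h0 _ (hα.tensor h1 h2), pairing_tensor]
    simp only [h.eq, profilePairing_apply]
  rw [h.eq, h1]
  rfl

lemma MemFX.eq_of_pairing (hσ : 0 ≤ σ) (h : MemFX σ u) (h' : MemFX σ u')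
    (h0 : ∀ φ, IsTest φ → pairing u φ = pairing u' φ) : u = u' := by
  obtain ⟨g, a, h⟩ := h
  obtain ⟨g', a', h'⟩ := h'
  refine sub_eq_zero.1 ((h.sub h').eq_zero_of_pairing hσ fun φ hφ => ?_)
  rw [h.pairing_sub hσ h' hφ.plane, h0 φ hφ, sub_self]

lemma IsBiotSavart.unique (hσ : 0 ≤ σ) {ψ Vr Vz Vr' Vz' : AxiField} (hr : MemFX σ Vr)
    (hz : MemFX σ Vz) (hr' : MemFX σ Vr') (hz' : MemFX σ Vz') (h : IsBiotSavart ψ Vr Vz)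
    (h' : IsBiotSavart ψ Vr' Vz') : Vr = Vr' ∧ Vz = Vz' :=
  ⟨hr.eq_of_pairing hσ hr' fun _ hφ => (h.radial_eq hφ.toTestFunction).trans
      (h'.radial_eq hφ.toTestFunction).symm,
    hz.eq_of_pairing hσ hz' fun _ hφ => (h.vertical_eq hφ.toTestFunction).trans
      (h'.vertical_eq hφ.toTestFunction).symm⟩

end

/-! ### Averages over frequencies -/

lemma exists_cutoff : ∃ κ : ℝ → ℂ, ContDiff ℝ ∞ κ ∧ HasCompactSupport κ ∧ κ 0 = 1 := by
  let b : ContDiffBump (0 : ℝ) := ⟨1, 2, by norm_num, by norm_num⟩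
  refine ⟨fun z => (b z : ℂ), Complex.ofRealCLM.contDiff.comp b.contDiff,
    b.hasCompactSupport.comp_left (g := ((↑) : ℝ → ℂ)) Complex.ofReal_zero, ?_⟩
  have h : b 0 = 1 := b.one_of_mem_closedBall (by simp [b.rIn_pos.le])
  simp [h]

/-- A weak equation `k'' = -K` may be tested with functions decaying at infinity. -/
lemma integral_weak_eq_zero {k K : ℝ → ℂ} (hk : Continuous k) (hK : Continuous K) {B : ℝ}
    (hkB : ∀ z, ‖k z‖ ≤ B) (hKB : ∀ z, ‖K z‖ ≤ B)
    (h : ∀ χ : ℝ → ℂ, ContDiff ℝ ∞ χ → HasCompactSupport χ →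
      ∫ z, (χ z * K z + deriv (deriv χ) z * k z) = 0)
    {χ : ℝ → ℂ} (hχ : ContDiff ℝ ∞ χ) (i0 : Integrable χ) (i1 : Integrable (deriv χ))
    (i2 : Integrable (deriv (deriv χ))) :
    ∫ z, (χ z * K z + deriv (deriv χ) z * k z) = 0 := by
  obtain ⟨κ, hκ, hκs, hκ0⟩ := exists_cutoff
  have hκ' : ContDiff ℝ ∞ (deriv κ) := (contDiff_infty_iff_deriv.1 hκ).2
  have hκ'' : ContDiff ℝ ∞ (deriv (deriv κ)) := (contDiff_infty_iff_deriv.1 hκ').2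
  have hχ' : ContDiff ℝ ∞ (deriv χ) := (contDiff_infty_iff_deriv.1 hχ).2
  have hd : ∀ {f : ℝ → ℂ}, ContDiff ℝ ∞ f → ∀ z, HasDerivAt f (deriv f z) z := fun hf z =>
    (hf.differentiable (by simp) z).hasDerivAt
  obtain ⟨D0, hD0⟩ := hκs.exists_bound_of_continuous hκ.continuous
  obtain ⟨D1, hD1⟩ := hκs.deriv.exists_bound_of_continuous hκ'.continuous
  obtain ⟨D2, hD2⟩ := hκs.deriv.deriv.exists_bound_of_continuous hκ''.continuous
  let ε : ℕ → ℝ := fun n => ((n : ℝ) + 1)⁻¹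
  have hε0 : ∀ n, 0 < ε n := fun n => by positivity
  have hε1 : ∀ n, ε n ≤ 1 := fun n => inv_le_one_of_one_le₀ (by
    have := n.cast_nonneg (α := ℝ); linarith)
  have hε : Tendsto ε atTop (𝓝 0) := tendsto_inv_atTop_zero.comp
    (tendsto_natCast_atTop_atTop.atTop_add tendsto_const_nhds)
  have hsc : ∀ {f : ℝ → ℂ}, ContDiff ℝ ∞ f → ∀ n z,
      HasDerivAt (fun z => f (ε n * z)) (ε n * deriv f (ε n * z)) z := fun hf n z => by
    have h1 : HasDerivAt (fun z : ℝ => ε n * z) (ε n) z := by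
      simpa using (hasDerivAt_id z).const_mul (ε n)
    exact (hd hf (ε n * z)).scomp z h1
  -- Each derivative falling on the dilated cutoff produces a factor `ε n ≤ 1`, which gives
  -- domination uniform in `n` and makes those terms vanish in the limit.
  let X : ℕ → ℝ → ℂ := fun n z => κ (ε n * z) * χ z
  have hX1 : ∀ n, deriv (X n) = fun z => ε n * deriv κ (ε n * z) * χ z +
      κ (ε n * z) * deriv χ z := fun n => funext fun z =>
    ((hsc hκ n z).mul (hd hχ z)).deriv
  have hX2 : ∀ n z, deriv (deriv (X n)) z = ε n * (ε n * deriv (deriv κ) (ε n * z)) * χ z +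
      ε n * deriv κ (ε n * z) * deriv χ z + (ε n * deriv κ (ε n * z) * deriv χ z +
      κ (ε n * z) * deriv (deriv χ) z) := fun n z => by
    rw [hX1]
    exact ((((hsc hκ' n z).const_mul (ε n : ℂ)).mul (hd hχ z)).add
      ((hsc hκ n z).mul (hd hχ' z))).deriv
  have hz : ∀ n, ∫ z, (X n z * K z + deriv (deriv (X n)) z * k z) = 0 := fun n => by
    refine h (X n) ((hκ.comp (contDiff_const.mul contDiff_id)).mul hχ) ?_
    exact HasCompactSupport.mul_right
      (hκs.comp_homeomorph (Homeomorph.mulLeft₀ (ε n) (hε0 n).ne'))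
  have hXc : ∀ n, ContDiff ℝ ∞ (X n) := fun n =>
    (hκ.comp (contDiff_const.mul contDiff_id)).mul hχ
  have hlim : Tendsto (fun n => ∫ z, (X n z * K z + deriv (deriv (X n)) z * k z)) atTop
      (𝓝 (∫ z, (χ z * K z + deriv (deriv χ) z * k z))) := by
    refine tendsto_integral_of_dominated_convergence
      (fun z => (D0 * ‖χ z‖ + (D2 * ‖χ z‖ + 2 * (D1 * ‖deriv χ z‖) +
        D0 * ‖deriv (deriv χ) z‖)) * B) (fun n => ?_) ?_ (fun n => ?_) ?_
    · have h1 := (contDiff_infty_iff_deriv.1 (contDiff_infty_iff_deriv.1 (hXc n)).2).2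
      exact (((hXc n).continuous.mul hK).add (h1.continuous.mul hk)).aestronglyMeasurable
    · exact ((i0.norm.const_mul D0).add (((i0.norm.const_mul D2).add
        ((i1.norm.const_mul D1).const_mul 2)).add (i2.norm.const_mul D0))).mul_const B
    · refine ae_of_all _ fun z => ?_
      have hεn : ‖(ε n : ℂ)‖ ≤ 1 := by
        rw [Complex.norm_real, Real.norm_of_nonneg (hε0 n).le]
        exact hε1 n
      have b0 : ‖X n z‖ ≤ D0 * ‖χ z‖ := by
        rw [norm_mul]
        exact mul_le_mul_of_nonneg_right (hD0 _) (norm_nonneg _)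
      have b1 : ‖ε n * deriv κ (ε n * z) * deriv χ z‖ ≤ D1 * ‖deriv χ z‖ := by
        rw [norm_mul, norm_mul]
        refine mul_le_mul_of_nonneg_right ?_ (norm_nonneg _)
        exact (mul_le_of_le_one_left (norm_nonneg _) hεn).trans (hD1 _)
      have b2 : ‖ε n * (ε n * deriv (deriv κ) (ε n * z)) * χ z‖ ≤ D2 * ‖χ z‖ := by
        rw [norm_mul, norm_mul, norm_mul]
        refine mul_le_mul_of_nonneg_right ?_ (norm_nonneg _)
        exact (mul_le_of_le_one_left (by positivity) hεn).trans
          ((mul_le_of_le_one_left (norm_nonneg _) hεn).trans (hD2 _))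
      have b3 : ‖κ (ε n * z) * deriv (deriv χ) z‖ ≤ D0 * ‖deriv (deriv χ) z‖ := by
        rw [norm_mul]
        exact mul_le_mul_of_nonneg_right (hD0 _) (norm_nonneg _)
      have b4 : ‖deriv (deriv (X n)) z‖ ≤ D2 * ‖χ z‖ + 2 * (D1 * ‖deriv χ z‖) +
          D0 * ‖deriv (deriv χ) z‖ := by
        rw [hX2]
        refine (norm_add_le _ _).trans ((add_le_add (norm_add_le _ _) (norm_add_le _ _)).trans ?_)
        linarith
      refine (norm_add_le _ _).trans ?_
      rw [norm_mul (X n z) (K z), norm_mul (deriv (deriv (X n)) z) (k z), add_mul]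
      exact add_le_add (mul_le_mul b0 (hKB z) (norm_nonneg _) ((norm_nonneg _).trans b0))
        (mul_le_mul b4 (hkB z) (norm_nonneg _) ((norm_nonneg _).trans b4))
    · refine ae_of_all _ fun z => ?_
      have hεc : Tendsto (fun n => (ε n : ℂ)) atTop (𝓝 0) := by
        exact_mod_cast (Complex.continuous_ofReal.tendsto 0).comp hε
      have ht : ∀ {f : ℝ → ℂ}, ContDiff ℝ ∞ f → Tendsto (fun n => f (ε n * z)) atTop (𝓝 (f 0)) :=
        fun hf => (hf.continuous.tendsto 0).comp (by simpa using hε.mul_const z)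
      have t0 := (ht hκ).mul_const (χ z)
      have t1 := (hεc.mul (ht hκ')).mul_const (deriv χ z)
      have t2 := (hεc.mul (hεc.mul (ht hκ''))).mul_const (χ z)
      have t3 := (ht hκ).mul_const (deriv (deriv χ) z)
      simp_rw [hX2]
      have := (t0.mul_const (K z)).add (((t2.add t1).add (t1.add t3)).mul_const (k z))
      simpa [hκ0] using this
  simp_rw [hz] at hlim
  exact (tendsto_nhds_unique hlim tendsto_const_nhds)

open scoped SchwartzMap FourierTransform in
-- Fourier inversion, rescaled by `2π` to the convention of `wave`. Integrating a field in `z`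
-- against `χ` then integrates `β` against its spectral measure; `χ` is only Schwartz, so compactly
-- supported tests do not suffice.
lemma exists_schwartz_wave {β : ℝ → ℂ} (hβ : ContDiff ℝ ∞ β) (hs : HasCompactSupport β) :
    ∃ χ : 𝓢(ℝ, ℂ), ∀ ζ, ∫ z, wave ζ z * χ z = β ζ := by
  have h2π : (2 * Real.pi) ≠ 0 := by positivity
  have h1 : HasCompactSupport fun ξ : ℝ => β (2 * Real.pi * ξ) :=
    hs.comp_homeomorph (Homeomorph.mulLeft₀ _ h2π)
  have h2 : ContDiff ℝ ∞ fun ξ : ℝ => β (2 * Real.pi * ξ) :=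
    hβ.comp (contDiff_const.mul contDiff_id)
  let b : 𝓢(ℝ, ℂ) := h1.toSchwartzMap h2
  refine ⟨𝓕⁻ b, fun ζ => ?_⟩
  have e : 𝓕 (𝓕⁻ b) (ζ / (2 * Real.pi)) = β ζ := by
    rw [FourierTransform.fourier_fourierInv_eq]
    change β (2 * Real.pi * (ζ / (2 * Real.pi))) = β ζ
    rw [mul_div_cancel₀ _ h2π]
  rw [← e, SchwartzMap.fourier_coe, Real.fourier_eq']
  refine integral_congr_ae (ae_of_all _ fun z => ?_)
  simp only [smul_eq_mul]
  congr 1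
  rw [wave]
  congr 1
  have : (Real.pi : ℂ) ≠ 0 := by exact_mod_cast Real.pi_ne_zero
  simp
  field_simp

lemma integrable_wave_mul {k : ℝ → ℂ} (hk : Integrable k) (ζ : ℝ) :
    Integrable fun z => wave ζ z * k z :=
  hk.bdd_mul (c := 1) (continuous_wave_right ζ).aestronglyMeasurable
    (ae_of_all _ fun _ => (norm_wave _ _).le)

lemma integral_wave_mul_deriv {χ : ℝ → ℂ} (hχ : ContDiff ℝ ∞ χ) (i0 : Integrable χ)
    (i1 : Integrable (deriv χ)) (ζ : ℝ) :
    ∫ z, wave ζ z * deriv χ z = Complex.I * ζ * ∫ z, wave ζ z * χ z := by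
  have hibp := integral_mul_deriv_eq_deriv_mul_of_integrable (u := wave ζ)
    (u' := fun z => -(Complex.I * ζ) * wave ζ z) (v := χ)
    (v' := deriv χ) (fun z _ => hasDerivAt_wave ζ z)
    (fun z _ => (hχ.differentiable (by simp) z).hasDerivAt) (integrable_wave_mul i1 ζ)
    (by
      have := (integrable_wave_mul i0 ζ).const_mul (-(Complex.I * ζ))
      refine this.congr (ae_of_all _ fun z => ?_)
      simp only [Pi.mul_apply]
      ring) (integrable_wave_mul i0 ζ)
  rw [hibp]
  simp only [mul_assoc]
  rw [integral_const_mul]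
  ring

section FreqAverage

variable {E : Type*} [NormedAddCommGroup E] [NormedSpace ℂ E] {g : ℝ → E} {a : ℤ → E}
  {β : ℝ → ℂ}

/-- The integral of `β` against the measure `g dΛ + ∑ a_m δ_m` whose Fourier transform is
`fourierSum g a`. -/
def freqAverage (β : ℝ → ℂ) (g : ℝ → E) (a : ℤ → E) : E :=
  fourierNorm • (∫ ζ, β ζ • g ζ) + ∑' m : ℤ, β (-(m : ℝ)) • a m

lemma norm_freqAverage_le (hg : Integrable g) (ha : Summable fun m => ‖a m‖) {b : ℝ}
    (hb : ∀ ζ, ‖β ζ‖ ≤ b) :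
    ‖freqAverage β g a‖ ≤ b * (‖fourierNorm‖ * (∫ ζ, ‖g ζ‖) + ∑' m, ‖a m‖) := by
  have hle : ∀ ζ (v : E), ‖β ζ • v‖ ≤ b * ‖v‖ := fun ζ v => by
    rw [norm_smul]
    exact mul_le_mul_of_nonneg_right (hb ζ) (norm_nonneg _)
  refine (norm_add_le _ _).trans ?_
  rw [mul_add, norm_smul]
  refine add_le_add ?_ ?_
  · rw [mul_left_comm, ← integral_const_mul]
    exact mul_le_mul_of_nonneg_left (norm_integral_le_of_norm_le (hg.norm.const_mul b)
      (ae_of_all _ fun ζ => hle ζ _)) (norm_nonneg _)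
  · exact tsum_of_norm_bounded (ha.hasSum.mul_left b) fun m => hle _ _

lemma continuous_smul_id {χ : ℝ → ℂ} (hχ : Continuous χ) :
    Continuous fun z => χ z • ContinuousLinearMap.id ℂ E := hχ.smul continuous_const

lemma integrable_norm_smul_id {χ : ℝ → ℂ} (hχ : Integrable χ) :
    Integrable fun z => ‖χ z • ContinuousLinearMap.id ℂ E‖ := by
  simpa only [norm_smul] using hχ.norm.mul_const ‖ContinuousLinearMap.id ℂ E‖

variable [CompleteSpace E]

lemma integral_smul_fourierSum (hg : Integrable g) (ha : Summable fun m => ‖a m‖) {χ : ℝ → ℂ}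
    (hc : Continuous χ) (hi : Integrable χ) (hχ : ∀ ζ, ∫ z, wave ζ z * χ z = β ζ) :
    ∫ z, χ z • fourierSum g a z = freqAverage β g a := by
  have h := integral_clm_fourierSum (continuous_smul_id (E := E) hc)
    (integrable_norm_smul_id (E := E) hi) hg ha
  have e : ∀ ζ (v : E), ∫ z, wave ζ z • (χ z • ContinuousLinearMap.id ℂ E) v = β ζ • v :=
    fun ζ v => by
      simp only [smul_apply, ContinuousLinearMap.id_apply, smul_smul]
      rw [integral_smul_const, hχ]
  simp only [e] at h
  exact h

lemma integrable_smul_fourierSum (hg : Integrable g) (ha : Summable fun m => ‖a m‖) {χ : ℝ → ℂ}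
    (hi : Integrable χ) : Integrable fun z => χ z • fourierSum g a z :=
  hi.smul_bdd (‖fourierNorm‖ * (∫ ζ, ‖g ζ‖) + ∑' m, ‖a m‖)
    (continuous_fourierSum hg ha).aestronglyMeasurable
    (ae_of_all _ fun z => norm_fourierSum_le ha z)

lemma clm_freqAverage {F : Type*} [NormedAddCommGroup F] [NormedSpace ℂ F] [CompleteSpace F]
    (L : E →L[ℂ] F) (hg : Integrable g) (ha : Summable fun m => ‖a m‖) {χ : ℝ → ℂ}
    (hc : Continuous χ) (hi : Integrable χ) (hχ : ∀ ζ, ∫ z, wave ζ z * χ z = β ζ) :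
    L (freqAverage β g a) = ∫ z, χ z • L (fourierSum g a z) := by
  rw [← integral_smul_fourierSum hg ha hc hi hχ,
    ← L.integral_comp_comm (integrable_smul_fourierSum hg ha hi)]
  simp only [map_smul]

end FreqAverage

/-! ### Regularity of weak solutions of the radial equation at frequency zero -/

namespace IsRadialTest

variable {α γ : ℝ → ℂ}

lemma add (h : IsRadialTest α) (h' : IsRadialTest γ) : IsRadialTest (α + γ) :=
  ⟨h.smooth.add h'.smooth, h.supp.add h'.supp, (tsupport_add α γ).trans (union_subset h.sub h'.sub)⟩

lemma const_smul (h : IsRadialTest α) (c : ℂ) : IsRadialTest (c • α) :=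
  h.mul_left (β := fun _ => c) contDiffOn_const

lemma zero : IsRadialTest 0 :=
  ⟨contDiff_const, HasCompactSupport.zero, by simp⟩

lemma exists_Icc (h : IsRadialTest α) : ∃ a b, 1 < a ∧ a ≤ b ∧ tsupport α ⊆ Icc a b := by
  rcases (tsupport α).eq_empty_or_nonempty with h0 | h0
  · exact ⟨2, 2, by norm_num, le_rfl, by simp [h0]⟩
  · have hc : IsCompact (tsupport α) := h.supp.isCompact
    exact ⟨_, _, h.sub (hc.sInf_mem h0), csInf_le_csSup h0 hc.bddBelow hc.bddAbove,
      subset_Icc_csInf_csSup hc.bddBelow hc.bddAbove⟩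

lemma exists_primitive (h : IsRadialTest γ) (h0 : ∫ r, γ r ∂radial = 0) :
    ∃ η, IsRadialTest η ∧ _root_.deriv η = γ := by
  obtain ⟨a, b, ha, hab, hsub⟩ := h.exists_Icc
  have hγ : ∀ r, r ∉ Icc a b → γ r = 0 := fun r hr =>
    image_eq_zero_of_notMem_tsupport fun hs => hr (hsub hs)
  have hc := h.smooth.continuous
  let η : ℝ → ℂ := fun r => ∫ s in (1 : ℝ)..r, γ s
  have hd : ∀ r, HasDerivAt η (γ r) r := fun r =>
    intervalIntegral.integral_hasDerivAt_right (hc.intervalIntegrable _ _)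
      (hc.stronglyMeasurableAtFilter _ _) hc.continuousAt
  have hη' : _root_.deriv η = γ := funext fun r => (hd r).deriv
  have hzero : ∀ r, r ∉ Icc a b → η r = 0 := by
    intro r hr
    by_cases h1 : r < a
    · refine (intervalIntegral.integral_congr (g := fun _ => (0 : ℂ)) fun s hs => ?_).trans
        (by simp)
      refine hγ s fun hs' => ?_
      have := hs.2
      rcases le_max_iff.1 this with h2 | h2 <;> linarith [hs'.1]
    · have h2 : b < r := by
        by_contra! h2
        exact hr ⟨not_lt.1 h1, h2⟩
      have h3 : (1 : ℝ) ≤ r := by linarith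
      refine Eq.trans ?_ h0
      change ∫ s in (1 : ℝ)..r, γ s = _
      rw [intervalIntegral.integral_of_le h3]
      have hsub' : Ioc (1 : ℝ) r ⊆ Ioi 1 := fun s hs => hs.1
      refine (setIntegral_eq_of_subset_of_forall_sdiff_eq_zero measurableSet_Ioi hsub'
        fun s hs => ?_).symm
      exact hγ s fun hs' => hs.2 ⟨hs.1, hs'.2.trans h2.le⟩
  have hsupp : tsupport η ⊆ Icc a b :=
    closure_minimal (fun r hr => by_contra fun h' => hr (hzero r h')) isClosed_Icc
  refine ⟨η, ⟨?_, ?_, ?_⟩, hη'⟩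
  · refine contDiff_infty_iff_deriv.2 ⟨fun r => (hd r).differentiableAt, ?_⟩
    rw [hη']
    exact h.smooth
  · exact isCompact_Icc.of_isClosed_subset (isClosed_tsupport η) hsupp
  · exact hsupp.trans fun r hr => ha.trans_le hr.1

/-- Invert the two derivatives one at a time: a primitive has compact support in `(1, ∞)` when the
mean vanishes. After the first step the condition is `∫ r η = 0`, which by parts is the
orthogonality of `γ` to `r²`. -/
lemma exists_deriv_div (h : IsRadialTest γ) (h0 : ∫ r, γ r ∂radial = 0)
    (h2 : ∫ r, (r : ℂ) ^ 2 * γ r ∂radial = 0) :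
    ∃ α, IsRadialTest α ∧ _root_.deriv (fun s : ℝ => _root_.deriv α s / s) = γ := by
  obtain ⟨η, hη, hηγ⟩ := h.exists_primitive h0
  have hcast : ContDiff ℝ ∞ fun r : ℝ => (r : ℂ) := Complex.ofRealCLM.contDiff
  have key := hη.integral_mul_deriv (P := fun r => (r : ℂ) ^ 2 / 2) (p := fun r => (r : ℂ))
    (fun r _ => Complex.continuous_ofReal.intervalIntegrable _ _) (fun r _ => by
      have hder : ∀ s ∈ uIcc 1 r, HasDerivAt (fun s : ℝ => (s : ℂ) ^ 2 / 2) (s : ℂ) s := by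
        intro s _
        have h1 : HasDerivAt (fun s : ℝ => (s : ℂ)) 1 s := (hasDerivAt_id s).ofReal_comp
        have := (h1.pow 2).div_const 2
        convert! this using 1
        simp
      rw [intervalIntegral.integral_eq_sub_of_hasDerivAt hder
        (Complex.continuous_ofReal.intervalIntegrable _ _)]
      ring)
  have e1 : ∫ r, (r : ℂ) * η r ∂radial = 0 := by
    rw [hηγ] at key
    have e2 : ∫ r, (r : ℂ) ^ 2 / 2 * γ r ∂radial = 0 := by
      have : ∀ r : ℝ, (r : ℂ) ^ 2 / 2 * γ r = (1 / 2 : ℂ) * ((r : ℂ) ^ 2 * γ r) :=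
        fun r => by ring
      simp_rw [this]
      rw [integral_const_mul, h2, mul_zero]
    rw [e2] at key
    exact neg_eq_zero.1 key.symm
  obtain ⟨α, hα, hαη⟩ := (hη.mul_left hcast.contDiffOn).exists_primitive e1
  refine ⟨α, hα, ?_⟩
  have : (fun s : ℝ => _root_.deriv α s / s) = η := by
    funext s
    rw [hαη]
    rcases eq_or_ne s 0 with rfl | hs
    · have : η 0 = 0 := image_eq_zero_of_notMem_tsupport fun h' => by
        have := hη.sub h'
        norm_num [mem_Ioi] at this
      simp [this]
    · have : (s : ℂ) ≠ 0 := by exact_mod_cast hs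
      field_simp
  rw [this, hηγ]

end IsRadialTest

/-- The space of smooth functions with compact support in `(1, ∞)`. -/
def radialTests : Submodule ℂ (ℝ → ℂ) where
  carrier := {α | IsRadialTest α}
  add_mem' := fun h h' => IsRadialTest.add h h'
  zero_mem' := IsRadialTest.zero
  smul_mem' := fun c _ h => IsRadialTest.const_smul h c

lemma IsRadialTest.integrable_mul {α : ℝ → ℂ} (hα : IsRadialTest α) {h : ℝ → ℂ}
    (hh : LocallyIntegrableOn h (Ioi 1)) : Integrable (fun r => h r * α r) radial := by
  have hc : IsCompact (tsupport α) := hα.supp.isCompact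
  have h1 : IntegrableOn (fun r => h r * α r) (tsupport α) :=
    (hh.integrableOn_compact_subset hα.sub hc).mul_continuousOn
      hα.smooth.continuous.continuousOn hc
  refine IntegrableOn.of_forall_sdiff_eq_zero h1 measurableSet_Ioi fun r hr => ?_
  rw [image_eq_zero_of_notMem_tsupport hr.2, mul_zero]

/-- The functional given by a locally integrable function on `(1, ∞)`. -/
def radialFunctional (h : ℝ → ℂ) (hh : LocallyIntegrableOn h (Ioi 1)) : radialTests →ₗ[ℂ] ℂ where
  toFun γ := ∫ r, h r * (γ : ℝ → ℂ) r ∂radial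
  map_add' γ γ' := by
    rw [← integral_add (IsRadialTest.integrable_mul γ.2 hh) (IsRadialTest.integrable_mul γ'.2 hh)]
    refine integral_congr_ae (ae_of_all _ fun r => ?_)
    simp only [Submodule.coe_add, Pi.add_apply]
    ring
  map_smul' c γ := by
    rw [RingHom.id_apply, smul_eq_mul, ← integral_const_mul]
    refine integral_congr_ae (ae_of_all _ fun r => ?_)
    simp only [Submodule.coe_smul, Pi.smul_apply, smul_eq_mul]
    ring

lemma radialFunctional_apply {h : ℝ → ℂ} (hh : LocallyIntegrableOn h (Ioi 1)) {γ : ℝ → ℂ}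
    (hγ : IsRadialTest γ) : radialFunctional h hh ⟨γ, hγ⟩ = ∫ r, h r * γ r ∂radial := rfl

/-- As functionals on test functions, `e` vanishes wherever `1` and `r²` both do, so it is a linear
combination of these two. -/
lemma exists_eq_add_sq {e : ℝ → ℂ} (he : LocallyIntegrableOn e (Ioi 1))
    (h : ∀ α, IsRadialTest α →
      ∫ r, e r * deriv (fun s : ℝ => deriv α s / s) r ∂radial = 0) :
    ∃ c₁ c₂ : ℂ, ∀ᵐ r ∂radial, e r = c₁ + c₂ * (r : ℂ) ^ 2 := by
  have l1 : LocallyIntegrableOn (fun _ : ℝ => (1 : ℂ)) (Ioi 1) :=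
    continuous_const.locallyIntegrable.locallyIntegrableOn _
  have l2 : LocallyIntegrableOn (fun r : ℝ => (r : ℂ) ^ 2) (Ioi 1) :=
    (Complex.continuous_ofReal.pow 2).locallyIntegrable.locallyIntegrableOn _
  have hspan : radialFunctional e he ∈ Submodule.span ℂ
      (range ![radialFunctional _ l1, radialFunctional _ l2]) := by
    refine mem_span_of_iInf_ker_le_ker fun γ hγ => ?_
    obtain ⟨γ, hγt⟩ := γ
    rw [Submodule.mem_iInf] at hγ
    have k1 : radialFunctional _ l1 ⟨γ, hγt⟩ = 0 := hγ 0
    have k2 : radialFunctional _ l2 ⟨γ, hγt⟩ = 0 := hγ 1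
    rw [radialFunctional_apply _ hγt] at k1 k2
    simp only [one_mul] at k1
    obtain ⟨α, hα, hαγ⟩ := IsRadialTest.exists_deriv_div hγt k1 k2
    rw [LinearMap.mem_ker, radialFunctional_apply _ hγt, ← hαγ]
    exact h α hα
  obtain ⟨c, hc⟩ := (Submodule.mem_span_range_iff_exists_fun ℂ).1 hspan
  rw [Fin.sum_univ_two] at hc
  refine ⟨c 0, c 1, ?_⟩
  have l3 : LocallyIntegrableOn (fun r : ℝ => c 0 + c 1 * (r : ℂ) ^ 2) (Ioi 1) := by
    refine Continuous.locallyIntegrable ?_ |>.locallyIntegrableOn _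
    fun_prop
  filter_upwards [ae_radial_eq_zero (he.sub l3) fun γ hγ => by
    have h1 := LinearMap.congr_fun hc ⟨γ, hγ⟩
    have h2 : c 0 * ∫ r, 1 * γ r ∂radial + c 1 * ∫ r, (r : ℂ) ^ 2 * γ r ∂radial =
      ∫ r, e r * γ r ∂radial := h1
    have h3 : ∫ r, (e - fun r : ℝ => c 0 + c 1 * (r : ℂ) ^ 2) r * γ r ∂radial =
        ∫ r, (e r * γ r - (c 0 * (1 * γ r) + c 1 * ((r : ℂ) ^ 2 * γ r))) ∂radial :=
      integral_congr_ae (ae_of_all _ fun r => by simp only [Pi.sub_apply]; ring)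
    rw [h3, integral_sub (hγ.integrable_mul he), integral_add, integral_const_mul (c 0),
      integral_const_mul (c 1), h2, sub_self]
    · exact (hγ.integrable_mul l1).const_mul _
    · exact (hγ.integrable_mul l2).const_mul _
    · exact ((hγ.integrable_mul l1).const_mul _).add ((hγ.integrable_mul l2).const_mul _)]
    with r hr
  exact sub_eq_zero.1 hr

/-- At frequency zero the system is triangular: `X` is a primitive of `F` and `rY` a primitive of
`rX`. -/
lemma exists_particular {F : ℝ → ℂ} (hF : IsBddRadial F) :
    ∃ Y X, RadialSolution 0 (fun r => -F r) Y X := by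
  obtain ⟨M, hM⟩ := hF.bdd
  have int : ∀ r : ℝ, 1 ≤ r → IntervalIntegrable F volume 1 r := fun r hr =>
    intervalIntegrable_of_bound hF.meas (g := fun _ => M) continuousOn_const hM hr
  let X : ℝ → ℂ := fun r => ∫ s in (1 : ℝ)..r, F s
  have hX : ContinuousOn X (Ici 1) := by
    intro r hr
    have h1 : ContinuousOn X (uIcc 1 (r + 1)) :=
      (absolutelyContinuousOnInterval_integral (int (r + 1) (by
        have : (1 : ℝ) ≤ r := hr
        linarith))).continuousOn
    have hr' : (1 : ℝ) ≤ r := hr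
    rw [uIcc_of_le (by linarith)] at h1
    refine (h1 r ⟨hr', by linarith⟩).mono_of_mem_nhdsWithin ?_
    have : Iio (r + 1) ∈ 𝓝 r := Iio_mem_nhds (by linarith)
    filter_upwards [self_mem_nhdsWithin, mem_nhdsWithin_of_mem_nhds this] with s h2 h3
    exact ⟨h2, (le_of_lt h3)⟩
  have hXm : Continuous fun r : ℝ => (r : ℂ) * X (max 1 r) :=
    Complex.continuous_ofReal.mul (hX.comp_continuous (by fun_prop) fun s =>
      mem_Ici.2 (le_max_left _ _))
  let P : ℝ → ℂ := fun r => ∫ s in (1 : ℝ)..r, (s : ℂ) * X (max 1 s)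
  have hP : Continuous P :=
    intervalIntegral.continuous_primitive (fun a b => hXm.intervalIntegrable a b) 1
  have hPX : ∀ r : ℝ, 1 ≤ r → P r = ∫ s in (1 : ℝ)..r, (s : ℂ) * X s := fun r hr => by
    refine intervalIntegral.integral_congr fun s hs => ?_
    rw [uIcc_of_le hr] at hs
    rw [max_eq_right hs.1]
  refine ⟨_, _, RadialSolution.of_continuousOn (Y := fun r => P r / r) (X := X) ?_ hX
    (fun r hr => (int r hr).neg) (fun r hr => ?_) fun r hr => ?_⟩
  · refine hP.continuousOn.div Complex.continuous_ofReal.continuousOn fun r hr => ?_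
    have : (0 : ℝ) < r := zero_lt_one.trans_le hr
    exact_mod_cast this.ne'
  · simp [X]
  · have : (r : ℂ) ≠ 0 := by exact_mod_cast (zero_lt_one.trans_le hr).ne'
    rw [← hPX r hr]
    simp only [P, intervalIntegral.integral_same]
    field_simp
    simp

lemma radialSolution_homogeneous (c₁ c₂ : ℂ) :
    RadialSolution 0 (fun _ => 0) (fun r => c₁ / (max 1 r : ℝ) + c₂ * (max 1 r : ℝ))
      (fun _ => 2 * c₂) := by
  refine RadialSolution.of_continuousOn (Y := fun r : ℝ => c₁ / (r : ℂ) + c₂ * r)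
    (X := fun _ => 2 * c₂) ?_ continuousOn_const (fun r _ => by simp) (fun r _ => by simp)
    fun r hr => ?_
  · refine (continuousOn_const.div Complex.continuous_ofReal.continuousOn fun r hr => ?_).add
      (continuousOn_const.mul Complex.continuous_ofReal.continuousOn)
    have : (0 : ℝ) < r := zero_lt_one.trans_le hr
    exact_mod_cast this.ne'
  · have h0 : (r : ℂ) ≠ 0 := by exact_mod_cast (zero_lt_one.trans_le hr).ne'
    have hder : ∀ s ∈ uIcc 1 r, HasDerivAt (fun s : ℝ => c₂ * (s : ℂ) ^ 2) (s * (2 * c₂)) s := by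
      intro s _
      have h1 : HasDerivAt (fun s : ℝ => (s : ℂ)) 1 s := (hasDerivAt_id s).ofReal_comp
      have := (h1.pow 2).const_mul c₂
      convert! this using 1
      simp
      ring
    rw [intervalIntegral.integral_eq_sub_of_hasDerivAt hder
      ((Complex.continuous_ofReal.mul continuous_const).intervalIntegrable _ _)]
    field_simp
    push_cast
    ring

/-- Weak solutions at frequency zero are solutions. -/
lemma exists_radialSolution_of_weak {w F : ℝ → ℂ} (hw : IsBddRadial w) (hF : IsBddRadial F)
    (h : ∀ α, IsRadialTest α →
      ∫ r, w r * (r * deriv (fun s : ℝ => deriv α s / s) r) ∂radial = ∫ r, F r * α r ∂radial) :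
    ∃ Y X, RadialSolution 0 (fun r => -F r) Y X ∧ w =ᵐ[radial] Y := by
  obtain ⟨Y, X, hS⟩ := exists_particular hF
  have hwl := hw.locallyIntegrableOn
  have hYl : LocallyIntegrableOn Y (Ioi 1) := hS.contY.locallyIntegrable.locallyIntegrableOn _
  have hel : LocallyIntegrableOn (fun r : ℝ => r * (w r - Y r)) (Ioi 1) :=
    (hwl.sub hYl).continuousOn_mul Complex.continuous_ofReal.continuousOn
      isOpen_Ioi.isLocallyClosed
  -- Subtracting the particular solution leaves `r (w - Y)` orthogonal to all `(α'/r)'`, hence equal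
  -- to `c₁ + c₂ r²`; so `w - Y = c₁/r + c₂ r` is a homogeneous solution.
  obtain ⟨c₁, c₂, hc⟩ := exists_eq_add_sq hel fun α hα => by
    have ht : IsRadialTest fun r : ℝ => r * deriv (fun s : ℝ => deriv α s / s) r :=
      hα.deriv.div_r.deriv.mul_left Complex.ofRealCLM.contDiff.contDiffOn
    have e1 := hS.integral_X_mul hα.deriv
    rw [hS.integral_X_mul_deriv hα] at e1
    have e2 : ∫ r, r * (w r - Y r) * deriv (fun s : ℝ => deriv α s / s) r ∂radial =
        ∫ r, (w r * (r * deriv (fun s : ℝ => deriv α s / s) r) -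
          Y r * (r * deriv (fun s : ℝ => deriv α s / s) r)) ∂radial :=
      integral_congr_ae (ae_of_all _ fun r => by simp only; ring)
    rw [e2, integral_sub (ht.integrable_mul hwl) (ht.integrable_mul hYl), h α hα, sub_eq_zero]
    simp only [mul_neg, integral_neg, Complex.ofReal_zero, zero_mul, zero_sub, neg_neg] at e1
    exact neg_injective e1
  refine ⟨_, _, (hS.add (radialSolution_homogeneous c₁ c₂)).congr_rhs
    (ae_of_all _ fun r => by simp), ?_⟩
  filter_upwards [hc, ae_restrict_mem measurableSet_Ioi] with r hr hr1
  have h1 : (1 : ℝ) < r := hr1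
  have h0 : (r : ℂ) ≠ 0 := by exact_mod_cast (zero_lt_one.trans h1).ne'
  simp only [Pi.add_apply]
  rw [max_eq_right h1.le]
  field_simp
  linear_combination hr

/-! ### Uniqueness of the streamfunction -/

lemma contDiff_sq_mul {β : ℝ → ℂ} (hβ : ContDiff ℝ ∞ β) :
    ContDiff ℝ ∞ fun ζ : ℝ => (ζ : ℂ) ^ 2 * β ζ :=
  (Complex.ofRealCLM.contDiff.pow 2).mul hβ

section FreqAverageLinear

variable {E : Type*} [NormedAddCommGroup E] [NormedSpace ℂ E] [CompleteSpace E]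
  {g : ℝ → E} {a : ℤ → E} {β β' : ℝ → ℂ}

omit [CompleteSpace E] in
lemma integrable_freq (hg : Integrable g) (hβ : Continuous β) (hs : HasCompactSupport β) :
    Integrable fun ζ => β ζ • g ζ := by
  obtain ⟨b, hb⟩ := hs.exists_bound_of_continuous hβ
  exact hg.bdd_smul b hβ.aestronglyMeasurable (ae_of_all _ hb)

lemma summable_freq (ha : Summable fun m => ‖a m‖) (hβ : Continuous β)
    (hs : HasCompactSupport β) : Summable fun m : ℤ => β (-(m : ℝ)) • a m := by
  obtain ⟨b, hb⟩ := hs.exists_bound_of_continuous hβ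
  refine Summable.of_norm_bounded (ha.mul_left b) fun m => ?_
  rw [norm_smul]
  exact mul_le_mul_of_nonneg_right (hb _) (norm_nonneg _)

lemma freqAverage_add (hg : Integrable g) (ha : Summable fun m => ‖a m‖) (hβ : Continuous β)
    (hs : HasCompactSupport β) (hβ' : Continuous β') (hs' : HasCompactSupport β') :
    freqAverage (fun ζ => β ζ + β' ζ) g a = freqAverage β g a + freqAverage β' g a := by
  simp only [freqAverage, add_smul]
  rw [integral_add (integrable_freq hg hβ hs) (integrable_freq hg hβ' hs'),
    (summable_freq ha hβ hs).tsum_add (summable_freq ha hβ' hs'), smul_add]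
  abel

omit [CompleteSpace E] in
lemma freqAverage_const_mul (c : ℂ) :
    freqAverage (fun ζ => c * β ζ) g a = c • freqAverage β g a := by
  simp only [freqAverage, mul_smul]
  rw [integral_smul, tsum_const_smul'', smul_add, smul_comm]

end FreqAverageLinear

/-! #### Averages near the boundary -/

/-- The normalized indicator function of `(1, 1 + ε]`. -/
def layer (ε : ℝ) : ℝ → ℂ := (Ioc (1 : ℝ) (1 + ε)).indicator fun _ => ((ε⁻¹ : ℝ) : ℂ)

lemma integrable_layer (ε : ℝ) : Integrable (layer ε) :=
  (integrable_indicator_iff measurableSet_Ioc).2 (integrableOn_const (by simp))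

lemma integral_norm_layer {ε : ℝ} (hε : 0 < ε) : ∫ r, ‖layer ε r‖ = 1 := by
  have e : (fun r => ‖layer ε r‖) = (Ioc (1 : ℝ) (1 + ε)).indicator fun _ => ε⁻¹ := by
    funext r
    rw [layer, norm_indicator_eq_indicator_norm]
    congr 1
    funext s
    rw [Complex.norm_real, Real.norm_of_nonneg (by positivity)]
  rw [e, integral_indicator measurableSet_Ioc, setIntegral_const, Measure.real,
    Real.volume_Ioc, add_sub_cancel_left, ENNReal.toReal_ofReal hε.le, smul_eq_mul,
    mul_inv_cancel₀ hε.ne']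

/-- These averages are difference quotients at `1` of a primitive of `F`. They give a boundary value
to a function known only up to null sets. -/
lemma tendsto_layer {f F : ℝ → ℂ} (hF : ContinuousOn F (Ici 1)) (hfF : f =ᵐ[radial] F) :
    Tendsto (fun n : ℕ => ∫ r, f r * layer ((n : ℝ) + 1)⁻¹ r ∂radial) atTop (𝓝 (F 1)) := by
  let Φ : ℝ → ℂ := fun r => F (max 1 r)
  have hΦ : Continuous Φ := hF.comp_continuous (by fun_prop) fun s => mem_Ici.2 (le_max_left _ _)
  have hd : HasDerivAt (fun r => ∫ s in (1 : ℝ)..r, Φ s) (Φ 1) 1 :=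
    intervalIntegral.integral_hasDerivAt_right (hΦ.intervalIntegrable _ _)
      (hΦ.stronglyMeasurableAtFilter _ _) hΦ.continuousAt
  have ht : Tendsto (fun n : ℕ => ((n : ℝ) + 1)⁻¹) atTop (𝓝[≠] 0) := by
    refine tendsto_nhdsWithin_iff.2 ⟨?_, Eventually.of_forall fun n => ?_⟩
    · exact tendsto_inv_atTop_zero.comp
        (tendsto_natCast_atTop_atTop.atTop_add tendsto_const_nhds)
    · have : (0 : ℝ) < ((n : ℝ) + 1)⁻¹ := by positivity
      exact this.ne'
  have h1 := (hasDerivAt_iff_tendsto_slope_zero.1 hd).comp ht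
  have e1 : Φ 1 = F 1 := by simp [Φ]
  rw [e1] at h1
  have hint : ∀ ε : ℝ, 0 < ε →
      ε⁻¹ • ∫ s in (1 : ℝ)..1 + ε, Φ s = ∫ r, f r * layer ε r ∂radial := fun ε hε => by
    have e2 : ∫ r, f r * layer ε r ∂radial =
        ∫ r, (Ioc (1 : ℝ) (1 + ε)).indicator (fun r => ((ε⁻¹ : ℝ) : ℂ) * Φ r) r ∂radial := by
      refine integral_congr_ae ?_
      filter_upwards [hfF, ae_restrict_mem measurableSet_Ioi] with r hr hr1
      have hr2 : (1 : ℝ) < r := hr1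
      by_cases h : r ∈ Ioc (1 : ℝ) (1 + ε)
      · simp only [layer, indicator_of_mem h, hr, Φ, max_eq_right hr2.le]
        ring
      · simp only [layer, indicator_of_notMem h, mul_zero]
    have hsub : Ioc (1 : ℝ) (1 + ε) ⊆ Ioi 1 := fun s hs => hs.1
    rw [e2, setIntegral_indicator measurableSet_Ioc, inter_eq_self_of_subset_right hsub,
      integral_const_mul, intervalIntegral.integral_of_le (by linarith), Complex.real_smul]
  refine h1.congr fun n => ?_
  simp only [Function.comp, intervalIntegral.integral_same, sub_zero]
  exact hint _ (by positivity)

section Uniqueness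

variable {σ : ℝ} {g : ℝ → WLinf σ} {a : ℤ → WLinf σ} {ψ : AxiField} {β : ℝ → ℂ}

/-- The test function `r (α' / r)'`. -/
def radialStreamTest (α : ℝ → ℂ) (r : ℝ) : ℂ := r * deriv (fun s : ℝ => deriv α s / s) r

lemma IsRadialTest.radialStreamTest {α : ℝ → ℂ} (hα : IsRadialTest α) :
    IsRadialTest (radialStreamTest α) :=
  hα.deriv.div_r.deriv.mul_left Complex.ofRealCLM.contDiff.contDiffOn

lemma streamTest_tensor {α χ : ℝ → ℂ} (hα : IsRadialTest α) {r : ℝ} (hr : 1 < r) (z : ℝ) :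
    streamTest (fun p => α p.1 * χ p.2) (r, z) =
      -(χ z * radialStreamTest α r + deriv (deriv χ) z * α r) := by
  have d1 : dr (fun p => α p.1 * χ p.2) = fun p => deriv α p.1 * χ p.2 :=
    funext fun p => deriv_mul_const (hα.hasDerivAt p.1).differentiableAt (χ p.2)
  have d2 : dr (fun p => deriv α p.1 * χ p.2) = fun p => deriv (deriv α) p.1 * χ p.2 :=
    funext fun p => deriv_mul_const (hα.deriv.hasDerivAt p.1).differentiableAt (χ p.2)
  have d3 : divR (fun p => α p.1 * χ p.2) = fun p => α p.1 / p.1 * χ p.2 :=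
    funext fun p => by simp only [divR]; ring
  have d4 : dr (fun p => α p.1 / p.1 * χ p.2) =
      fun p => deriv (fun s : ℝ => α s / s) p.1 * χ p.2 :=
    funext fun p => deriv_mul_const (hα.div_r.hasDerivAt p.1).differentiableAt (χ p.2)
  have d5 : dz (fun p => α p.1 * χ p.2) = fun p => α p.1 * deriv χ p.2 :=
    funext fun p => deriv_const_mul_field (v := χ) (x := p.2) (α p.1)
  have d6 : dz (fun p => α p.1 * deriv χ p.2) = fun p => α p.1 * deriv (deriv χ) p.2 :=
    funext fun p => deriv_const_mul_field (v := deriv χ) (x := p.2) (α p.1)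
  have h0 : (r : ℂ) ≠ 0 := by exact_mod_cast (zero_lt_one.trans hr).ne'
  rw [streamTest, d1, d2, d3, d4, d5, d6]
  simp only [divR, radialStreamTest]
  rw [deriv_div_of_isRadialTest hα hr, deriv_div_of_isRadialTest hα.deriv hr]
  field_simp
  ring

lemma Represents.pairing_streamTest_tensor (hσ : 0 ≤ σ) (h : Represents σ g a ψ) {α χ : ℝ → ℂ}
    (hα : IsRadialTest α) :
    pairing ψ (streamTest fun p => α p.1 * χ p.2) =
      -∫ z, (χ z * profilePairing hσ hα.radialStreamTest.integrable (fourierSum g a z) +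
        deriv (deriv χ) z * profilePairing hσ hα.integrable (fourierSum g a z)) := by
  rw [pairing, ← integral_neg]
  refine integral_congr_ae (ae_of_all _ fun z => ?_)
  have e : ∀ r, ψ z r = ((fourierSum g a z : WLinf σ) : Profile) r := fun r => by rw [h.eq, fourierX_eq]
  simp only
  rw [profilePairing_apply, profilePairing_apply, ← integral_const_mul, ← integral_const_mul,
    ← integral_add ((integrable_profile_mul hσ _ hα.radialStreamTest.integrable).const_mul _)
      ((integrable_profile_mul hσ _ hα.integrable).const_mul _), ← integral_neg]
  refine radial_congr fun r hr => ?_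
  rw [streamTest_tensor hα hr, e]
  ring

/-- The averages of a weak solution of the homogeneous equation are coupled. -/
lemma Represents.freqAverage_weak (hσ : 0 ≤ σ) (h : Represents σ g a ψ)
    (h0 : ∀ φ, IsTest φ → pairing ψ (streamTest φ) = 0) (hβ : ContDiff ℝ ∞ β)
    (hs : HasCompactSupport β) {α : ℝ → ℂ} (hα : IsRadialTest α) :
    ∫ r, ((freqAverage β g a : WLinf σ) : Profile) r * radialStreamTest α r ∂radial =
      ∫ r, ((freqAverage (fun ζ => (ζ : ℂ) ^ 2 * β ζ) g a : WLinf σ) : Profile) r * α r ∂radial := by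
  obtain ⟨χ, hχ⟩ := exists_schwartz_wave hβ hs
  have hd1 : deriv χ = SchwartzMap.derivCLM ℂ ℂ χ := rfl
  have hd2 : deriv (deriv χ) = SchwartzMap.derivCLM ℂ ℂ (SchwartzMap.derivCLM ℂ ℂ χ) := rfl
  have i0 : Integrable χ := χ.integrable
  have i1 : Integrable (deriv χ) := by
    rw [hd1]
    exact SchwartzMap.integrable _
  have i2 : Integrable (deriv (deriv χ)) := by
    rw [hd2]
    exact SchwartzMap.integrable _
  have c1 : ContDiff ℝ ∞ (deriv χ) := by
    rw [hd1]
    exact SchwartzMap.smooth _ ⊤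
  have c2 : Continuous (deriv (deriv χ)) := by
    rw [hd2]
    exact SchwartzMap.continuous _
  have hG := continuous_fourierSum h.integrable h.summable
  obtain ⟨L, hL⟩ : ∃ L, L = profilePairing hσ hα.radialStreamTest.integrable := ⟨_, rfl⟩
  obtain ⟨L', hL'⟩ : ∃ L', L' = profilePairing hσ hα.integrable := ⟨_, rfl⟩
  have hbd : ∀ (T : WLinf σ →L[ℂ] ℂ) z, ‖T (fourierSum g a z)‖ ≤
      ‖T‖ * (‖fourierNorm‖ * (∫ ζ, ‖g ζ‖) + ∑' m, ‖a m‖) := fun T z =>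
    (T.le_opNorm _).trans (mul_le_mul_of_nonneg_left (norm_fourierSum_le h.summable z)
      (norm_nonneg _))
  have key := integral_weak_eq_zero (k := fun z => L' (fourierSum g a z))
    (K := fun z => L (fourierSum g a z)) (L'.continuous.comp hG) (L.continuous.comp hG)
    (fun z => (hbd L' z).trans (le_max_left _ _)) (fun z => (hbd L z).trans (le_max_right _ _))
    (fun χ h1 h2 => by
      have h3 := h0 _ (hα.tensor h1 h2)
      rw [h.pairing_streamTest_tensor hσ hα, neg_eq_zero] at h3
      rw [hL, hL']
      exact h3) (χ.smooth ⊤) i0 i1 i2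
  -- Two derivatives of `χ` multiply its wave transform by `(iζ)²`, so `-χ''` has transform `ζ² β`.
  have hcmp : ∀ ζ, ∫ z, wave ζ z * -deriv (deriv χ) z = (ζ : ℂ) ^ 2 * β ζ := fun ζ => by
    simp only [mul_neg, integral_neg]
    rw [integral_wave_mul_deriv c1 i1 i2, integral_wave_mul_deriv (χ.smooth ⊤) i0 i1, hχ]
    linear_combination (-(ζ : ℂ) ^ 2 * β ζ) * Complex.I_sq
  have e1 := clm_freqAverage L h.integrable h.summable χ.continuous i0 hχ
  have e2 := clm_freqAverage L' h.integrable h.summable c2.neg i2.neg hcmp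
  have j1 : Integrable fun z => χ z * L (fourierSum g a z) :=
    i0.mul_bdd (L.continuous.comp hG).aestronglyMeasurable (ae_of_all _ (hbd L))
  have j2 : Integrable fun z => deriv (deriv χ) z * L' (fourierSum g a z) :=
    i2.mul_bdd (L'.continuous.comp hG).aestronglyMeasurable (ae_of_all _ (hbd L'))
  rw [integral_add j1 j2] at key
  have e3 : L (freqAverage β g a) = L' (freqAverage (fun ζ => (ζ : ℂ) ^ 2 * β ζ) g a) := by
    rw [e1, e2]
    simp only [Pi.neg_apply, smul_eq_mul, neg_mul, integral_neg]
    exact eq_neg_of_add_eq_zero_left key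
  rw [hL, hL', profilePairing_apply, profilePairing_apply] at e3
  exact e3

/-- At each height the layer averages of `ψ` tend to `Ψ (1, z) = 0`. The layer functionals have norm
at most `1`, so a multiple of `‖χ z‖` dominates and the limit passes through the `z` integral. -/
lemma Represents.tendsto_layer_freqAverage (hσ : 0 ≤ σ) (h : Represents σ g a ψ)
    {Ψ : ℝ × ℝ → ℂ} (hΨ : ContinuousOn Ψ (Ici (1 : ℝ) ×ˢ univ))
    (hψΨ : ∀ z : ℝ, ∀ᵐ r ∂radial, ψ z r = Ψ (r, z)) (hΨ1 : ∀ z : ℝ, Ψ (1, z) = 0)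
    (hβ : ContDiff ℝ ∞ β) (hs : HasCompactSupport β) :
    Tendsto (fun n : ℕ => ∫ r, ((freqAverage β g a : WLinf σ) : Profile) r * layer ((n : ℝ) + 1)⁻¹ r ∂radial)
      atTop (𝓝 0) := by
  obtain ⟨χ, hχ⟩ := exists_schwartz_wave hβ hs
  have hG := continuous_fourierSum h.integrable h.summable
  let L : ℕ → WLinf σ →L[ℂ] ℂ := fun n => profilePairing hσ (integrable_layer ((n : ℝ) + 1)⁻¹)
  have hL : ∀ n, ‖L n‖ ≤ 1 := fun n =>
    (norm_profilePairing_le hσ _).trans_eq (integral_norm_layer (by positivity))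
  have e : ∀ n : ℕ, ∫ r, ((freqAverage β g a : WLinf σ) : Profile) r * layer ((n : ℝ) + 1)⁻¹ r ∂radial =
      ∫ z, χ z * L n (fourierSum g a z) := fun n =>
    clm_freqAverage (L n) h.integrable h.summable χ.continuous χ.integrable hχ
  simp_rw [e]
  have hlim := tendsto_integral_of_dominated_convergence
    (F := fun n z => χ z * L n (fourierSum g a z)) (f := fun _ => (0 : ℂ)) (μ := volume)
    (fun z => ‖χ z‖ * (‖fourierNorm‖ * (∫ ζ, ‖g ζ‖) + ∑' m, ‖a m‖))
    (fun n => (χ.continuous.mul ((L n).continuous.comp hG)).aestronglyMeasurable)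
    (χ.integrable.norm.mul_const _) (fun n => ae_of_all _ fun z => by
      rw [norm_mul]
      refine mul_le_mul_of_nonneg_left (((L n).le_opNorm _).trans ?_) (norm_nonneg _)
      exact (mul_le_of_le_one_left (norm_nonneg _) (hL n)).trans (norm_fourierSum_le h.summable z))
    (ae_of_all _ fun z => by
      have hc : ContinuousOn (fun r => Ψ (r, z)) (Ici 1) :=
        hΨ.comp (by fun_prop) fun r hr => ⟨hr, mem_univ _⟩
      have h1 : ((fourierSum g a z : WLinf σ) : Profile) =ᵐ[radial] fun r => Ψ (r, z) := by
        filter_upwards [hψΨ z] with r hr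
        rw [← hr, h.eq, fourierX_eq]
      have h2 := tendsto_layer hc h1
      rw [hΨ1] at h2
      have h3 := h2.const_mul (χ z)
      rw [mul_zero] at h3
      exact h3)
  simpa using hlim

/-- The averages of a weak solution of the homogeneous problem are solutions of
Dirichlet problems. -/
lemma Represents.exists_radialSolution (hσ : 0 < σ) (h : Represents σ g a ψ)
    (h0 : ∀ φ, IsTest φ → pairing ψ (streamTest φ) = 0)
    (hb : ∃ Ψ : ℝ × ℝ → ℂ, ContinuousOn Ψ (Ici (1 : ℝ) ×ˢ univ) ∧
      (∀ z : ℝ, ∀ᵐ r ∂radial, ψ z r = Ψ (r, z)) ∧ ∀ z : ℝ, Ψ (1, z) = 0)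
    (hβ : ContDiff ℝ ∞ β) (hs : HasCompactSupport β) :
    ∃ Y X, RadialSolution 0
      (fun r => -((freqAverage (fun ζ => (ζ : ℂ) ^ 2 * β ζ) g a : WLinf σ) : Profile) r) Y X ∧
      ((freqAverage β g a : WLinf σ) : Profile) =ᵐ[radial] Y ∧ Y 1 = 0 ∧ Tendsto Y atTop (𝓝 0) := by
  obtain ⟨Ψ, hΨ, hψΨ, hΨ1⟩ := hb
  obtain ⟨Y, X, hS, hY⟩ := exists_radialSolution_of_weak (isBddRadial_coe hσ.le _)
    (isBddRadial_coe hσ.le _) fun α hα => h.freqAverage_weak hσ.le h0 hβ hs hα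
  refine ⟨Y, X, hS, hY, ?_, ?_⟩
  · exact tendsto_nhds_unique (tendsto_layer hS.contY.continuousOn hY)
      (h.tendsto_layer_freqAverage hσ.le hΨ hψΨ hΨ1 hβ hs)
  -- The decay bound holds almost everywhere. The positive part of the excess is continuous and
  -- vanishes almost everywhere, hence vanishes everywhere on `(1, ∞)`.
  · have hc : ContinuousOn (fun r : ℝ => max (‖Y r‖ - ‖freqAverage β g a‖ * r ^ (-σ)) 0)
        (Ioi 1) := by
      refine ContinuousOn.sup (hS.contY.norm.continuousOn.sub (continuousOn_const.mul
        ((continuousOn_rpow_Ici _).mono Ioi_subset_Ici_self))) continuousOn_const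
    have hae : (fun r : ℝ => max (‖Y r‖ - ‖freqAverage β g a‖ * r ^ (-σ)) 0) =ᵐ[radial]
        fun _ => 0 := by
      filter_upwards [hY, WLinf.ae_norm_le (freqAverage β g a)] with r h1 h2
      rw [h1] at h2
      exact max_eq_right (by linarith)
    have heq := Measure.eqOn_open_of_ae_eq hae isOpen_Ioi hc continuousOn_const
    refine squeeze_zero_norm' (a := fun r : ℝ => ‖freqAverage β g a‖ * r ^ (-σ)) ?_ ?_
    · filter_upwards [eventually_gt_atTop 1] with r hr
      have h1 : max (‖Y r‖ - ‖freqAverage β g a‖ * r ^ (-σ)) 0 = 0 := heq hr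
      have h2 := le_max_left (‖Y r‖ - ‖freqAverage β g a‖ * r ^ (-σ)) 0
      linarith
    · simpa using (tendsto_rpow_neg_atTop hσ).const_mul ‖freqAverage β g a‖

end Uniqueness

/-! ### Vanishing of the spectral measure of a homogeneous solution. -/

section Uniqueness

variable {σ : ℝ} {g : ℝ → WLinf σ} {a : ℤ → WLinf σ} {ψ : AxiField} {β : ℝ → ℂ}

/-- A field all of whose averages solve Dirichlet problems for the homogeneous equation. -/
structure IsHomogeneous (g : ℝ → WLinf σ) (a : ℤ → WLinf σ) : Prop where
  integrable : Integrable g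
  summable : Summable fun m => ‖a m‖
  solution : ∀ {β : ℝ → ℂ}, ContDiff ℝ ∞ β → HasCompactSupport β →
    ∃ Y X, RadialSolution 0
      (fun r => -((freqAverage (fun ζ => (ζ : ℂ) ^ 2 * β ζ) g a : WLinf σ) : Profile) r) Y X ∧
      ((freqAverage β g a : WLinf σ) : Profile) =ᵐ[radial] Y ∧ Y 1 = 0 ∧ Tendsto Y atTop (𝓝 0)

namespace IsHomogeneous

/-- Adding `k Y` to both sides of the equation for the average gives the resolvent equation at `k`,
with source `k` times the average of `(1 - ζ²/k) β`. The resolvent bound `1/k` cancels the factor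
`k`. -/
lemma norm_freqAverage_le_shift (h : IsHomogeneous g a) (hσ0 : 0 < σ) (hσ1 : σ < 1)
    (hβ : ContDiff ℝ ∞ β) (hs : HasCompactSupport β) {k : ℝ} (hk : 0 < k) :
    ‖freqAverage β g a‖ ≤ ‖freqAverage (fun ζ => ((1 - ζ ^ 2 / k : ℝ) : ℂ) * β ζ) g a‖ := by
  obtain ⟨Y, X, hS, hY, h1, hlim⟩ := h.solution hβ hs
  obtain ⟨v, hv⟩ : ∃ v, v = freqAverage (fun ζ => ((1 - ζ ^ 2 / k : ℝ) : ℂ) * β ζ) g a := ⟨_, rfl⟩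
  rw [← hv]
  have hk0 : (k : ℂ) ≠ 0 := by exact_mod_cast hk.ne'
  have hlin : freqAverage β g a = v +
      ((k : ℂ)⁻¹) • freqAverage (fun ζ => (ζ : ℂ) ^ 2 * β ζ) g a := by
    have hq : ContDiff ℝ ∞ fun ζ : ℝ => ((1 - ζ ^ 2 / k : ℝ) : ℂ) :=
      Complex.ofRealCLM.contDiff.comp
        (contDiff_const.sub ((contDiff_id.pow 2).div_const k) : ContDiff ℝ ∞ fun ζ => 1 - ζ ^ 2 / k)
    rw [hv, ← freqAverage_const_mul, ← freqAverage_add h.integrable h.summable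
      (hq.mul hβ).continuous hs.mul_left
      (contDiff_const.mul (contDiff_sq_mul hβ)).continuous hs.mul_left.mul_left]
    congr 1
    funext ζ
    push_cast
    field_simp
    ring
  have hS' := (hS.shift k).congr_rhs (g := fun r => (k : ℂ) * (v : Profile) r) (by
    have h2 := WLinf.coe_add v ((k : ℂ)⁻¹ • freqAverage (fun ζ => (ζ : ℂ) ^ 2 * β ζ) g a)
    rw [← hlin] at h2
    filter_upwards [h2, WLinf.coe_smul (k : ℂ)⁻¹
      (freqAverage (fun ζ => (ζ : ℂ) ^ 2 * β ζ) g a), hY] with r h3 h4 h5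
    simp only [Pi.add_apply, Pi.smul_apply, smul_eq_mul, sub_zero]
    rw [← h5, h3, h4]
    field_simp
    ring)
  refine WLinf.norm_le (norm_nonneg v) ?_
  have hb : ∀ᵐ r ∂radial, ‖(k : ℂ) * (v : Profile) r‖ ≤ k * ‖v‖ * r ^ (-σ) := by
    filter_upwards [WLinf.ae_norm_le v] with r hr
    rw [norm_mul, Complex.norm_real, Real.norm_of_nonneg hk.le, mul_assoc]
    exact mul_le_mul_of_nonneg_left hr hk.le
  filter_upwards [hY, ae_restrict_mem measurableSet_Ioi] with r hr hr1
  rw [hr]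
  refine (hS'.norm_le_div hσ0 hσ1 hk h1 hlim (by positivity) hb (le_of_lt hr1)).trans_eq ?_
  rw [mul_div_cancel_left₀ _ hk.ne']

/-- Iterating the shift with `k = N²`, where `N` exceeds every frequency in the support, multiplies
`β` by powers of `1 - ζ²/N²`. The support also keeps a distance `ε` from zero, so these powers decay
like `q^n`; the total mass of the measure is finite and the bound tends to zero. -/
lemma freqAverage_eq_zero (h : IsHomogeneous g a) (hσ0 : 0 < σ) (hσ1 : σ < 1)
    (hβ : ContDiff ℝ ∞ β) (hs : HasCompactSupport β) (h0 : tsupport β ⊆ {0}ᶜ) :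
    freqAverage β g a = 0 := by
  obtain ⟨R, hR⟩ := hs.isCompact.isBounded.subset_closedBall (0 : ℝ)
  obtain ⟨ε, hε, hεs⟩ := Metric.isOpen_iff.1 (isClosed_tsupport β).isOpen_compl 0
    fun hm => h0 hm rfl
  -- Larger than all `|ζ|` in the support, and than `ε`, so that `q` lies in `[0, 1)`.
  set N : ℝ := |R| + ε + 1 with hN
  have hN0 : 0 < N := by positivity
  set q : ℝ := 1 - ε ^ 2 / N ^ 2 with hq
  have hεN : ε < N := by linarith [abs_nonneg R]
  have hq0 : 0 ≤ q := by
    rw [hq, sub_nonneg, div_le_one (by positivity)]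
    exact pow_le_pow_left₀ hε.le hεN.le 2
  have hq1 : q < 1 := by
    have : 0 < ε ^ 2 / N ^ 2 := by positivity
    linarith
  have hbound : ∀ ζ, β ζ ≠ 0 → |1 - ζ ^ 2 / N ^ 2| ≤ q := fun ζ hζ => by
    have h1 : ζ ∈ tsupport β := subset_tsupport β hζ
    have h2 : |ζ| ≤ R := by simpa using hR h1
    have h3 : ε ≤ |ζ| := by
      by_contra! h4
      exact hεs (by simpa using h4) h1
    have h5 : |ζ| ≤ N := by linarith [le_abs_self R]
    have h6 : ε ^ 2 / N ^ 2 ≤ ζ ^ 2 / N ^ 2 := by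
      rw [← sq_abs ζ]
      gcongr
    have h7 : ζ ^ 2 / N ^ 2 ≤ 1 := by
      rw [← sq_abs ζ, div_le_one (by positivity)]
      exact pow_le_pow_left₀ (abs_nonneg ζ) h5 2
    rw [abs_of_nonneg (by linarith)]
    linarith
  have hqs : ContDiff ℝ ∞ fun ζ : ℝ => ((1 - ζ ^ 2 / N ^ 2 : ℝ) : ℂ) :=
    Complex.ofRealCLM.contDiff.comp (contDiff_const.sub ((contDiff_id.pow 2).div_const (N ^ 2)) :
      ContDiff ℝ ∞ fun ζ => 1 - ζ ^ 2 / N ^ 2)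
  let B : ℕ → ℝ → ℂ := fun n ζ => ((1 - ζ ^ 2 / N ^ 2 : ℝ) : ℂ) ^ n * β ζ
  have hB : ∀ n, ContDiff ℝ ∞ (B n) := fun n => (hqs.pow n).mul hβ
  have hBs : ∀ n, HasCompactSupport (B n) := fun n => hs.mul_left
  have hiter : ∀ n, ‖freqAverage β g a‖ ≤ ‖freqAverage (B n) g a‖ := by
    intro n
    induction n with
    | zero => simp [B]
    | succ n ih =>
      refine ih.trans ((h.norm_freqAverage_le_shift hσ0 hσ1 (hB n) (hBs n)
        (by positivity : 0 < N ^ 2)).trans_eq ?_)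
      congr 2
      funext ζ
      simp only [B]
      ring
  obtain ⟨b, hb⟩ := hs.exists_bound_of_continuous hβ.continuous
  have hb0 : 0 ≤ b := (norm_nonneg _).trans (hb 0)
  have hBn : ∀ n ζ, ‖B n ζ‖ ≤ q ^ n * b := fun n ζ => by
    by_cases hζ : β ζ = 0
    · simp only [B, hζ, mul_zero, norm_zero]
      positivity
    · rw [norm_mul, norm_pow, Complex.norm_real, Real.norm_eq_abs]
      exact mul_le_mul (pow_le_pow_left₀ (abs_nonneg _) (hbound ζ hζ) n) (hb ζ) (norm_nonneg _)
        (by positivity)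
  have hle : ∀ n : ℕ, ‖freqAverage β g a‖ ≤
      q ^ n * b * (‖fourierNorm‖ * (∫ ζ, ‖g ζ‖) + ∑' m, ‖a m‖) := fun n =>
    (hiter n).trans (norm_freqAverage_le h.integrable h.summable (hBn n))
  have ht : Tendsto (fun n : ℕ => q ^ n * b * (‖fourierNorm‖ * (∫ ζ, ‖g ζ‖) + ∑' m, ‖a m‖)) atTop
      (𝓝 0) := by
    simpa using ((tendsto_pow_atTop_nhds_zero_of_lt_one hq0 hq1).mul_const b).mul_const
      (‖fourierNorm‖ * (∫ ζ, ‖g ζ‖) + ∑' m, ‖a m‖)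
  exact norm_le_zero_iff.1 (ge_of_tendsto' ht hle)

lemma fourierNorm_ne_zero : fourierNorm ≠ 0 := by
  have : (0 : ℝ) < (Real.sqrt (2 * Real.pi))⁻¹ := by positivity
  exact Complex.ofReal_ne_zero.2 this.ne'

/-- Tests supported away from the integers see none of the atoms and avoid `ζ = 0`, itself an
integer; what is left of the average is the integral against `g`. -/
lemma density_eq_zero (h : IsHomogeneous g a) (hσ0 : 0 < σ) (hσ1 : σ < 1) :
    g =ᵐ[volume] 0 := by
  have hU : IsOpen (range ((↑) : ℤ → ℝ))ᶜ :=
    Int.isClosedEmbedding_coe_real.isClosed_range.isOpen_compl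
  have hae : ∀ᵐ ζ : ℝ, ζ ∈ (range ((↑) : ℤ → ℝ))ᶜ :=
    compl_mem_ae_iff.2 ((countable_range _).measure_zero volume)
  have key := hU.ae_eq_zero_of_integral_contDiff_smul_eq_zero (μ := volume) (f := g)
    (h.integrable.locallyIntegrable.locallyIntegrableOn _) fun β hβ hs hsub => by
      have hs' : HasCompactSupport fun ζ => (β ζ : ℂ) :=
        hs.comp_left (g := ((↑) : ℝ → ℂ)) Complex.ofReal_zero
      have hsub' : tsupport (fun ζ => (β ζ : ℂ)) ⊆ (range ((↑) : ℤ → ℝ))ᶜ :=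
        (tsupport_comp_subset (g := ((↑) : ℝ → ℂ)) Complex.ofReal_zero β).trans hsub
      have h1 := h.freqAverage_eq_zero hσ0 hσ1 (Complex.ofRealCLM.contDiff.comp hβ) hs'
        (hsub'.trans (compl_subset_compl.2 (singleton_subset_iff.2 ⟨0, by simp⟩)))
      have h2 : ∀ m : ℤ, β (-(m : ℝ)) = 0 := fun m =>
        image_eq_zero_of_notMem_tsupport fun hm => hsub hm ⟨-m, by simp⟩
      simp only [freqAverage, Function.comp, Complex.ofRealCLM_apply, h2, Complex.ofReal_zero,
        zero_smul, tsum_zero, add_zero, smul_eq_zero, fourierNorm_ne_zero, false_or] at h1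
      simpa only [Complex.coe_smul] using h1
  filter_upwards [key, hae] with ζ h1 h2
  exact h1 h2

/-- A smooth bump at the integer `-m`. -/
lemma exists_bump (m : ℤ) : ∃ β : ℝ → ℂ, ContDiff ℝ ∞ β ∧ HasCompactSupport β ∧
    β (-(m : ℝ)) = 1 ∧ (∀ n : ℤ, n ≠ m → β (-(n : ℝ)) = 0) ∧
    (m ≠ 0 → tsupport β ⊆ {0}ᶜ) := by
  let b : ContDiffBump (-(m : ℝ)) := ⟨1 / 4, 1 / 2, by norm_num, by norm_num⟩
  have hdist : ∀ n : ℤ, n ≠ m → ¬dist (-(n : ℝ)) (-(m : ℝ)) ≤ 1 / 2 := fun n hn hd => by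
    rw [dist_neg_neg, Real.dist_eq] at hd
    have h1 : (1 : ℤ) ≤ |n - m| := Int.one_le_abs (sub_ne_zero.2 hn)
    have h2 : (1 : ℝ) ≤ |(n : ℝ) - m| := by exact_mod_cast h1
    linarith
  refine ⟨fun ζ => (b ζ : ℂ), Complex.ofRealCLM.contDiff.comp b.contDiff,
    b.hasCompactSupport.comp_left (g := ((↑) : ℝ → ℂ)) Complex.ofReal_zero, ?_, fun n hn => ?_,
    fun hm ζ hζ h0 => ?_⟩
  · have : b (-(m : ℝ)) = 1 := b.one_of_mem_closedBall (by simp [b.rIn_pos.le])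
    simp [this]
  · have : b (-(n : ℝ)) = 0 := b.zero_of_le_dist (not_le.1 (hdist n hn)).le
    simp [this]
  · have h1 := tsupport_comp_subset (g := ((↑) : ℝ → ℂ)) Complex.ofReal_zero b hζ
    rw [b.tsupport_eq] at h1
    have h2 : dist ζ (-(m : ℝ)) ≤ 1 / 2 := h1
    have h3 : ζ = 0 := h0
    rw [h3] at h2
    exact hdist 0 hm.symm (by simpa using h2)

lemma freqAverage_of_density (hg : g =ᵐ[volume] 0) {m : ℤ}
    (hβ : ∀ n : ℤ, n ≠ m → β (-(n : ℝ)) = 0) : freqAverage β g a = β (-(m : ℝ)) • a m := by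
  have h1 : ∫ ζ, β ζ • g ζ = 0 := by
    refine (integral_congr_ae ?_).trans (integral_zero ℝ (WLinf σ))
    filter_upwards [hg] with ζ hζ
    rw [hζ, Pi.zero_apply, smul_zero]
  rw [freqAverage, h1, smul_zero, zero_add]
  exact tsum_eq_single m fun n hn => by rw [hβ n hn, zero_smul]

/-- Once the density is gone, a bump at `-m` isolates the atom `a m`. For `m = 0` the factor `ζ²`
annihilates the only atom seen, so `a 0` solves the Dirichlet problem at frequency zero without
source. -/
lemma coeff_eq_zero (h : IsHomogeneous g a) (hσ0 : 0 < σ) (hσ1 : σ < 1) (m : ℤ) : a m = 0 := by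
  have hg := h.density_eq_zero hσ0 hσ1
  obtain ⟨β, hβ, hs, h1, h2, h3⟩ := exists_bump m
  have e := freqAverage_of_density (a := a) hg h2
  rw [h1, one_smul] at e
  by_cases hm : m = 0
  · obtain ⟨Y, X, hS, hY, hY1, hlim⟩ := h.solution hβ hs
    have e2 : freqAverage (fun ζ : ℝ => (ζ : ℂ) ^ 2 * β ζ) g a = 0 := by
      rw [freqAverage_of_density (m := m) hg fun n hn => by rw [h2 n hn, mul_zero], hm]
      simp
    have hS0 := hS.congr_rhs (g := fun _ => 0) (by
      rw [e2]
      filter_upwards [AEEqFun.coeFn_zero (μ := radial) (β := ℂ)] with r hr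
      exact neg_eq_zero.2 hr)
    refine norm_le_zero_iff.1 (WLinf.norm_le le_rfl ?_)
    filter_upwards [hY, ae_restrict_mem measurableSet_Ioi] with r hr hr1
    rw [← e, hr]
    -- The source is zero, so `M = 0` and any exponent in `(2, 3)` serves.
    refine (hS0.norm_stream_le (ρ := 5 / 2) (M := 0) (by norm_num) (by norm_num) le_rfl hY1 hlim
      le_rfl (ae_of_all _ fun r => by simp) (le_of_lt hr1)).trans_eq ?_
    simp
  · rw [← e]
    exact h.freqAverage_eq_zero hσ0 hσ1 hβ hs (h3 hm)

end IsHomogeneous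

lemma Represents.eq_zero_of_stream (hσ0 : 0 < σ) (hσ1 : σ < 1) (h : Represents σ g a ψ)
    (h0 : ∀ φ, IsTest φ → pairing ψ (streamTest φ) = 0)
    (hb : ∃ Ψ : ℝ × ℝ → ℂ, ContinuousOn Ψ (Ici (1 : ℝ) ×ˢ univ) ∧
      (∀ z : ℝ, ∀ᵐ r ∂radial, ψ z r = Ψ (r, z)) ∧ ∀ z : ℝ, Ψ (1, z) = 0) : ψ = 0 := by
  have hH : IsHomogeneous g a :=
    ⟨h.integrable, h.summable, fun hβ hs => h.exists_radialSolution hσ0 h0 hb hβ hs⟩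
  have hg := hH.density_eq_zero hσ0 hσ1
  funext z
  have e : fourierX σ g a z = 0 := by
    have h1 : ∫ ζ, wave ζ z • g ζ = 0 := by
      refine (integral_congr_ae ?_).trans (integral_zero ℝ (WLinf σ))
      filter_upwards [hg] with ζ hζ
      rw [hζ, Pi.zero_apply, smul_zero]
    rw [fourierX_eq, fourierSum, h1]
    simp [hH.coeff_eq_zero hσ0 hσ1]
  rw [h.eq, e]
  rfl

lemma IsStreamFunction.unique {w ψ' : AxiField} (hσ0 : 0 < σ) (hσ1 : σ < 1) (hψ : MemFX σ ψ)
    (hψ' : MemFX σ ψ') (h : IsStreamFunction w ψ) (h' : IsStreamFunction w ψ') : ψ = ψ' := by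
  obtain ⟨g, a, hR⟩ := hψ
  obtain ⟨g', a', hR'⟩ := hψ'
  refine sub_eq_zero.1 ((hR.sub hR').eq_zero_of_stream hσ0 hσ1 (fun φ hφ => ?_) ?_)
  · rw [hR.pairing_sub hσ0.le hR' hφ.streamTest.plane]
    exact sub_eq_zero.2 ((h.equation hφ.toTestFunction).trans
      (h'.equation hφ.toTestFunction).symm)
  · obtain ⟨Ψ, c, e, z⟩ := h.boundary
    obtain ⟨Ψ', c', e', z'⟩ := h'.boundary
    refine ⟨Ψ - Ψ', c.sub c', fun t => ?_, fun t => ?_⟩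
    · filter_upwards [e t, e' t, AEEqFun.coeFn_sub (ψ t) (ψ' t)] with r h1 h2 h3
      rw [Pi.sub_apply, Pi.sub_apply, h3, Pi.sub_apply, h1, h2]
    · rw [Pi.sub_apply, z, z', sub_zero]

end Uniqueness

/-! ### Assembly: existence, uniqueness, and passage to the infimum norm. -/

section Conclusion

variable {ρ : ℝ} (hρ2 : 2 < ρ) (hρ3 : ρ < 3)

lemma IsMultiplier.memFX {σ C : ℝ} {A : ℝ → WLinf ρ →L[ℂ] WLinf σ} (hA : IsMultiplier C A)
    {g : ℝ → WLinf ρ} {a : ℤ → WLinf ρ} {w : AxiField} (h : Represents ρ g a w) :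
    MemFX σ (multField A g a) :=
  ⟨_, _, hA.represents h.integrable h.summable⟩

include hρ2 hρ3

lemma existsUnique_stream {w : AxiField} (hw : MemFX ρ w) :
    ∃! ψ : AxiField, MemFX (ρ - 2) ψ ∧ IsStreamFunction w ψ := by
  obtain ⟨g, a, h⟩ := hw
  have hm := (isMultiplier_streamOp hρ2 hρ3).memFX h
  have hs := isStreamFunction_multField hρ2 hρ3 h
  exact ⟨_, ⟨hm, hs⟩, fun ψ hψ => hψ.2.unique (by linarith) (by linarith) hψ.1 hm hs⟩

/-- Every solution is given by the multipliers, whatever the representation of `w`. -/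
lemma eq_multField {g : ℝ → WLinf ρ} {a : ℤ → WLinf ρ} {w ψ Vr Vz : AxiField}
    (h : Represents ρ g a w) (hψ : MemFX (ρ - 2) ψ) (hs : IsStreamFunction w ψ)
    (hr : MemFX (ρ - 1) Vr) (hz : MemFX (ρ - 1) Vz) (hV : IsBiotSavart ψ Vr Vz) :
    Vr = multField (radialOp hρ2 hρ3) g a ∧ Vz = multField (verticalOp hρ2 hρ3) g a := by
  have e : ψ = multField (streamOp hρ2 hρ3) g a :=
    hs.unique (by linarith) (by linarith) hψ ((isMultiplier_streamOp hρ2 hρ3).memFX h)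
      (isStreamFunction_multField hρ2 hρ3 h)
  subst e
  exact IsBiotSavart.unique (by linarith) hr hz ((isMultiplier_radialOp hρ2 hρ3).memFX h)
    ((isMultiplier_verticalOp hρ2 hρ3).memFX h) hV
    (isBiotSavart_multField hρ2 hρ3 h.integrable h.summable)

lemma existsUnique_velocity {w ψ : AxiField} (hw : MemFX ρ w) (hψ : MemFX (ρ - 2) ψ)
    (hs : IsStreamFunction w ψ) : ∃! V : AxiField × AxiField,
      MemFX (ρ - 1) V.1 ∧ MemFX (ρ - 1) V.2 ∧ IsBiotSavart ψ V.1 V.2 := by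
  obtain ⟨g, a, h⟩ := hw
  have e : ψ = multField (streamOp hρ2 hρ3) g a :=
    hs.unique (by linarith) (by linarith) hψ ((isMultiplier_streamOp hρ2 hρ3).memFX h)
      (isStreamFunction_multField hρ2 hρ3 h)
  refine ⟨(multField (radialOp hρ2 hρ3) g a, multField (verticalOp hρ2 hρ3) g a),
    ⟨(isMultiplier_radialOp hρ2 hρ3).memFX h, (isMultiplier_verticalOp hρ2 hρ3).memFX h, ?_⟩,
    fun V hV => ?_⟩
  · rw [e]
    exact isBiotSavart_multField hρ2 hρ3 h.integrable h.summable
  · obtain ⟨h1, h2⟩ := eq_multField hρ2 hρ3 h hψ hs hV.1 hV.2.1 hV.2.2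
    exact Prod.ext h1 h2

end Conclusion

/-- A bound valid for every representation passes to the infimum, so injectivity of the Fourier
transform on these measures is not needed. -/
lemma le_mul_fxNorm {ρ C S : ℝ} (hC : 0 < C) {w : AxiField} (hw : MemFX ρ w)
    (h : ∀ g a, Represents ρ g a w → S ≤ C * ((∫ ζ, ‖g ζ‖) + ∑' m, ‖a m‖)) :
    S ≤ C * fxNorm ρ w := by
  obtain ⟨g, a, hR⟩ := hw
  rw [← div_le_iff₀' hC]
  refine le_csInf ⟨_, g, a, hR, rfl⟩ ?_
  rintro N ⟨g', a', hR', rfl⟩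
  rw [div_le_iff₀' hC]
  exact h g' a' hR'

lemma IsWeakDr.unique {σ : ℝ} (hσ : 0 ≤ σ) {u v v' : AxiField} (hv : MemFX σ v)
    (hv' : MemFX σ v') (h : IsWeakDr u v) (h' : IsWeakDr u v') : v = v' :=
  hv.eq_of_pairing hσ hv' fun _ hφ => (h hφ.toTestFunction).trans (h' hφ.toTestFunction).symm

lemma IsWeakDz.unique {σ : ℝ} (hσ : 0 ≤ σ) {u v v' : AxiField} (hv : MemFX σ v)
    (hv' : MemFX σ v') (h : IsWeakDz u v) (h' : IsWeakDz u v') : v = v' :=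
  hv.eq_of_pairing hσ hv' fun _ hφ => (h hφ.toTestFunction).trans (h' hφ.toTestFunction).symm

end AxiBiotSavart

end

open AxiBiotSavart
theorem corollary3p3 (ρ : ℝ) (hρ2 : 2 < ρ) (hρ3 : ρ < 3) :
    (∀ ω : AxiField, MemFX ρ ω →
      (∃! ψ : AxiField, MemFX (ρ - 2) ψ ∧ IsStreamFunction ω ψ) ∧
      ∀ ψ : AxiField, MemFX (ρ - 2) ψ → IsStreamFunction ω ψ →
        ∃! V : AxiField × AxiField,
          MemFX (ρ - 1) V.1 ∧ MemFX (ρ - 1) V.2 ∧ IsBiotSavart ψ V.1 V.2) ∧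
    ∃ C : ℝ, ∀ ω ψ Vr Vz : AxiField, MemFX ρ ω →
      MemFX (ρ - 2) ψ → IsStreamFunction ω ψ →
      MemFX (ρ - 1) Vr → MemFX (ρ - 1) Vz → IsBiotSavart ψ Vr Vz →
      fxNorm (ρ - 1) Vr + fxNorm (ρ - 1) Vz ≤ C * fxNorm ρ ω ∧
      ∃ drVr dzVr drVz dzVz : AxiField,
        IsWeakDr Vr drVr ∧ IsWeakDz Vr dzVr ∧ IsWeakDr Vz drVz ∧ IsWeakDz Vz dzVz ∧
        MemFX ρ drVr ∧ MemFX ρ dzVr ∧ MemFX ρ drVz ∧ MemFX ρ dzVz ∧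
        fxNorm ρ drVr + fxNorm ρ dzVr + fxNorm ρ drVz + fxNorm ρ dzVz ≤ C * fxNorm ρ ω := by
  -- The constant is the sum of the four multiplier bounds for the derivatives, `2`, `1`, `1` and
  -- `1` times `opConst ρ` plus the `1` from the source in `∂_r 𝒱^z`; the velocity needs only twice
  -- `opConst ρ`.
  refine ⟨fun ω hω => ⟨existsUnique_stream hρ2 hρ3 hω,
    fun ψ hψ hs => existsUnique_velocity hρ2 hρ3 hω hψ hs⟩, 5 * opConst ρ + 1,
    fun ω ψ Vr Vz hω hψ hs hr hz hV => ?_⟩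
  have hC := opConst_pos hρ2 hρ3
  have hC' : 0 < 5 * opConst ρ + 1 := by linarith
  have hρ0 : 0 ≤ ρ := by linarith
  have mr := isMultiplier_radialOp hρ2 hρ3
  have mz := isMultiplier_verticalOp hρ2 hρ3
  have m₁ := isMultiplier_drRadialOp hρ2 hρ3
  have m₂ := isMultiplier_dzRadialOp hρ2 hρ3
  have m₃ := isMultiplier_drVerticalOp hρ2 hρ3
  have m₄ := isMultiplier_dzVerticalOp hρ2 hρ3
  refine ⟨le_mul_fxNorm hC' hω fun g a h => ?_, ?_⟩
  · obtain ⟨e₁, e₂⟩ := eq_multField hρ2 hρ3 h hψ hs hr hz hV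
    have b₁ := mr.fxNorm_le h.integrable h.summable
    have b₂ := mz.fxNorm_le h.integrable h.summable
    have hN : 0 ≤ (∫ ζ, ‖g ζ‖) + ∑' m, ‖a m‖ :=
      add_nonneg (integral_nonneg fun _ => norm_nonneg _) (tsum_nonneg fun _ => norm_nonneg _)
    rw [e₁, e₂]
    nlinarith
  · obtain ⟨g, a, h⟩ := id hω
    obtain ⟨e₁, e₂⟩ := eq_multField hρ2 hρ3 h hψ hs hr hz hV
    have d₁ := isWeakDr_radial hρ2 hρ3 h.integrable h.summable
    have d₂ := isWeakDz_radial hρ2 hρ3 h.integrable h.summable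
    have d₃ := isWeakDr_vertical hρ2 hρ3 h.integrable h.summable
    have d₄ := isWeakDz_vertical hρ2 hρ3 h.integrable h.summable
    rw [← e₁] at d₁ d₂
    rw [← e₂] at d₃ d₄
    refine ⟨_, _, _, _, d₁, d₂, d₃, d₄, m₁.memFX h, m₂.memFX h, m₃.memFX h, m₄.memFX h,
      le_mul_fxNorm hC' hω fun g' a' h' => ?_⟩
    -- The derivative fields were built from one fixed representation `(g, a)`. Uniqueness of weak
    -- derivatives identifies them with those built from the arbitrary `(g', a')`, for which the
    -- bound is then available.
    obtain ⟨e₁', e₂'⟩ := eq_multField hρ2 hρ3 h' hψ hs hr hz hV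
    have d₁' := isWeakDr_radial hρ2 hρ3 h'.integrable h'.summable
    have d₂' := isWeakDz_radial hρ2 hρ3 h'.integrable h'.summable
    have d₃' := isWeakDr_vertical hρ2 hρ3 h'.integrable h'.summable
    have d₄' := isWeakDz_vertical hρ2 hρ3 h'.integrable h'.summable
    rw [← e₁'] at d₁' d₂'
    rw [← e₂'] at d₃' d₄'
    rw [d₁.unique hρ0 (m₁.memFX h) (m₁.memFX h') d₁', d₂.unique hρ0 (m₂.memFX h) (m₂.memFX h') d₂',
      d₃.unique hρ0 (m₃.memFX h) (m₃.memFX h') d₃', d₄.unique hρ0 (m₄.memFX h) (m₄.memFX h') d₄']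
    have b₁ := m₁.fxNorm_le h'.integrable h'.summable
    have b₂ := m₂.fxNorm_le h'.integrable h'.summable
    have b₃ := m₃.fxNorm_le h'.integrable h'.summable
    have b₄ := m₄.fxNorm_le h'.integrable h'.summable
    linarith
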